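/- **Setting.** Let $\mathbb T$ be the unit circle in $\mathbb C$ (with Euclidean distance), $h(z)=z^2$, $\alpha\in\mathbb T$, and let $\star_1,\star_2$ be the roots of $z^2=\alpha$, ordered counterclockwise from $1$. Let $L$, $R$ denote the open semicircles running counterclockwise from $\star_1$ to $\star_2$ and from $\star_2$ to $\star_1$. The itinerary $I^\alpha(x)\in\{L,R,\star\}^{\infty}$ has $n$-th digit $L$, $R$ or $\star$ according to whether $h^{n-1}(x)$ lies in the semicircle $L$, in the semicircle $R$, or in $\{\star_1,\star_2\}$. Write $x\approx_\alpha y$ if for every $n$ either $I^\alpha(x)[n]=I^\alpha(y)[n]$ or one of these two digits is $\star$. Let $\widetilde L,\widetilde R$ be the inverse branches of $h$ from $\mathbb T\setminus\{\alpha\}$ onto the semicircles, and $\widetilde u=\widetilde{u[1]}\circ\dots\circ\widetilde{u[n]}$ for a word $u\in\{L,R\}^n$. The angle $\alpha$ is *pre-periodic* if some $h^n(\alpha)$, $n\ge 0$, is periodic under $h$. **Strong recurrence.** A set $\mathcal R\subseteq\mathbb N$ is *$D$-rare* if $\#(\mathcal R\cap[i,i+D])\le 3$ for all $i$. Digit $i$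 of $I^\alpha(\alpha)|_{[1,n]}$ is *$(D,\mathcal R)$-duplicating* if there are $2\le a\le i\le b\le n$ with $b=n$ or $b-a+1>D$ such that $I^\alpha(\alpha)[k]=I^\alpha(\alpha)[k-a+1]$ for all $k\in[a,b]\setminus\mathcal R$. The angle $\alpha$ is *strongly recurrent* if for all integers $D>0$ and all real $\tau<1$ there are $n>D$ and a $D$-rare set $\mathcal R_n\subseteq\{1,\dots,n\}$ such that more than $\tau n$ of the digits $1,\dots,n$ of $I^\alpha(\alpha)|_{[1,n]}$ are $(D,\mathcal R_n)$-duplicating. **Generalized cylinder sets.** For $\alpha$ not periodic, let $l_u$ be the hyperbolic geodesic joining $\widetilde u(\star_1)$ and $\widetilde u(\star_2)$. The geodesics $l_u$ with $|u|=n$ are pairwise disjoint and cut the closed disc into pieces; $\mathcal{GCS}_n$ is the set of intersections of the (closed) pieces with $\mathbb T$. Let $C_\star$ be the union of $\{\star_1,\star_2\}$ and, for every $\beta\ne\alpha$ with $\beta\approx_\alpha\alpha$, of the closures of the images under $\widetilde L$ and $\widetilde R$ of the shorter open arc between $\alpha$ and $\beta$. For $K\in\mathbb N$ and $\delta>0$,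 call a family $\{C^K(x)\}_{x\in\mathbb T}$ a *$\delta$-inside covering of level $K$* if for every $x$: $C^K(x)\in\mathcal{GCS}_K\cup\mathcal{GCS}_{K+1}$, $x\in C^K(x)$, and $\operatorname{dist}(x,\widetilde g(C_\star))>\delta$ for every word $g$ with $\widetilde g(\{\star_1,\star_2\})\subseteq\partial C^K(x)$. **Nice gluing circuits.** Write $a\asymp_C b$ for $a\le Cb$ and $b\le Ca$. An *$(N,C,r)$-nice gluing circuit* consists of disjoint closed arcs in the counterclockwise order $A'_1,A_1,A'_2,A_2,\dots,A'_n,A_n$ on $\mathbb T$, with $1\le n\le N$ and indices cyclic modulo $n$, such that 1. for all $j$: $\operatorname{diam}(A_j\cup A'_j)\asymp_C r$ and $\operatorname{diam}A_j\asymp_C\operatorname{diam}(A_j\cup A'_j)\asymp_C\operatorname{diam}A'_j$; 2. there are Borel probability measures $\mu_j$ on $A_j$ and $\mu'_j$ on $A'_j$ whose push-forwards under $x\mapsto x/\operatorname{diam}A_j$, respectively $x\mapsto x/\operatorname{diam}A'_j$, have logarithmic energy $\iint-\log|x-y|\,d\mu(x)\,d\mu(y)$ at most $C$; 3. for all $j$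 there are Borel sets $B_j\subseteq A_j$ and $B'_{j+1}\subseteq A'_{j+1}$ of full $\mu_j$- and $\mu'_{j+1}$-measure and a measure-preserving bijection $\phi_j:B_j\to B'_{j+1}$ with $y\approx_\alpha\phi_j(y)$ for all $y\in B_j$. It is *around* $x$ if for some $j$ the point $x$ lies in the open arc that leads counterclockwise from the end of $A'_j$ to the beginning of $A_j$, and it is *in* $D\subseteq\mathbb T$ if all its arcs are contained in $D$. **Proposition.** Let $\alpha\in\mathbb T$ be neither strongly recurrent nor pre-periodic, and let $K\in\mathbb N$. Then there are $\delta>0$ and a $\delta$-inside covering $\{C^K(x)\}_{x\in\mathbb T}$ of level $K$. Moreover, for every $\delta>0$ there are $N\in\mathbb N$ and $C,r>0$ (depending only on $\alpha$, $K$, $\delta$) such that for every $\delta$-inside covering $\{C^K(x)\}_{x\in\mathbb T}$ of level $K$ and every $x\in\mathbb T$ there is an $(N,C,r)$-nice gluing circuit around $x$ in $C^K(x)$. -/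

import Mathlib

open MeasureTheory Set
open scoped ENNReal

noncomputable section

namespace QuadLam

/-! ### The circle, arcs, and the doubling map -/

/-- The angle in `[0, 2π)` that one travels counterclockwise from `a` to `b`. -/
def ccwAngle (a b : Circle) : ℝ :=
  toIcoMod Real.two_pi_pos 0 (Complex.arg ((b / a : Circle) : ℂ))

/-- The open arc from `a` counterclockwise to `b` (empty if `a = b`). -/
def ccwArc (a b : Circle) : Set Circle :=
  {z | 0 < ccwAngle a z ∧ ccwAngle a z < ccwAngle a b}

/-- The closed arc from `a` counterclockwise to `b` (equal to `{a}` if `a = b`). -/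
def ccwClosedArc (a b : Circle) : Set Circle :=
  {z | ccwAngle a z ≤ ccwAngle a b}

/-- The open proper arc `a ⌢ b` between two distinct points: the shorter one of the two arcs
that they bound; for antipodal points, the one going counterclockwise from `a` to `b`. -/
def properArc (a b : Circle) : Set Circle :=
  if ccwAngle a b ≤ Real.pi then ccwArc a b else ccwArc b a

/-- The angle-doubling map `h(z) = z²`. -/
def dbl (z : Circle) : Circle := z ^ 2

/-- `α` is pre-periodic: some forward image of `α` under `h` is periodic. -/
def IsPreperiodicAngle (α : Circle) : Prop :=
  ∃ n : ℕ, dbl^[n] α ∈ Function.periodicPts dbl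

/-! ### Itineraries -/

/-- The two letters `L = L₁`, `R = L₂`. -/
inductive Letter
  | L
  | R

/-- The two roots `⋆₁`, `⋆₂` of `z² = α`, ordered counterclockwise from `1`:
`starPt α L = ⋆₁` has angle in `[0, π)` and `starPt α R = ⋆₂ = -⋆₁`. -/
def starPt (α : Circle) : Letter → Circle
  | .L => Circle.exp (ccwAngle 1 α / 2)
  | .R => Circle.exp (ccwAngle 1 α / 2 + Real.pi)

/-- The open semicircles `⋆₁ ⌢ ⋆₂` (letter `L`) and `⋆₂ ⌢ ⋆₁` (letter `R`). -/
def semicircle (α : Circle) : Letter → Set Circle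
  | .L => ccwArc (starPt α .L) (starPt α .R)
  | .R => ccwArc (starPt α .R) (starPt α .L)

open Classical in
/-- The itinerary of `x`. The symbol `⋆` is `none`, and digits are numbered from `0`: the value
at `k` tells where `h^k(x)` lies, so it is the `(k+1)`-st digit `I^α(x)[k+1]`. -/
def itinerary (α x : Circle) (k : ℕ) : Option Letter :=
  if dbl^[k] x ∈ semicircle α .L then some .L
  else if dbl^[k] x ∈ semicircle α .R then some .R
  else none

/-- The lamination `x ≈_α y`: the itineraries agree wherever neither of them is `⋆`. -/
def LamEquiv (α x y : Circle) : Prop :=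
  ∀ k, itinerary α x k = itinerary α y k ∨ itinerary α x k = none ∨ itinerary α y k = none

/-! ### Strong recurrence -/

/-- The interval `[a, b]` of digits of `I^α(α)` is `R`-duplicating: it repeats the initial
segment of `I^α(α)` of the same length, except possibly at digits in `R`. -/
def IsDuplicatingInterval (α : Circle) (R : Finset ℕ) (a b : ℕ) : Prop :=
  ∀ k, a ≤ k → k ≤ b → k ∉ R → itinerary α α k = itinerary α α (k - a)

/-- Digit `i` of the word formed by the first `n` digits (numbered `0, …, n-1`) of `I^α(α)` is
`(D, R)`-duplicating: it is covered by an `R`-duplicating interval `[a, b]` of that word that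
does not start at the first digit (the initial segments repeat themselves trivially), and that
covers the last digit or has length exceeding `D`. -/
def IsDuplicatingDigit (α : Circle) (n D : ℕ) (R : Finset ℕ) (i : ℕ) : Prop :=
  ∃ a b, 0 < a ∧ a ≤ i ∧ i ≤ b ∧ b < n ∧ IsDuplicatingInterval α R a b ∧
    (b + 1 = n ∨ D < b + 1 - a)

/-- `D`-rare sets. -/
def IsRare (D : ℕ) (R : Finset ℕ) : Prop :=
  ∀ i, (R ∩ Finset.Icc i (i + D)).card ≤ 3

/-- Strongly recurrent angles. -/
def IsStronglyRecurrent (α : Circle) : Prop :=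
  ∀ D : ℕ, 0 < D → ∀ τ : ℝ, τ < 1 → ∃ n : ℕ, D < n ∧ ∃ R : Finset ℕ,
    R ⊆ Finset.range n ∧ IsRare D R ∧
      τ * n < ({i | i < n ∧ IsDuplicatingDigit α n D R i} : Set ℕ).ncard

/-! ### Generalized cylinder sets -/

/-- The inverse branch of `h` from `𝕋 ∖ {α}` onto the open semicircle of the given letter.
(The value at `α` itself is a junk value.) -/
def branch (α : Circle) (l : Letter) (z : Circle) : Circle :=
  starPt α l * Circle.exp (ccwAngle α z / 2)

/-- The composition `w̃ = w̃[1] ∘ ⋯ ∘ w̃[n]` of inverse branches along a finite word. -/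
def wordBranch (α : Circle) : List Letter → Circle → Circle
  | [], z => z
  | l :: w, z => branch α l (wordBranch α w z)

/-- The end point `ũ(⋆₁)` (letter `L`) or `ũ(⋆₂)` (letter `R`) of the leaf `l_u`. -/
def leafEnd (α : Circle) (u : List Letter) (l : Letter) : Circle :=
  wordBranch α u (starPt α l)

/-- `x` and `y` lie on the same closed side of the leaf `l_u`. -/
def SameSide (α : Circle) (u : List Letter) (x y : Circle) : Prop :=
  (x ∈ ccwClosedArc (leafEnd α u .L) (leafEnd α u .R) ∧
    y ∈ ccwClosedArc (leafEnd α u .L) (leafEnd α u .R)) ∨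
  (x ∈ ccwClosedArc (leafEnd α u .R) (leafEnd α u .L) ∧
    y ∈ ccwClosedArc (leafEnd α u .R) (leafEnd α u .L))

/-- The generalized cylinder sets of degree `n`: the traces on the circle of the (closed) pieces
into which the pairwise disjoint geodesics `l_u`, `|u| = n`, cut the closed disc. The piece that
has the point `x` of the circle, not an end point of any of these leaves, on its boundary meets
the circle in the points that none of the leaves separates from `x`. -/
def gcs (α : Circle) (n : ℕ) : Set (Set Circle) :=
  {C | ∃ x : Circle, (∀ u : List Letter, u.length = n → ∀ l, x ≠ leafEnd α u l) ∧
    C = {y | ∀ u : List Letter, u.length = n → SameSide α u x y}}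

/-- The set `C_⋆`: it is `{⋆₁, ⋆₂}` if the class of `α` is `{α}`, and the union of the closures
of the two lifts of the arc `α ⌢ β` (which contain `⋆₁`, `⋆₂`) if it is `{α, β}`. -/
def cStar (α : Circle) : Set Circle :=
  range (starPt α) ∪ ⋃ β ∈ {β | LamEquiv α α β ∧ β ≠ α}, ⋃ l, closure (branch α l '' properArc α β)

/-- `{D(x)}` is a choice of the covering `{C^K(x)}` with constant `δ`: each `D(x)` is a
generalized cylinder set of degree `K` or `K+1` that contains `x`, such that `x` is at distance
more than `δ` from `g̃(C_⋆)` for each pair `g̃({⋆₁, ⋆₂})` in the boundary of `D(x)`. -/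
def IsCK (α : Circle) (K : ℕ) (δ : ℝ) (D : Circle → Set Circle) : Prop :=
  ∀ x, D x ∈ gcs α K ∪ gcs α (K + 1) ∧ x ∈ D x ∧
    ∀ g : List Letter, (∀ l, leafEnd α g l ∈ frontier (D x)) →
      δ < Metric.infDist x (wordBranch α g '' cStar α)

/-! ### Nice gluing circuits -/

instance instMeasurableSpaceCircle : MeasurableSpace Circle := borel Circle

instance instBorelSpaceCircle : BorelSpace Circle := ⟨rfl⟩

/-- `a ≍_C b`. -/
def Comparable (C a b : ℝ) : Prop := a ≤ C * b ∧ b ≤ C * a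

/-- Logarithmic energy `∬ -log|x - y| dμ(x) dμ(y)` as an extended real, computed as the integral
of the positive part (which is `∞` on the diagonal) minus that of the negative part. -/
def logEnergy (μ : Measure ℂ) : EReal :=
  ((∫⁻ x, ∫⁻ y, (-ENNReal.log (edist x y)).toENNReal ∂μ ∂μ : ℝ≥0∞) : EReal) -
    ((∫⁻ x, ∫⁻ y, (ENNReal.log (edist x y)).toENNReal ∂μ ∂μ : ℝ≥0∞) : EReal)

/-- The logarithmic energy of the push-forward of `μ` under `x ↦ x / diam A`. -/
def rescaledEnergy (μ : Measure Circle) (A : Set Circle) : EReal :=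
  logEnergy (μ.map fun z : Circle => (z : ℂ) / ((Metric.diam A : ℝ) : ℂ))

/-- The closed arc of the points with angle in `[s, t]`. -/
def angleArc (s t : ℝ) : Set Circle := Circle.exp '' Icc s t

/-- The measures `μ` on `A` and `μ'` on `A'` are glued by `≈`: there are full-measure Borel
subsets and a measure-preserving bijection between them that moves points inside classes. -/
def IsGlued (rel : Circle → Circle → Prop) (A A' : Set Circle) (μ μ' : Measure Circle) : Prop :=
  ∃ (B B' : Set Circle) (φ : Circle → Circle), B ⊆ A ∧ B' ⊆ A' ∧
    MeasurableSet B ∧ MeasurableSet B' ∧ μ Bᶜ = 0 ∧ μ' B'ᶜ = 0 ∧ BijOn φ B B' ∧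
    MeasurePreserving φ (μ.restrict B) (μ'.restrict B') ∧ ∀ y ∈ B, rel y (φ y)

/-- An `(N, C, r)`-nice gluing circuit around `x` contained in `D`, for the relation `rel`.
It consists of `m + 1 ≤ N` pairs of arcs `A_j = angleArc (s j) (t j)` and
`A'_j = angleArc (s' j) (t' j)`, indices being cyclic, in the counterclockwise order
`A'_0, A_0, A'_1, A_1, …, A'_m, A_m`, with `A_j` glued to `A'_{j+1}`. The point `x` lies in the
arc between `A'_j` and `A_j` for some `j`. -/
def HasNiceCircuit (rel : Circle → Circle → Prop) (N : ℕ) (C r : ℝ) (x : Circle)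
    (D : Set Circle) : Prop :=
  ∃ (m : ℕ) (s' t' s t : Fin (m + 1) → ℝ) (μ μ' : Fin (m + 1) → Measure Circle),
    m + 1 ≤ N ∧
    (∀ j, s' j ≤ t' j ∧ t' j < s j ∧ s j ≤ t j) ∧
    (∀ i j, i < j → t i < s' j) ∧
    (∀ i j, t j < s' i + 2 * Real.pi) ∧
    (∀ j, Comparable C (Metric.diam (angleArc (s j) (t j) ∪ angleArc (s' j) (t' j))) r ∧
      Comparable C (Metric.diam (angleArc (s j) (t j)))
        (Metric.diam (angleArc (s j) (t j) ∪ angleArc (s' j) (t' j))) ∧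
      Comparable C (Metric.diam (angleArc (s j) (t j) ∪ angleArc (s' j) (t' j)))
        (Metric.diam (angleArc (s' j) (t' j)))) ∧
    (∀ j, IsProbabilityMeasure (μ j) ∧ IsProbabilityMeasure (μ' j) ∧
      μ j (angleArc (s j) (t j))ᶜ = 0 ∧ μ' j (angleArc (s' j) (t' j))ᶜ = 0 ∧
      rescaledEnergy (μ j) (angleArc (s j) (t j)) ≤ (C : EReal) ∧
      rescaledEnergy (μ' j) (angleArc (s' j) (t' j)) ≤ (C : EReal)) ∧
    (∀ j, IsGlued rel (angleArc (s j) (t j)) (angleArc (s' (j + 1)) (t' (j + 1)))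
      (μ j) (μ' (j + 1))) ∧
    (∀ j, angleArc (s j) (t j) ⊆ D ∧ angleArc (s' j) (t' j) ⊆ D) ∧
    (∃ j, x ∈ Circle.exp '' Ioo (t' j) (s j))

end QuadLam

end

namespace QuadLam

/-! ### Angular coordinates -/

/-! Combinatorics. Cut the kneading sequence (the itinerary of `α`) greedily: after each cutting
time, compare it with its own beginning, and cut again at the first disagreement. If the lengths of
these agreements tended to infinity, the blocks would copy initial segments, with the sparse cutting
times as the only errors, and `α` would be strongly recurrent. So some agreement length `t` occurs
infinitely often; this is the content of `Tame`.

Geometry. Leaves between points equivalent to `α` are not linked with their forward images, and the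
images of a leaf starting at `α` are never shorter than that leaf. Hence forward images of the class
of `α` avoid its hull, and the hull is disjoint from its own image (`Tame.dbl_notMem_hull`). Since
`C_⋆` is the preimage of the hull (`Tame.cStar_eq`), its preimages of levels `K` and `K + 1` are
disjoint compact sets. Every point is therefore uniformly far from one of them, which gives the
inside covering (`Tame.exists_isCK`).

Gluing. The leaves belonging to the prefixes of the kneading sequence at cutting times shrink to the
hull. The inverse branch along such a prefix with one more letter carries the arc between `α` and
the leaf of level `agree` to the band between two consecutive cutting leaves on the other side of
`α`. Two cutting times with the same agreement length `t` thus generate an iterated function system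
acting on both sides of the hull simultaneously. Points with the same code have the same itinerary,
and points with different codes are exponentially separated, so fair coin flips induce glued
measures of finite energy on the two sides (`Tame.exists_glued`). Near `C_⋆` the inverse branches
are affine, so these Cantor sets can be transported to every leaf of a given level
(`Tame.exists_glued_leaf`).

Circuits. Placing these pairs at the ends of all leaves that bound a generalized cylinder set yields
a circuit around a given point (`Tame.exists_circuit`). The same circuit serves nearby points, so
compactness, together with the finiteness of the number of cylinder sets, makes the constants
uniform. -/

lemma ccwAngle_nonneg (a b : Circle) : 0 ≤ ccwAngle a b :=
  left_le_toIcoMod _ _ _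

lemma ccwAngle_lt_two_pi (a b : Circle) : ccwAngle a b < 2 * Real.pi :=
  (toIcoMod_lt_right Real.two_pi_pos 0 (Complex.arg ((b / a : Circle) : ℂ))).trans_eq (zero_add _)

lemma mul_exp_ccwAngle (a b : Circle) : a * Circle.exp (ccwAngle a b) = b := by
  have h : Circle.exp (ccwAngle a b) = b / a := by
    rw [← Circle.exp_arg (b / a), Circle.exp_inj, ← toIcoMod_inj Real.two_pi_pos (c := 0)]
    exact toIcoMod_toIcoMod _ _ _ _
  rw [h, mul_div_cancel]

lemma ccwAngle_mul_exp (a : Circle) {t : ℝ} (h0 : 0 ≤ t) (h1 : t < 2 * Real.pi) :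
    ccwAngle a (a * Circle.exp t) = t := by
  unfold ccwAngle
  rw [mul_div_cancel_left]
  have h : toIcoMod Real.two_pi_pos 0 (Complex.arg (Circle.exp t : ℂ)) =
      toIcoMod Real.two_pi_pos 0 t := by
    rw [toIcoMod_inj, ← Circle.exp_inj, Circle.exp_arg]
  rw [h, toIcoMod_eq_self]
  exact ⟨h0, by simpa using h1⟩

lemma ccwAngle_injective (a : Circle) : Function.Injective (ccwAngle a) := fun x y h => by
  rw [← mul_exp_ccwAngle a x, h, mul_exp_ccwAngle]

lemma ccwAngle_inj {a x y : Circle} : ccwAngle a x = ccwAngle a y ↔ x = y :=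
  (ccwAngle_injective a).eq_iff

@[simp] lemma ccwAngle_self (a : Circle) : ccwAngle a a = 0 := by
  simpa using ccwAngle_mul_exp a le_rfl Real.two_pi_pos

lemma ccwAngle_pos {a b : Circle} (h : b ≠ a) : 0 < ccwAngle a b := by
  refine lt_of_le_of_ne (ccwAngle_nonneg a b) fun h0 => h ?_
  rw [← ccwAngle_self a] at h0
  exact (ccwAngle_injective a h0).symm

lemma ccwAngle_of_le {o a b : Circle} (h : ccwAngle o a ≤ ccwAngle o b) :
    ccwAngle a b = ccwAngle o b - ccwAngle o a := by
  have ha := ccwAngle_nonneg o a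
  have hb := ccwAngle_lt_two_pi o b
  conv_lhs => rw [← mul_exp_ccwAngle o b, ← mul_exp_ccwAngle o a]
  rw [show o * Circle.exp (ccwAngle o b) = o * Circle.exp (ccwAngle o a) *
    Circle.exp (ccwAngle o b - ccwAngle o a) by rw [mul_assoc, ← Circle.exp_add]; congr 2; ring]
  exact ccwAngle_mul_exp _ (by linarith) (by linarith)

lemma ccwAngle_of_lt {o a b : Circle} (h : ccwAngle o b < ccwAngle o a) :
    ccwAngle a b = ccwAngle o b - ccwAngle o a + 2 * Real.pi := by
  have ha := ccwAngle_lt_two_pi o a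
  have hb := ccwAngle_nonneg o b
  conv_lhs => rw [← mul_exp_ccwAngle o b, ← mul_exp_ccwAngle o a]
  rw [show o * Circle.exp (ccwAngle o b) = o * Circle.exp (ccwAngle o a) *
    Circle.exp (ccwAngle o b - ccwAngle o a + 2 * Real.pi) by
      rw [mul_assoc, Circle.exp_add_two_pi, ← Circle.exp_add]; congr 2; ring]
  exact ccwAngle_mul_exp _ (by linarith) (by linarith)

/-- Betweenness on the circle, read off in the angular coordinate based at an arbitrary point. -/
lemma mem_ccwArc_iff (o : Circle) {a b z : Circle} : z ∈ ccwArc a b ↔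
    (ccwAngle o a < ccwAngle o z ∧ ccwAngle o z < ccwAngle o b) ∨
    (ccwAngle o z < ccwAngle o b ∧ ccwAngle o b < ccwAngle o a) ∨
    (ccwAngle o b < ccwAngle o a ∧ ccwAngle o a < ccwAngle o z) := by
  have ha := ccwAngle_nonneg o a
  have hb := ccwAngle_nonneg o b
  have hz := ccwAngle_nonneg o z
  have ha' := ccwAngle_lt_two_pi o a
  have hb' := ccwAngle_lt_two_pi o b
  have hz' := ccwAngle_lt_two_pi o z
  simp only [ccwArc, mem_ofPred_eq]
  rcases le_or_gt (ccwAngle o a) (ccwAngle o z) with h1 | h1 <;>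
  rcases le_or_gt (ccwAngle o a) (ccwAngle o b) with h2 | h2 <;>
  first | rw [ccwAngle_of_le h1] | rw [ccwAngle_of_lt h1]
  all_goals first | rw [ccwAngle_of_le h2] | rw [ccwAngle_of_lt h2]
  all_goals
    constructor
    · rintro ⟨h3, h4⟩
      first
        | exact Or.inl ⟨by linarith, by linarith⟩
        | exact Or.inr (Or.inl ⟨by linarith, by linarith⟩)
        | exact Or.inr (Or.inr ⟨by linarith, by linarith⟩)
    · rintro (⟨h3, h4⟩ | ⟨h3, h4⟩ | ⟨h3, h4⟩) <;> constructor <;> linarith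

/-- The two open arcs between two distinct points cover everything but these points. -/
lemma mem_ccwArc_or {a b z : Circle} (hab : a ≠ b) (ha : z ≠ a) (hb : z ≠ b) :
    z ∈ ccwArc a b ∨ z ∈ ccwArc b a := by
  have h1 : ccwAngle a z ≠ ccwAngle a b := fun h => hb (ccwAngle_inj.1 h)
  have h2 := ccwAngle_pos ha
  have h3 := ccwAngle_pos hab.symm
  rw [mem_ccwArc_iff a, mem_ccwArc_iff a, ccwAngle_self]
  rcases lt_or_gt_of_ne h1 with h | h
  · exact Or.inl (Or.inl ⟨h2, h⟩)
  · exact Or.inr (Or.inr (Or.inr ⟨h3, h⟩))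

/-! ### The semicircles and the inverse branches -/

/-- The other letter. -/
def Letter.other : Letter → Letter
  | .L => .R
  | .R => .L

@[simp] lemma Letter.other_other (l : Letter) : l.other.other = l := by cases l <;> rfl

lemma Letter.other_ne (l : Letter) : l.other ≠ l := by cases l <;> simp [Letter.other]

lemma Letter.eq_other_of_ne {l l' : Letter} (h : l ≠ l') : l = l'.other := by
  cases l <;> cases l' <;> simp_all [Letter.other]

variable {α : Circle}

lemma dbl_mul_exp (z : Circle) (t : ℝ) : dbl (z * Circle.exp t) = dbl z * Circle.exp (2 * t) := by
  rw [dbl, dbl, mul_pow, two_mul, Circle.exp_add, sq (Circle.exp t)]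

lemma starPt_other (α : Circle) (l : Letter) :
    starPt α l.other = starPt α l * Circle.exp Real.pi := by
  cases l
  · exact Circle.exp_add _ _
  · change Circle.exp _ = Circle.exp _ * _
    rw [← Circle.exp_add, add_assoc, ← two_mul, Circle.exp_add_two_pi]

@[simp] lemma dbl_starPt (α : Circle) (l : Letter) : dbl (starPt α l) = α := by
  have h : dbl (starPt α .L) = α := by
    rw [starPt, ← one_mul (Circle.exp _), dbl_mul_exp, mul_div_cancel₀ _ two_ne_zero]
    simpa [dbl] using mul_exp_ccwAngle 1 α
  cases l
  · exact h
  · rw [show Letter.R = Letter.L.other from rfl, starPt_other, dbl_mul_exp, h, Circle.exp_two_pi,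
      mul_one]

@[simp] lemma ccwAngle_starPt_other (l : Letter) :
    ccwAngle (starPt α l) (starPt α l.other) = Real.pi := by
  rw [starPt_other, ccwAngle_mul_exp _ Real.pi_pos.le (by linarith [Real.pi_pos])]

lemma starPt_other_ne (l : Letter) : starPt α l.other ≠ starPt α l := fun h => by
  have := ccwAngle_starPt_other (α := α) l
  rw [h, ccwAngle_self] at this
  exact Real.pi_pos.ne this

lemma semicircle_eq (l : Letter) :
    semicircle α l = ccwArc (starPt α l) (starPt α l.other) := by cases l <;> rfl

lemma mem_semicircle_iff {l : Letter} {z : Circle} : z ∈ semicircle α l ↔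
    0 < ccwAngle (starPt α l) z ∧ ccwAngle (starPt α l) z < Real.pi := by
  rw [semicircle_eq, ccwArc, mem_ofPred_eq, ccwAngle_starPt_other]

lemma mem_semicircle_other_iff {l : Letter} {z : Circle} : z ∈ semicircle α l.other ↔
    Real.pi < ccwAngle (starPt α l) z := by
  rw [semicircle_eq, Letter.other_other, mem_ccwArc_iff (starPt α l), ccwAngle_self,
    ccwAngle_starPt_other]
  have := ccwAngle_nonneg (starPt α l) z
  have := Real.pi_pos
  constructor
  · rintro (⟨h, h'⟩ | ⟨h, h'⟩ | ⟨h, h'⟩) <;> linarith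
  · exact fun h => Or.inr (Or.inr ⟨by assumption, h⟩)

/-- The closed semicircles. -/
def closedSemi (α : Circle) (l : Letter) : Set Circle := {z | ccwAngle (starPt α l) z ≤ Real.pi}

lemma semicircle_subset_closedSemi (l : Letter) : semicircle α l ⊆ closedSemi α l :=
  fun _ hz => (mem_semicircle_iff.1 hz).2.le

lemma notMem_semicircle_of_mem_closedSemi {l l' : Letter} {z : Circle} (h : z ∈ closedSemi α l)
    (h' : z ∈ semicircle α l') : l' = l := by
  by_contra hne
  rw [Letter.eq_other_of_ne hne, mem_semicircle_other_iff] at h'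
  exact absurd h (not_le.2 h')

lemma mem_closedSemi_iff {l : Letter} {z : Circle} :
    z ∈ closedSemi α l ↔ z ∈ semicircle α l ∨ dbl z = α := by
  have key : dbl z = α ↔ ccwAngle (starPt α l) z = 0 ∨ ccwAngle (starPt α l) z = Real.pi := by
    have h0 := ccwAngle_nonneg (starPt α l) z
    have h1 := ccwAngle_lt_two_pi (starPt α l) z
    conv_lhs => rw [← mul_exp_ccwAngle (starPt α l) z, dbl_mul_exp, dbl_starPt]
    rw [mul_eq_left, Circle.exp_eq_one]
    constructor
    · rintro ⟨n, hn⟩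
      have hn' : ccwAngle (starPt α l) z = n * Real.pi := by linarith
      rw [hn'] at h0 h1 ⊢
      have := Real.pi_pos
      have h2 : (n : ℝ) < 2 := by nlinarith
      have h3 : (-1 : ℝ) < n := by nlinarith
      have h2' : n < 2 := by exact_mod_cast h2
      have h3' : -1 < n := by exact_mod_cast h3
      interval_cases n <;> simp
    · rintro (h | h)
      · exact ⟨0, by simp [h]⟩
      · exact ⟨1, by simp [h]⟩
  rw [key, mem_semicircle_iff, closedSemi, mem_ofPred_eq]
  have h0 := ccwAngle_nonneg (starPt α l) z
  have := Real.pi_pos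
  constructor
  · intro h
    rcases h0.eq_or_lt with h2 | h2
    · exact Or.inr (Or.inl h2.symm)
    · rcases h.eq_or_lt with h3 | h3
      · exact Or.inr (Or.inr h3)
      · exact Or.inl ⟨h2, h3⟩
  · rintro (h | h | h)
    · exact h.2.le
    · rw [h]; exact this.le
    · exact h.le

lemma dbl_eq_iff {z : Circle} : dbl z = α ↔ ∃ l, z = starPt α l := by
  refine ⟨fun h => ?_, fun ⟨l, h⟩ => h ▸ dbl_starPt α l⟩
  have h1 : z ∈ closedSemi α .L := mem_closedSemi_iff.2 (Or.inr h)
  have h2 : z ∉ semicircle α .L := fun h2 => by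
    have h3 : z ∈ closedSemi α .R := mem_closedSemi_iff.2 (Or.inr h)
    cases notMem_semicircle_of_mem_closedSemi h3 h2
  rw [mem_semicircle_iff] at h2
  rcases (ccwAngle_nonneg (starPt α .L) z).eq_or_lt with h3 | h3
  · exact ⟨.L, ccwAngle_inj.1 (h3.symm.trans (ccwAngle_self _).symm)⟩
  · refine ⟨Letter.L.other, (ccwAngle_inj (a := starPt α .L)).1 ?_⟩
    rw [ccwAngle_starPt_other]
    exact le_antisymm h1 (not_lt.1 fun h4 => h2 ⟨h3, h4⟩)

lemma exists_mem_semicircle {z : Circle} (h : dbl z ≠ α) : ∃ l, z ∈ semicircle α l := by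
  by_contra hne
  push Not at hne
  have h1 : z ∉ closedSemi α .L := fun h' => by
    rcases mem_closedSemi_iff.1 h' with h' | h'
    exacts [hne _ h', h h']
  exact hne Letter.L.other (mem_semicircle_other_iff.2 (not_le.1 h1))

lemma dbl_ne_of_mem_semicircle {l : Letter} {z : Circle} (h : z ∈ semicircle α l) : dbl z ≠ α :=
  fun h' => l.other_ne.symm
    (notMem_semicircle_of_mem_closedSemi (mem_closedSemi_iff.2 (Or.inr h')) h)

lemma ccwAngle_dbl {l : Letter} {z : Circle} (h : ccwAngle (starPt α l) z < Real.pi) :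
    ccwAngle α (dbl z) = 2 * ccwAngle (starPt α l) z := by
  have h0 := ccwAngle_nonneg (starPt α l) z
  conv_lhs => rw [← mul_exp_ccwAngle (starPt α l) z, dbl_mul_exp, dbl_starPt]
  exact ccwAngle_mul_exp _ (by linarith) (by linarith)

lemma ccwAngle_branch (l : Letter) (z : Circle) :
    ccwAngle (starPt α l) (branch α l z) = ccwAngle α z / 2 :=
  ccwAngle_mul_exp _ (by linarith [ccwAngle_nonneg α z])
    (by linarith [ccwAngle_nonneg α z, ccwAngle_lt_two_pi α z])

@[simp] lemma dbl_branch (l : Letter) (z : Circle) : dbl (branch α l z) = z := by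
  rw [branch, dbl_mul_exp, dbl_starPt, mul_div_cancel₀ _ two_ne_zero, mul_exp_ccwAngle]

lemma branch_mem_closedSemi (l : Letter) (z : Circle) : branch α l z ∈ closedSemi α l := by
  rw [closedSemi, mem_ofPred_eq, ccwAngle_branch]
  linarith [ccwAngle_lt_two_pi α z]

lemma branch_mem_semicircle {l : Letter} {z : Circle} (h : z ≠ α) :
    branch α l z ∈ semicircle α l := by
  rw [mem_semicircle_iff, ccwAngle_branch]
  constructor <;> linarith [ccwAngle_lt_two_pi α z, ccwAngle_pos h]

lemma branch_dbl {l : Letter} {z : Circle} (h : z ∈ semicircle α l) :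
    branch α l (dbl z) = z := by
  apply ccwAngle_injective (starPt α l)
  rw [ccwAngle_branch, ccwAngle_dbl (mem_semicircle_iff.1 h).2, mul_div_cancel_left₀ _ two_ne_zero]

lemma branch_injective (l : Letter) : Function.Injective (branch α l) := fun x y h => by
  rw [← dbl_branch (α := α) l x, h, dbl_branch]

lemma branch_mem_ccwArc (l : Letter) {a b z : Circle} (h : z ∈ ccwArc a b) :
    branch α l z ∈ ccwArc (branch α l a) (branch α l b) := by
  rw [mem_ccwArc_iff α] at h
  rw [mem_ccwArc_iff (starPt α l)]
  simp only [ccwAngle_branch]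
  rcases h with ⟨h, h'⟩ | ⟨h, h'⟩ | ⟨h, h'⟩
  · exact Or.inl ⟨by linarith, by linarith⟩
  · exact Or.inr (Or.inl ⟨by linarith, by linarith⟩)
  · exact Or.inr (Or.inr ⟨by linarith, by linarith⟩)

lemma wordBranch_mem_ccwArc (u : List Letter) {a b z : Circle} (h : z ∈ ccwArc a b) :
    wordBranch α u z ∈ ccwArc (wordBranch α u a) (wordBranch α u b) := by
  induction u with
  | nil => exact h
  | cons l u ih => exact branch_mem_ccwArc l ih

lemma wordBranch_append (u v : List Letter) (z : Circle) :
    wordBranch α (u ++ v) z = wordBranch α u (wordBranch α v z) := by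
  induction u with
  | nil => rfl
  | cons l u ih => simp only [List.cons_append, wordBranch, ih]

@[simp] lemma iterate_dbl_wordBranch (u : List Letter) (z : Circle) :
    dbl^[u.length] (wordBranch α u z) = z := by
  induction u with
  | nil => rfl
  | cons l u ih =>
    rw [List.length_cons, Function.iterate_succ_apply, wordBranch, dbl_branch, ih]

lemma continuous_dbl : Continuous dbl := continuous_pow 2

/-! ### Prefixes of itineraries, with `⋆` as a joker -/

/-- The point `z` has an itinerary that starts with `u`, if `⋆` may be read as any letter. -/
def HasPrefix (α : Circle) : List Letter → Circle → Prop
  | [], _ => True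
  | l :: u, z => z ∈ closedSemi α l ∧ HasPrefix α u (dbl z)

lemma hasPrefix_append {u v : List Letter} {z : Circle} :
    HasPrefix α (u ++ v) z ↔ HasPrefix α u z ∧ HasPrefix α v (dbl^[u.length] z) := by
  induction u generalizing z with
  | nil => simp [HasPrefix]
  | cons l u ih =>
    simp only [List.cons_append, HasPrefix, ih, List.length_cons, Function.iterate_succ_apply,
      and_assoc]

lemma hasPrefix_wordBranch (u : List Letter) (z : Circle) : HasPrefix α u (wordBranch α u z) := by
  induction u with
  | nil => trivial
  | cons l u ih => exact ⟨branch_mem_closedSemi _ _, by rwa [wordBranch, dbl_branch]⟩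

lemma closedSemi_eq_image (l : Letter) :
    closedSemi α l = (fun t : ℝ => starPt α l * Circle.exp t) '' Icc 0 Real.pi := by
  ext z
  constructor
  · exact fun h => ⟨_, ⟨ccwAngle_nonneg _ _, h⟩, mul_exp_ccwAngle _ _⟩
  · rintro ⟨t, ht, rfl⟩
    change ccwAngle _ _ ≤ _
    rw [ccwAngle_mul_exp _ ht.1 (by linarith [ht.2, Real.pi_pos])]
    exact ht.2

lemma isClosed_closedSemi (l : Letter) : IsClosed (closedSemi α l) := by
  rw [closedSemi_eq_image]
  exact (isCompact_Icc.image (by fun_prop)).isClosed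

/-- Reading `⋆` as a joker replaces open semicircles by closed ones. Prefix conditions then survive
limits and can be intersected by compactness. -/
lemma isClosed_hasPrefix (u : List Letter) : IsClosed {z | HasPrefix α u z} := by
  induction u with
  | nil => simp [HasPrefix]
  | cons l u ih => exact (isClosed_closedSemi l).inter (ih.preimage continuous_dbl)

/-- The itineraries of `x` and `y` can be made equal by replacing `⋆`s by letters. -/
def SameItinerary (α x y : Circle) : Prop :=
  ∀ k, ∃ l, dbl^[k] x ∈ closedSemi α l ∧ dbl^[k] y ∈ closedSemi α l

lemma itinerary_of_mem_semicircle {x : Circle} {k : ℕ} {l : Letter}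
    (h : dbl^[k] x ∈ semicircle α l) : itinerary α x k = some l := by
  cases l
  · rw [itinerary, if_pos h]
  · have h' : dbl^[k] x ∉ semicircle α .L := fun h' => by
      cases notMem_semicircle_of_mem_closedSemi (semicircle_subset_closedSemi _ h) h'
    rw [itinerary, if_neg h', if_pos h]

lemma itinerary_eq_none {x : Circle} {k : ℕ} (h : dbl^[k + 1] x = α) : itinerary α x k = none := by
  rw [Function.iterate_succ_apply'] at h
  rw [itinerary, if_neg fun h' => dbl_ne_of_mem_semicircle h' h,
    if_neg fun h' => dbl_ne_of_mem_semicircle h' h]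

lemma itinerary_of_mem_closedSemi {x : Circle} {k : ℕ} {l : Letter}
    (h : dbl^[k] x ∈ closedSemi α l) : itinerary α x k = some l ∨ itinerary α x k = none := by
  rcases mem_closedSemi_iff.1 h with h | h
  · exact Or.inl (itinerary_of_mem_semicircle h)
  · exact Or.inr (itinerary_eq_none (by rwa [Function.iterate_succ_apply']))

lemma SameItinerary.lamEquiv {x y : Circle} (h : SameItinerary α x y) : LamEquiv α x y := by
  intro k
  obtain ⟨l, h1, h2⟩ := h k
  rcases itinerary_of_mem_closedSemi h1 with h3 | h3
  · rcases itinerary_of_mem_closedSemi h2 with h4 | h4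
    · exact Or.inl (h3.trans h4.symm)
    · exact Or.inr (Or.inr h4)
  · exact Or.inr (Or.inl h3)

lemma SameItinerary.branch {x y : Circle} (h : SameItinerary α x y) (l : Letter) :
    SameItinerary α (branch α l x) (branch α l y) := by
  intro k
  cases k with
  | zero => exact ⟨l, branch_mem_closedSemi _ _, branch_mem_closedSemi _ _⟩
  | succ k => simpa only [Function.iterate_succ_apply, dbl_branch] using h k

lemma SameItinerary.wordBranch {x y : Circle} (h : SameItinerary α x y) (u : List Letter) :
    SameItinerary α (wordBranch α u x) (wordBranch α u y) := by
  induction u with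
  | nil => exact h
  | cons l u ih => exact ih.branch l

lemma HasPrefix.exists_mem_closedSemi {u : List Letter} {x y : Circle} (hx : HasPrefix α u x)
    (hy : HasPrefix α u y) {k : ℕ} (hk : k < u.length) :
    ∃ l, dbl^[k] x ∈ closedSemi α l ∧ dbl^[k] y ∈ closedSemi α l := by
  induction u generalizing x y k with
  | nil => simp at hk
  | cons l u ih =>
    cases k with
    | zero => exact ⟨l, hx.1, hy.1⟩
    | succ k => exact ih hx.2 hy.2 (by simpa using hk)

/-! ### The kneading sequence and its cutting times -/

open Classical in
/-- The kneading sequence: the itinerary of a non-periodic angle `α` itself. -/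
noncomputable def knead (α : Circle) (k : ℕ) : Letter :=
  if dbl^[k] α ∈ semicircle α .L then .L else .R

/-- The length of the longest common prefix of the kneading sequence and its `(n+1)`-st shift. -/
noncomputable def agree (α : Circle) (n : ℕ) : ℕ :=
  sInf {j | knead α (n + 1 + j) ≠ knead α j}

/-- The cutting times. -/
noncomputable def cut (α : Circle) : ℕ → ℕ
  | 0 => 0
  | k + 1 => cut α k + 1 + agree α (cut α k)

/-- The properties of angles that are neither periodic nor strongly recurrent that matter here:
the differences of the cutting times do not tend to infinity. -/
structure Tame (α : Circle) : Prop where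
  iterate_ne : ∀ k, dbl^[k + 1] α ≠ α
  shift_ne : ∀ n, ∃ j, knead α (n + 1 + j) ≠ knead α j
  frequently_agree : ∃ t, ∀ m, ∃ k, m ≤ k ∧ agree α (cut α k) = t


lemma iterate_mem_semicircle_knead (hα : ∀ k, dbl^[k + 1] α ≠ α) (k : ℕ) :
    dbl^[k] α ∈ semicircle α (knead α k) := by
  have h := hα k
  rw [Function.iterate_succ_apply'] at h
  obtain ⟨l, hl⟩ := exists_mem_semicircle h
  cases l
  · rwa [knead, if_pos hl]
  · have h' : dbl^[k] α ∉ semicircle α .L := fun h' => by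
      cases notMem_semicircle_of_mem_closedSemi (semicircle_subset_closedSemi _ hl) h'
    rwa [knead, if_neg h']

lemma itinerary_self (hα : ∀ k, dbl^[k + 1] α ≠ α) (k : ℕ) :
    itinerary α α k = some (knead α k) :=
  itinerary_of_mem_semicircle (iterate_mem_semicircle_knead hα k)

lemma cut_lt_cut_succ (k : ℕ) : cut α k < cut α (k + 1) := by
  rw [cut]; omega

lemma cut_strictMono : StrictMono (cut α) := strictMono_nat_of_lt_succ cut_lt_cut_succ

lemma knead_eq_of_lt_agree {n j : ℕ} (hj : j < agree α n) :
    knead α (n + 1 + j) = knead α j := by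
  by_contra h
  exact Nat.notMem_of_lt_sInf hj h

lemma knead_agree_ne (h : ∃ j, knead α (n + 1 + j) ≠ knead α j) :
    knead α (n + 1 + agree α n) ≠ knead α (agree α n) := Nat.sInf_mem h

lemma exists_lt_le_cut_succ {k₀ i : ℕ} (h : cut α k₀ < i) :
    ∃ k, k₀ ≤ k ∧ cut α k < i ∧ i ≤ cut α (k + 1) := by
  have hex : ∃ k, i ≤ cut α k := ⟨i, cut_strictMono.id_le i⟩
  classical
  have h1 := Nat.find_spec hex
  have h2 : k₀ < Nat.find hex := by
    by_contra h3
    have := (cut_strictMono (α := α)).monotone (not_lt.1 h3)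
    exact absurd (h1.trans this) (not_le.2 h)
  obtain ⟨k, hk⟩ := Nat.exists_eq_add_of_lt h2
  refine ⟨k₀ + k, by omega, ?_, hk ▸ h1⟩
  by_contra h3
  exact Nat.find_min hex (m := k₀ + k) (by omega) (not_lt.1 h3)

/-! ### From the failure of strong recurrence to a recurring agreement length -/

/-- A fixed number `n₀` of non-duplicating digits is a negligible proportion of long words, so
duplication from `n₀` on is enough for strong recurrence. -/
lemma not_tendsto_of_dup (hSR : ¬ IsStronglyRecurrent α)
    (H : ∀ D : ℕ, 0 < D → ∃ n₀ : ℕ, ∀ n, n₀ ≤ n → ∃ R : Finset ℕ, R ⊆ Finset.range n ∧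
      IsRare D R ∧ ∀ i, n₀ ≤ i → i < n → IsDuplicatingDigit α n D R i) : False := by
  refine hSR fun D hD τ hτ => ?_
  obtain ⟨n₀, h⟩ := H D hD
  -- This choice gives `(1 - τ) * n > n₀`, that is `n - n₀ > τ * n`, for every `n ≥ N`.
  obtain ⟨N, hN⟩ := exists_nat_gt (n₀ / (1 - τ))
  have hτ' : 0 < 1 - τ := by linarith
  obtain ⟨R, hR, hR', hdup⟩ := h (n₀ + N + D + 1) (by omega)
  refine ⟨n₀ + N + D + 1, by omega, R, hR, hR', ?_⟩
  set n := n₀ + N + D + 1 with hn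
  have hcard : n - n₀ ≤ ({i | i < n ∧ IsDuplicatingDigit α n D R i} : Set ℕ).ncard := by
    have hfin : ({i | i < n ∧ IsDuplicatingDigit α n D R i} : Set ℕ).Finite :=
      (Set.finite_lt_nat n).subset fun i hi => hi.1
    have := Set.ncard_le_ncard (s := (Finset.Ico n₀ n : Set ℕ)) (fun i hi => by
      have hi' := Finset.mem_Ico.1 (Finset.mem_coe.1 hi)
      exact ⟨hi'.2, hdup i hi'.1 hi'.2⟩) hfin
    rwa [Set.ncard_coe_finset, Nat.card_Ico] at this
  have hcard' : (n : ℝ) - n₀ ≤ ({i | i < n ∧ IsDuplicatingDigit α n D R i} : Set ℕ).ncard := by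
    rw [← Nat.cast_sub (by omega)]
    exact_mod_cast hcard
  rw [div_lt_iff₀ hτ'] at hN
  have hNn : (N : ℝ) ≤ n := by exact_mod_cast (by omega : N ≤ n)
  nlinarith

/-- If the kneading sequence were equal to its shift by `n + 1`, then everything from digit `n + 1`
on would be a single duplicating interval that reaches the last digit, without any exceptional
digits. -/
lemma shift_ne_of_not_stronglyRecurrent (hSR : ¬ IsStronglyRecurrent α)
    (hα : ∀ k, dbl^[k + 1] α ≠ α) (n : ℕ) : ∃ j, knead α (n + 1 + j) ≠ knead α j := by
  by_contra hne
  push Not at hne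
  refine not_tendsto_of_dup hSR fun D _ => ⟨n + 1, fun N _ => ⟨∅, by simp, fun i => by simp,
    fun i hi hiN => ⟨n + 1, N - 1, by omega, hi, by omega, by omega, fun k hk _ _ => ?_, ?_⟩⟩⟩
  · rw [itinerary_self hα, itinerary_self hα, ← hne (k - (n + 1))]
    congr 2; omega
  · left; omega

/-- If every agreement length occurred only finitely often, these lengths would tend to infinity.
The cutting times could then serve as the rare set, and the blocks between them as duplicating
intervals. -/
lemma frequently_agree_of_not_stronglyRecurrent (hSR : ¬ IsStronglyRecurrent α)
    (hα : ∀ k, dbl^[k + 1] α ≠ α) : ∃ t, ∀ m, ∃ k, m ≤ k ∧ agree α (cut α k) = t := by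
  by_contra hne
  push Not at hne
  refine not_tendsto_of_dup hSR fun D hD => ?_
  choose m hm using hne
  -- The sum dominates each `m t` with `t < D`, so beyond it no agreement length below `D` occurs.
  obtain ⟨k₀, hk₀⟩ : ∃ k₀, ∀ k, k₀ ≤ k → D ≤ agree α (cut α k) := by
    refine ⟨∑ t ∈ Finset.range D, m t, fun k hk => ?_⟩
    by_contra hlt
    refine hm (agree α (cut α k)) k (le_trans ?_ hk) rfl
    exact Finset.single_le_sum (f := m) (fun _ _ => Nat.zero_le _)
      (Finset.mem_range.2 (not_le.1 hlt))
  classical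
  refine ⟨cut α k₀ + 1, fun n _ => ⟨(Finset.range n).filter fun i => ∃ k, k₀ < k ∧ cut α k = i,
    Finset.filter_subset _ _, fun i => ?_, fun i hi hin => ?_⟩⟩
  · refine le_trans (Finset.card_le_one.2 fun a ha b hb => ?_) (by norm_num : 1 ≤ 3)
    simp only [Finset.mem_inter, Finset.mem_filter, Finset.mem_Icc] at ha hb
    obtain ⟨⟨-, ka, hka, rfl⟩, ha⟩ := ha
    obtain ⟨⟨-, kb, hkb, rfl⟩, hb⟩ := hb
    have key : ∀ k k', k₀ < k → k < k' → cut α k + D < cut α k' := fun k k' h0 h => by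
      have h1 := hk₀ k h0.le
      have h2 : cut α (k + 1) ≤ cut α k' := cut_strictMono.monotone h
      rw [cut] at h2
      omega
    rcases lt_trichotomy ka kb with h | h | h
    · have := key _ _ hka h; omega
    · rw [h]
    · have := key _ _ hkb h; omega
  · obtain ⟨k, hk, h1, h2⟩ := exists_lt_le_cut_succ (i := i) (by omega : cut α k₀ < i)
    -- The block ends with its cutting time, the only digit that fails to agree; it belongs to the
    -- rare set. If the word ends earlier, the interval is truncated at `n - 1` and qualifies
    -- because it covers the last digit.
    refine ⟨cut α k + 1, min (cut α (k + 1)) (n - 1), by omega, h1, by omega, by omega,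
      fun j hj hj' hjR => ?_, ?_⟩
    · rw [itinerary_self hα, itinerary_self hα]
      have h3 : j ≠ cut α (k + 1) := fun h3 =>
        hjR (Finset.mem_filter.2 ⟨Finset.mem_range.2 (by omega), k + 1, by omega, h3.symm⟩)
      have h4 := knead_eq_of_lt_agree (α := α) (n := cut α k) (j := j - (cut α k + 1)) (by
        rw [cut] at h3 hj'; omega)
      rw [← h4]
      congr 2; omega
    · have h5 := hk₀ k hk
      have h6 : cut α (k + 1) = cut α k + 1 + agree α (cut α k) := rfl
      omega

lemma tame_of_not_stronglyRecurrent (hSR : ¬ IsStronglyRecurrent α)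
    (hpp : ¬ IsPreperiodicAngle α) : Tame α := by
  have hα : ∀ k, dbl^[k + 1] α ≠ α := fun k h =>
    hpp ⟨0, Function.mk_mem_periodicPts (Nat.succ_pos k) h⟩
  exact ⟨hα, shift_ne_of_not_stronglyRecurrent hSR hα,
    frequently_agree_of_not_stronglyRecurrent hSR hα⟩

/-! ### The class of `α` -/

/-- The class of `α` under `≈_α`. -/
def alphaClass (α : Circle) : Set Circle := {β | ∀ k, dbl^[k] β ∈ closedSemi α (knead α k)}

lemma Tame.mem_alphaClass (hα : Tame α) {β : Circle} : β ∈ alphaClass α ↔ LamEquiv α α β := by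
  refine forall_congr' fun k => ?_
  rw [itinerary_self hα.iterate_ne]
  constructor
  · intro h
    rcases itinerary_of_mem_closedSemi h with h | h
    · exact Or.inl h.symm
    · exact Or.inr (Or.inr h)
  · rintro (h | h | h)
    · by_cases h1 : dbl (dbl^[k] β) = α
      · exact mem_closedSemi_iff.2 (Or.inr h1)
      · obtain ⟨l, hl⟩ := exists_mem_semicircle h1
        rw [itinerary_of_mem_semicircle hl, Option.some_inj] at h
        exact semicircle_subset_closedSemi _ (h ▸ hl)
    · cases h
    · by_cases h1 : dbl (dbl^[k] β) = α
      · exact mem_closedSemi_iff.2 (Or.inr h1)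
      · obtain ⟨l, hl⟩ := exists_mem_semicircle h1
        rw [itinerary_of_mem_semicircle hl] at h
        cases h

lemma Tame.self_mem_alphaClass (hα : Tame α) : α ∈ alphaClass α := fun k =>
  semicircle_subset_closedSemi _ (iterate_mem_semicircle_knead hα.iterate_ne k)

lemma isClosed_alphaClass : IsClosed (alphaClass α) := by
  simp only [alphaClass, Set.ofPred_forall]
  exact isClosed_iInter fun k => (isClosed_closedSemi _).preimage (continuous_dbl.iterate k)

/-- A point of the class that returned to `α` would make the kneading sequence equal to one of its
own shifts. Consequently points of the class never meet `⋆`, and their itineraries are free of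
jokers. -/
lemma Tame.iterate_ne_of_mem_alphaClass (hα : Tame α) {β : Circle} (hβ : β ∈ alphaClass α)
    (k : ℕ) : dbl^[k + 1] β ≠ α := by
  intro h
  obtain ⟨j, hj⟩ := hα.shift_ne k
  refine hj (notMem_semicircle_of_mem_closedSemi (z := dbl^[j] α) ?_
    (iterate_mem_semicircle_knead hα.iterate_ne j)).symm
  have := hβ (k + 1 + j)
  rwa [add_comm (k + 1) j, Function.iterate_add_apply, h, add_comm j] at this

lemma Tame.iterate_mem_semicircle (hα : Tame α) {β : Circle} (hβ : β ∈ alphaClass α) (k : ℕ) :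
    dbl^[k] β ∈ semicircle α (knead α k) := by
  rcases mem_closedSemi_iff.1 (hβ k) with h | h
  · exact h
  · rw [← Function.iterate_succ_apply' dbl] at h
    exact absurd h (hα.iterate_ne_of_mem_alphaClass hβ k)

lemma Tame.iterate_notMem_alphaClass (hα : Tame α) {β : Circle} (hβ : β ∈ alphaClass α)
    (k : ℕ) : dbl^[k + 1] β ∉ alphaClass α := by
  intro h
  obtain ⟨j, hj⟩ := hα.shift_ne k
  refine hj (notMem_semicircle_of_mem_closedSemi (h j) ?_)
  rw [← Function.iterate_add_apply, add_comm j]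
  exact hα.iterate_mem_semicircle hβ _

/-- The points `p`, `q`, `r`, `s` follow one another counterclockwise. -/
def Interlaced (p q r s : Circle) : Prop := q ∈ ccwArc p r ∧ s ∈ ccwArc r p

/-- Pairs in opposite semicircles cannot be linked. Inside one semicircle doubling is monotone,
hence preserves the linking. -/
lemma Interlaced.step {p q r s : Circle} (h : Interlaced p q r s) {l l' : Letter}
    (hp : p ∈ semicircle α l) (hr : r ∈ semicircle α l) (hq : q ∈ semicircle α l')
    (hs : s ∈ semicircle α l') : l' = l ∧ Interlaced (dbl p) (dbl q) (dbl r) (dbl s) := by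
  have hll : l' = l := by
    by_contra hne
    rw [Letter.eq_other_of_ne hne, mem_semicircle_other_iff] at hq hs
    have hp := (mem_semicircle_iff.1 hp).2
    have hr := (mem_semicircle_iff.1 hr).2
    obtain ⟨h1, h2⟩ := h
    rw [mem_ccwArc_iff (starPt α l)] at h1 h2
    rcases h1 with ⟨h1, h1'⟩ | ⟨h1, h1'⟩ | ⟨h1, h1'⟩ <;>
    rcases h2 with ⟨h2, h2'⟩ | ⟨h2, h2'⟩ | ⟨h2, h2'⟩ <;> linarith
  subst hll
  refine ⟨rfl, ?_⟩
  rw [mem_semicircle_iff] at hp hq hr hs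
  unfold Interlaced at h ⊢
  rw [mem_ccwArc_iff α, mem_ccwArc_iff α, ccwAngle_dbl hp.2, ccwAngle_dbl hq.2, ccwAngle_dbl hr.2,
    ccwAngle_dbl hs.2]
  rw [mem_ccwArc_iff (starPt α l'), mem_ccwArc_iff (starPt α l')] at h
  simpa only [mul_lt_mul_iff_right₀ (zero_lt_two (α := ℝ))] using h

/-- The leaves between points of the class of `α` are not linked with their forward images. -/
lemma Tame.not_interlaced (hα : Tame α) {β γ β' γ' : Circle} (hβ : β ∈ alphaClass α)
    (hγ : γ ∈ alphaClass α) (hβ' : β' ∈ alphaClass α) (hγ' : γ' ∈ alphaClass α) (k : ℕ) :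
    ¬ Interlaced β (dbl^[k + 1] β') γ (dbl^[k + 1] γ') := by
  intro h
  -- Linking persists under all iterates, and at each time it forces both leaves into the same
  -- semicircle. The kneading sequence would then agree with its shift by `k + 1` forever.
  have key : ∀ j, Interlaced (dbl^[j] β) (dbl^[j] (dbl^[k + 1] β')) (dbl^[j] γ)
      (dbl^[j] (dbl^[k + 1] γ')) := by
    intro j
    induction j with
    | zero => exact h
    | succ j ih =>
      simp only [Function.iterate_succ_apply' dbl j]
      refine (ih.step (hα.iterate_mem_semicircle hβ j) (hα.iterate_mem_semicircle hγ j)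
        (l' := knead α (j + (k + 1))) ?_ ?_).2 <;> rw [← Function.iterate_add_apply]
      exacts [hα.iterate_mem_semicircle hβ' _, hα.iterate_mem_semicircle hγ' _]
  obtain ⟨j, hj⟩ := hα.shift_ne k
  rw [add_comm] at hj
  refine hj ((key j).step (hα.iterate_mem_semicircle hβ j) (hα.iterate_mem_semicircle hγ j)
    (l' := knead α (j + (k + 1))) ?_ ?_).1 <;> rw [← Function.iterate_add_apply]
  exacts [hα.iterate_mem_semicircle hβ' _, hα.iterate_mem_semicircle hγ' _]

/-! ### The hull of the class of `α` and its preimage -/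

/-- The length of the shorter arc between two points. -/
noncomputable def arcDist (z w : Circle) : ℝ := min (ccwAngle z w) (ccwAngle w z)

lemma arcDist_comm (z w : Circle) : arcDist z w = arcDist w z := min_comm _ _

lemma arcDist_of_le (o : Circle) {z w : Circle} (h : ccwAngle o z ≤ ccwAngle o w) :
    arcDist z w = min (ccwAngle o w - ccwAngle o z)
      (2 * Real.pi - (ccwAngle o w - ccwAngle o z)) := by
  rcases h.eq_or_lt with h' | h'
  · rw [ccwAngle_inj] at h'
    subst h'
    simp [arcDist, Real.pi_pos.le]
  · rw [arcDist, ccwAngle_of_le h, ccwAngle_of_lt h']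
    congr 1; ring

/-- A leaf of length `a` has an image of length `min (2a) (2π - 2a)`. Only the second value can be
smaller than `arcDist α γ`, and then the end points of the image lie so close to `α` on its two
sides that the image is linked with the leaf from `α` to `γ`, contrary to `Tame.not_interlaced`. -/
lemma Tame.arcDist_le_step (hα : Tame α) {γ β β' : Circle} (hγ : γ ∈ alphaClass α)
    (hβ : β ∈ alphaClass α) (hβ' : β' ∈ alphaClass α) (k : ℕ)
    (hle : ccwAngle (starPt α (knead α k)) (dbl^[k] β) ≤
      ccwAngle (starPt α (knead α k)) (dbl^[k] β'))
    (h : arcDist α γ ≤ arcDist (dbl^[k] β) (dbl^[k] β')) :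
    arcDist α γ ≤ arcDist (dbl^[k + 1] β) (dbl^[k + 1] β') := by
  by_contra hlt
  push Not at hlt
  have h1 := mem_semicircle_iff.1 (hα.iterate_mem_semicircle hβ k)
  have h2 := mem_semicircle_iff.1 (hα.iterate_mem_semicircle hβ' k)
  have e1 := ccwAngle_dbl h1.2
  have e2 := ccwAngle_dbl h2.2
  rw [← Function.iterate_succ_apply' dbl] at e1 e2
  rw [arcDist_of_le _ hle] at h
  rw [arcDist_of_le α (by rw [e1, e2]; linarith), e1, e2] at hlt
  have hx : arcDist α γ = min (ccwAngle α γ) (2 * Real.pi - ccwAngle α γ) := by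
    rw [arcDist_of_le α (by rw [ccwAngle_self]; exact ccwAngle_nonneg _ _), ccwAngle_self, sub_zero]
  have hx1 : arcDist α γ ≤ ccwAngle α γ := hx ▸ min_le_left _ _
  have hx2 : arcDist α γ ≤ 2 * Real.pi - ccwAngle α γ := hx ▸ min_le_right _ _
  have h3 := (le_min_iff.1 h).1
  rcases min_lt_iff.1 hlt with h4 | h4
  · linarith
  refine hα.not_interlaced hα.self_mem_alphaClass hγ hβ hβ' k ⟨?_, ?_⟩ <;>
    rw [mem_ccwArc_iff α, ccwAngle_self]
  · rw [e1]; exact Or.inl ⟨by linarith, by linarith⟩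
  · rw [e2]; exact Or.inr (Or.inr ⟨by linarith, by linarith⟩)

/-- The images of a leaf between `α` and a point of its class are never shorter. -/
lemma Tame.arcDist_le_arcDist_iterate (hα : Tame α) {γ : Circle} (hγ : γ ∈ alphaClass α) (k : ℕ) :
    arcDist α γ ≤ arcDist (dbl^[k] α) (dbl^[k] γ) := by
  induction k with
  | zero => exact le_rfl
  | succ k ih =>
    rcases le_total (ccwAngle (starPt α (knead α k)) (dbl^[k] α))
      (ccwAngle (starPt α (knead α k)) (dbl^[k] γ)) with h | h
    · exact hα.arcDist_le_step hγ hα.self_mem_alphaClass hγ k h ih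
    · rw [arcDist_comm (dbl^[k] α)] at ih
      rw [arcDist_comm (dbl^[k + 1] α)]
      exact hα.arcDist_le_step hγ hγ hα.self_mem_alphaClass k h ih

lemma mem_properArc_iff {γ z : Circle} : z ∈ properArc α γ ↔
    (ccwAngle α γ ≤ Real.pi ∧ 0 < ccwAngle α z ∧ ccwAngle α z < ccwAngle α γ) ∨
    (Real.pi < ccwAngle α γ ∧ ccwAngle α γ < ccwAngle α z) := by
  unfold properArc
  split_ifs with h
  · simp [ccwArc, h, not_lt.2 h]
  · rw [mem_ccwArc_iff α, ccwAngle_self]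
    have h1 := ccwAngle_nonneg α z
    have h2 := ccwAngle_nonneg α γ
    have := Real.pi_pos
    push Not at h
    constructor
    · rintro (h3 | h3 | h3)
      · linarith
      · linarith
      · exact Or.inr ⟨h, h3.2⟩
    · rintro (h3 | h3)
      · linarith
      · exact Or.inr (Or.inr ⟨by linarith, h3.2⟩)

lemma arcDist_lt_of_mem_properArc {γ z w : Circle} (hz : z ∈ properArc α γ)
    (hw : w ∈ properArc α γ) : arcDist z w < arcDist α γ := by
  wlog hzw : ccwAngle α z ≤ ccwAngle α w generalizing z w
  · rw [arcDist_comm]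
    exact this hw hz (le_of_not_ge hzw)
  rw [arcDist_of_le α hzw, arcDist_of_le α (z := α) (w := γ)
    (by rw [ccwAngle_self]; exact ccwAngle_nonneg _ _), ccwAngle_self, sub_zero]
  rw [mem_properArc_iff] at hz hw
  have := ccwAngle_lt_two_pi α w
  refine min_lt_iff.2 (Or.inl (lt_min ?_ ?_)) <;> rcases hz with hz | hz <;>
    rcases hw with hw | hw <;> linarith

lemma Tame.iterate_ne_alphaClass (hα : Tame α) {β γ : Circle} (hβ : β ∈ alphaClass α)
    (hγ : γ ∈ alphaClass α) (k : ℕ) : dbl^[k + 1] β ≠ γ :=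
  fun h => hα.iterate_notMem_alphaClass hβ k (h ▸ hγ)

lemma mem_properArc_iff_mem_ccwArc {γ z : Circle} : z ∈ properArc α γ ↔
    (ccwAngle α γ ≤ Real.pi ∧ z ∈ ccwArc α γ) ∨ (Real.pi < ccwAngle α γ ∧ z ∈ ccwArc γ α) := by
  unfold properArc
  split_ifs with h
  · simp [h, not_lt.2 h]
  · simp [h, not_le.1 h]

/-- No forward image of the class of `α` enters the arc between `α` and a point of its class. -/
lemma Tame.iterate_notMem_properArc (hα : Tame α) {β γ : Circle} (hβ : β ∈ alphaClass α)
    (hγ : γ ∈ alphaClass α) (k : ℕ) : dbl^[k + 1] β ∉ properArc α γ := by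
  have hself := hα.self_mem_alphaClass
  intro h
  have hαγ : α ≠ γ := by
    rintro rfl
    rw [mem_properArc_iff, ccwAngle_self] at h
    have := Real.pi_pos
    rcases h with h | h <;> linarith
  -- Since the image leaves do not cross the leaf from `α` to `γ`, all points of the class enter its
  -- arc at the same time. Applied to `α` and `γ` themselves, this makes an image of their leaf
  -- shorter than the leaf.
  have key : ∀ {b b' : Circle}, b ∈ alphaClass α → b' ∈ alphaClass α →
      dbl^[k + 1] b ∈ properArc α γ → dbl^[k + 1] b' ∈ properArc α γ := by
    intro b b' hb hb' h
    by_contra h'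
    have n1' := hα.iterate_ne_alphaClass hb' hself k
    have n2' := hα.iterate_ne_alphaClass hb' hγ k
    rw [mem_properArc_iff_mem_ccwArc] at h
    rw [mem_properArc_iff_mem_ccwArc] at h'
    push Not at h'
    rcases h with ⟨h1, h2⟩ | ⟨h1, h2⟩
    · exact hα.not_interlaced hself hγ hb hb' k
        ⟨h2, (mem_ccwArc_or hαγ n1' n2').resolve_left (h'.1 h1)⟩
    · exact hα.not_interlaced hself hγ hb' hb k
        ⟨(mem_ccwArc_or hαγ n1' n2').resolve_right (h'.2 h1), h2⟩
  exact absurd (hα.arcDist_le_arcDist_iterate hγ (k + 1)) (not_le.2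
    (arcDist_lt_of_mem_properArc (key hβ hself h) (key hβ hγ h)))

/-- The angle from `α` to the last point of its class on the counterclockwise half. -/
noncomputable def ccwEnd (α : Circle) : ℝ :=
  sSup {t | t ∈ Icc 0 Real.pi ∧ α * Circle.exp t ∈ alphaClass α}

/-- The angle to `α` from the last point of its class on the clockwise half. -/
noncomputable def cwEnd (α : Circle) : ℝ :=
  sSup {t | t ∈ Icc 0 Real.pi ∧ α * Circle.exp (-t) ∈ alphaClass α}

/-- Antipodal points lie in opposite semicircles. This keeps both ends of the hull at an angle
strictly below `π` from `α`. -/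
lemma Tame.mul_exp_pi_notMem (hα : Tame α) : α * Circle.exp Real.pi ∉ alphaClass α := by
  intro h
  have h0 := mem_semicircle_iff.1 (hα.iterate_mem_semicircle hα.self_mem_alphaClass 0)
  have h1 := (mem_semicircle_iff.1 (hα.iterate_mem_semicircle h 0)).2
  simp only [Function.iterate_zero, id] at h0 h1
  rw [← mul_exp_ccwAngle (starPt α (knead α 0)) α, mul_assoc, ← Circle.exp_add,
    mul_exp_ccwAngle, ccwAngle_mul_exp _ (by linarith [Real.pi_pos]) (by linarith)] at h1
  linarith

lemma Tame.ccwEnd_mem (hα : Tame α) : 0 ≤ ccwEnd α ∧ ccwEnd α < Real.pi ∧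
    α * Circle.exp (ccwEnd α) ∈ alphaClass α := by
  have hc : IsCompact {t | t ∈ Icc 0 Real.pi ∧ α * Circle.exp t ∈ alphaClass α} :=
    isCompact_Icc.inter_right (isClosed_alphaClass.preimage (by fun_prop))
  have h := hc.sSup_mem ⟨0, ⟨le_rfl, Real.pi_pos.le⟩, by simpa using hα.self_mem_alphaClass⟩
  refine ⟨h.1.1, lt_of_le_of_ne h.1.2 fun h' => ?_, h.2⟩
  have h2 : α * Circle.exp (ccwEnd α) ∈ alphaClass α := h.2
  rw [h'] at h2
  exact hα.mul_exp_pi_notMem h2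

lemma le_ccwEnd {t : ℝ} (h0 : 0 ≤ t) (h1 : t ≤ Real.pi)
    (h : α * Circle.exp t ∈ alphaClass α) : t ≤ ccwEnd α :=
  le_csSup ⟨Real.pi, fun _ h => h.1.2⟩ ⟨⟨h0, h1⟩, h⟩

lemma Tame.cwEnd_mem (hα : Tame α) : 0 ≤ cwEnd α ∧ cwEnd α < Real.pi ∧
    α * Circle.exp (-cwEnd α) ∈ alphaClass α := by
  have hc : IsCompact {t | t ∈ Icc 0 Real.pi ∧ α * Circle.exp (-t) ∈ alphaClass α} :=
    isCompact_Icc.inter_right (isClosed_alphaClass.preimage (by fun_prop))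
  have h := hc.sSup_mem ⟨0, ⟨le_rfl, Real.pi_pos.le⟩, by simpa using hα.self_mem_alphaClass⟩
  refine ⟨h.1.1, lt_of_le_of_ne h.1.2 fun h' => ?_, h.2⟩
  have h2 : α * Circle.exp (-cwEnd α) ∈ alphaClass α := h.2
  rw [h', ← Circle.exp_add_two_pi, show -Real.pi + 2 * Real.pi = Real.pi by ring] at h2
  exact hα.mul_exp_pi_notMem h2

lemma le_cwEnd {t : ℝ} (h0 : 0 ≤ t) (h1 : t ≤ Real.pi)
    (h : α * Circle.exp (-t) ∈ alphaClass α) : t ≤ cwEnd α :=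
  le_csSup ⟨Real.pi, fun _ h => h.1.2⟩ ⟨⟨h0, h1⟩, h⟩

/-- The hull of the class of `α`: the closed arc between the last points of the class on either
side of `α`. -/
def hull (α : Circle) : Set Circle :=
  (fun t : ℝ => α * Circle.exp t) '' Icc (-cwEnd α) (ccwEnd α)

lemma isClosed_hull : IsClosed (hull α) := (isCompact_Icc.image (by fun_prop)).isClosed

lemma Tame.mem_hull_iff (hα : Tame α) {z : Circle} :
    z ∈ hull α ↔ ccwAngle α z ≤ ccwEnd α ∨ 2 * Real.pi - cwEnd α ≤ ccwAngle α z := by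
  have hx := hα.ccwEnd_mem
  have hy := hα.cwEnd_mem
  constructor
  · rintro ⟨t, ⟨h1, h2⟩, rfl⟩
    rcases le_or_gt 0 t with h | h
    · left
      change ccwAngle _ (α * Circle.exp t) ≤ _
      rwa [ccwAngle_mul_exp _ h (by linarith)]
    · right
      change _ ≤ ccwAngle _ (α * Circle.exp t)
      rw [← Circle.exp_add_two_pi, ccwAngle_mul_exp _ (by linarith) (by linarith)]
      linarith
  · rintro (h | h)
    · exact ⟨_, ⟨by linarith [ccwAngle_nonneg α z], h⟩, mul_exp_ccwAngle α z⟩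
    · refine ⟨ccwAngle α z - 2 * Real.pi, ⟨by linarith, ?_⟩, ?_⟩
      · linarith [ccwAngle_lt_two_pi α z]
      · change α * Circle.exp _ = z
        rw [Circle.exp_sub_two_pi, mul_exp_ccwAngle]

lemma Tame.iterate_notMem_hull (hα : Tame α) {β : Circle} (hβ : β ∈ alphaClass α) (k : ℕ) :
    dbl^[k + 1] β ∉ hull α := by
  obtain ⟨hx0, hx1, hx⟩ := hα.ccwEnd_mem
  obtain ⟨hy0, hy1, hy⟩ := hα.cwEnd_mem
  have hne := ccwAngle_pos (hα.iterate_ne_alphaClass hβ hα.self_mem_alphaClass k)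
  rw [hα.mem_hull_iff]
  rintro (h | h)
  · have e := ccwAngle_mul_exp α hx0 (by linarith)
    refine hα.iterate_notMem_properArc hβ hx k (mem_properArc_iff.2 (Or.inl ?_))
    rw [e]
    refine ⟨hx1.le, hne, lt_of_le_of_ne h fun h' => ?_⟩
    rw [← e, ccwAngle_inj] at h'
    exact hα.iterate_ne_alphaClass hβ hx k h'
  · have hy2 : 0 < cwEnd α := by linarith [ccwAngle_lt_two_pi α (dbl^[k + 1] β)]
    have e : ccwAngle α (α * Circle.exp (-cwEnd α)) = 2 * Real.pi - cwEnd α := by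
      rw [← Circle.exp_add_two_pi, ccwAngle_mul_exp α (by linarith) (by linarith)]
      ring
    refine hα.iterate_notMem_properArc hβ hy k (mem_properArc_iff.2 (Or.inr ?_))
    rw [e]
    refine ⟨by linarith, lt_of_le_of_ne h fun h' => ?_⟩
    rw [← e, ccwAngle_inj] at h'
    exact hα.iterate_ne_alphaClass hβ hy k h'.symm

/-- The hull of the class of `α` is disjoint from its image. -/
lemma Tame.dbl_notMem_hull (hα : Tame α) {z : Circle} (hz : z ∈ hull α) : dbl z ∉ hull α := by
  obtain ⟨hx0, hx1, hx⟩ := hα.ccwEnd_mem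
  obtain ⟨hy0, hy1, hy⟩ := hα.cwEnd_mem
  set l := knead α 0
  set s := ccwAngle (starPt α l) α with hs
  have hs' := mem_semicircle_iff.1 (hα.iterate_mem_semicircle hα.self_mem_alphaClass 0)
  change 0 < s ∧ s < Real.pi at hs'
  have hpt : ∀ t, α * Circle.exp t = starPt α l * Circle.exp (s + t) := fun t => by
    rw [Circle.exp_add, ← mul_assoc, mul_exp_ccwAngle]
  have hx' := mem_semicircle_iff.1 (hα.iterate_mem_semicircle hx 0)
  have hy' := mem_semicircle_iff.1 (hα.iterate_mem_semicircle hy 0)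
  simp only [Function.iterate_zero, id] at hx' hy'
  -- The hull lies entirely inside the open semicircle that contains `α`: extending past `⋆` would
  -- carry one of its end points into the other half.
  have hx2 : s + ccwEnd α < Real.pi := by
    by_contra h
    push Not at h
    rw [hpt, ccwAngle_mul_exp _ (by linarith) (by linarith)] at hx'
    linarith
  have hy2 : 0 < s - cwEnd α := by
    by_contra h
    push Not at h
    rw [hpt] at hy'
    rcases h.eq_or_lt with h | h
    · rw [← sub_eq_add_neg, h, Circle.exp_zero, mul_one, ccwAngle_self] at hy'
      exact lt_irrefl _ hy'.1
    · rw [← Circle.exp_add_two_pi, ccwAngle_mul_exp _ (by linarith) (by linarith)] at hy'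
      linarith
  have hd : ∀ t, -cwEnd α ≤ t → t ≤ ccwEnd α →
      ccwAngle α (dbl (α * Circle.exp t)) = 2 * (s + t) := fun t h1 h2 => by
    have e : ccwAngle (starPt α l) (α * Circle.exp t) = s + t := by
      rw [hpt, ccwAngle_mul_exp _ (by linarith) (by linarith)]
    rw [ccwAngle_dbl (l := l) (by rw [e]; linarith), e]
  -- Doubling is increasing on the hull and sends its two ends outside the hull, so the angles of
  -- the whole image are squeezed between `ccwEnd α` and `2π - cwEnd α`.
  have h1 := hα.iterate_notMem_hull hx 0
  have h2 := hα.iterate_notMem_hull hy 0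
  rw [hα.mem_hull_iff, Function.iterate_one] at h1 h2
  rw [hd _ (by linarith) le_rfl] at h1
  rw [hd _ le_rfl (by linarith)] at h2
  push Not at h1 h2
  obtain ⟨t, ht, rfl⟩ := hz
  rw [hα.mem_hull_iff]
  change ¬ (ccwAngle α (dbl (α * Circle.exp t)) ≤ _ ∨ _ ≤ ccwAngle α (dbl (α * Circle.exp t)))
  rw [hd _ ht.1 ht.2]
  push Not
  constructor <;> linarith [ht.1, ht.2]

/-- Of all arcs between `α` and points of its class, the outermost one on each side contains the
others. Their lifts therefore fill the preimage of the hull, and closeness to `C_⋆` becomes a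
condition on one further iterate. -/
lemma Tame.cStar_eq (hα : Tame α) : cStar α = dbl ⁻¹' hull α := by
  obtain ⟨hx0, hx1, hx⟩ := hα.ccwEnd_mem
  obtain ⟨hy0, hy1, hy⟩ := hα.cwEnd_mem
  apply Subset.antisymm
  · refine union_subset ?_ (iUnion₂_subset fun β hβ => iUnion_subset fun l =>
      closure_minimal ?_ (isClosed_hull.preimage continuous_dbl))
    · rintro _ ⟨l, rfl⟩
      rw [mem_preimage, dbl_starPt, hα.mem_hull_iff, ccwAngle_self]
      exact Or.inl hx0
    · rintro _ ⟨z, hz, rfl⟩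
      rw [mem_preimage, dbl_branch, hα.mem_hull_iff]
      have hβ' := hα.mem_alphaClass.2 hβ.1
      rw [← mul_exp_ccwAngle α β] at hβ'
      rcases mem_properArc_iff.1 hz with ⟨h1, h2, h3⟩ | ⟨h1, h2⟩
      · exact Or.inl (h3.le.trans (le_ccwEnd (ccwAngle_nonneg _ _) h1 hβ'))
      · rw [← Circle.exp_sub_two_pi] at hβ'
        have := le_cwEnd (t := 2 * Real.pi - ccwAngle α β) (by linarith [ccwAngle_lt_two_pi α β])
          (by linarith) (by rwa [neg_sub])
        right; linarith
  · intro z hz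
    obtain ⟨t, ht, htz⟩ := hz
    have hz' : ∃ l, z = starPt α l * Circle.exp (t / 2) := by
      have : dbl (z * Circle.exp (-t / 2)) = α := by
        rw [dbl_mul_exp, ← htz, mul_assoc, ← Circle.exp_add]
        simp [mul_div_cancel₀]
      obtain ⟨l, hl⟩ := dbl_eq_iff.1 this
      refine ⟨l, ?_⟩
      rw [← hl, mul_assoc, ← Circle.exp_add]
      simp [neg_div]
    obtain ⟨l, rfl⟩ := hz'
    rcases lt_trichotomy t 0 with h0 | h0 | h0
    · have hy2 : 0 < cwEnd α := by linarith [ht.1]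
      -- Points just clockwise of `starPt α l` belong to the end of the opposite semicircle, hence
      -- to the image of the branch of `l.other`.
      refine Or.inr (mem_iUnion₂.2 ⟨α * Circle.exp (-cwEnd α), ⟨hα.mem_alphaClass.1 hy, ?_⟩,
        mem_iUnion.2 ⟨l.other, ?_⟩⟩)
      · rw [Ne, mul_eq_left, ← Circle.exp_zero, ← Circle.exp_add_two_pi]
        intro h
        have := Circle.exp_injOn_Ico (a := 0) (b := 2 * Real.pi) (by linarith)
          ⟨by linarith, by linarith⟩ ⟨le_rfl, by linarith⟩ h
        linarith
      · have e : ccwAngle α (α * Circle.exp (-cwEnd α)) = 2 * Real.pi - cwEnd α := by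
          rw [← Circle.exp_add_two_pi, ccwAngle_mul_exp α (by linarith) (by linarith)]
          ring
        have hsub : (fun r : ℝ => starPt α l * Circle.exp r) '' Ioo (-cwEnd α / 2) 0 ⊆
            branch α l.other '' properArc α (α * Circle.exp (-cwEnd α)) := by
          rintro _ ⟨r, hr, rfl⟩
          have e' : ccwAngle α (α * Circle.exp (2 * r)) = 2 * r + 2 * Real.pi := by
            rw [← Circle.exp_add_two_pi,
              ccwAngle_mul_exp α (by linarith [hr.1]) (by linarith [hr.2])]
          refine ⟨α * Circle.exp (2 * r), mem_properArc_iff.2 (Or.inr ?_), ?_⟩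
          · rw [e, e']
            constructor <;> linarith [hr.1]
          · rw [branch, e', starPt_other, mul_assoc, ← Circle.exp_add]
            change _ = _ * Circle.exp r
            rw [← Circle.exp_add_two_pi r]
            congr 2; ring
        refine closure_mono hsub (image_closure_subset_closure_image (by fun_prop)
          ⟨t / 2, ?_, rfl⟩)
        rw [closure_Ioo (by linarith)]
        constructor <;> linarith [ht.1]
    · exact Or.inl ⟨l, by simp [h0]⟩
    · have hx2 : 0 < ccwEnd α := by linarith [ht.2]
      refine Or.inr (mem_iUnion₂.2 ⟨α * Circle.exp (ccwEnd α), ⟨hα.mem_alphaClass.1 hx, ?_⟩,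
        mem_iUnion.2 ⟨l, ?_⟩⟩)
      · rw [Ne, mul_eq_left, ← Circle.exp_zero]
        intro h
        have := Circle.exp_injOn_Ico (a := 0) (b := 2 * Real.pi) (by linarith)
          ⟨by linarith, by linarith⟩ ⟨le_rfl, by linarith⟩ h
        linarith
      · have e := ccwAngle_mul_exp α hx0 (by linarith)
        have hsub : (fun r : ℝ => starPt α l * Circle.exp r) '' Ioo 0 (ccwEnd α / 2) ⊆
            branch α l '' properArc α (α * Circle.exp (ccwEnd α)) := by
          rintro _ ⟨r, hr, rfl⟩
          have e' : ccwAngle α (α * Circle.exp (2 * r)) = 2 * r :=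
            ccwAngle_mul_exp α (by linarith [hr.1]) (by linarith [hr.2])
          refine ⟨α * Circle.exp (2 * r), mem_properArc_iff.2 (Or.inl ?_), ?_⟩
          · rw [e, e']
            exact ⟨hx1.le, by linarith [hr.1], by linarith [hr.2]⟩
          · rw [branch, e', mul_div_cancel_left₀ _ two_ne_zero]
        refine closure_mono hsub (image_closure_subset_closure_image (by fun_prop)
          ⟨t / 2, ?_, rfl⟩)
        rw [closure_Ioo (by linarith)]
        constructor <;> linarith [ht.2]

/-! ### The leaves that separate `α` from `⋆` -/

/-- The first `n` letters of the kneading sequence. -/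
noncomputable def kneadPre (α : Circle) (n : ℕ) : List Letter := (List.range n).map (knead α)

@[simp] lemma length_kneadPre (n : ℕ) : (kneadPre α n).length = n := by simp [kneadPre]

lemma kneadPre_succ (n : ℕ) : kneadPre α (n + 1) = kneadPre α n ++ [knead α n] := by
  simp [kneadPre, List.range_succ]

lemma kneadPre_add {n t : ℕ} (h : ∀ j < t, knead α (n + j) = knead α j) :
    kneadPre α (n + t) = kneadPre α n ++ kneadPre α t := by
  induction t with
  | zero => simp [kneadPre]
  | succ t ih =>
    rw [← add_assoc, kneadPre_succ, kneadPre_succ, ih fun j hj => h j (by omega), h t (by omega),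
      List.append_assoc]

/-- The first end point, counterclockwise from `α`, of the leaf of the word `kneadPre α n`. -/
noncomputable def ccwLeaf (α : Circle) (n : ℕ) : Circle :=
  leafEnd α (kneadPre α n) (knead α n).other

/-- The last end point, counterclockwise from `α`, of the leaf of the word `kneadPre α n`. -/
noncomputable def cwLeaf (α : Circle) (n : ℕ) : Circle :=
  leafEnd α (kneadPre α n) (knead α n)

lemma wordBranch_kneadPre {n : ℕ} {z : Circle}
    (hz : ∀ j < n, dbl^[j] z ∈ semicircle α (knead α j)) :
    wordBranch α (kneadPre α n) (dbl^[n] z) = z := by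
  induction n with
  | zero => rfl
  | succ n ih =>
    rw [kneadPre_succ, wordBranch_append]
    change wordBranch α _ (branch α _ (dbl^[n + 1] z)) = z
    rw [Function.iterate_succ_apply', branch_dbl (hz n (by omega)), ih fun j hj => hz j (by omega)]

/-- The class of `α` lies on one side of each of these leaves. -/
lemma Tame.mem_ccwArc_leaf (hα : Tame α) {β : Circle} (hβ : β ∈ alphaClass α) (n : ℕ) :
    β ∈ ccwArc (cwLeaf α n) (ccwLeaf α n) := by
  have h := hα.iterate_mem_semicircle hβ n
  rw [semicircle_eq] at h
  have := wordBranch_mem_ccwArc (α := α) (kneadPre α n) h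
  rwa [wordBranch_kneadPre fun j _ => hα.iterate_mem_semicircle hβ j] at this

lemma Tame.ccwLeaf_lt_cwLeaf (hα : Tame α) (n : ℕ) :
    0 < ccwAngle α (ccwLeaf α n) ∧ ccwAngle α (ccwLeaf α n) < ccwAngle α (cwLeaf α n) := by
  have h := hα.mem_ccwArc_leaf hα.self_mem_alphaClass n
  rw [mem_ccwArc_iff α, ccwAngle_self] at h
  have := ccwAngle_nonneg α (cwLeaf α n)
  have := ccwAngle_nonneg α (ccwLeaf α n)
  rcases h with h | h | h
  · linarith
  · exact h
  · linarith

/-- The forward image of `α` whose itinerary first agrees with the kneading sequence for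
`agree α n` digits is separated from `α` by the corresponding leaf. -/
lemma Tame.ccwLeaf_lt_iterate (hα : Tame α) (n : ℕ) :
    ccwAngle α (ccwLeaf α (agree α n)) < ccwAngle α (dbl^[n + 1] α) ∧
      ccwAngle α (dbl^[n + 1] α) < ccwAngle α (cwLeaf α (agree α n)) := by
  set t := agree α n
  have hmem : ∀ j, dbl^[j] (dbl^[n + 1] α) ∈ semicircle α (knead α (n + 1 + j)) := fun j => by
    rw [← Function.iterate_add_apply, add_comm]
    exact iterate_mem_semicircle_knead hα.iterate_ne _
  have h := hmem t
  rw [Letter.eq_other_of_ne (knead_agree_ne (hα.shift_ne n)), semicircle_eq,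
    Letter.other_other] at h
  have h1 := wordBranch_mem_ccwArc (α := α) (kneadPre α t) h
  rw [wordBranch_kneadPre fun j hj => by rw [← knead_eq_of_lt_agree hj]; exact hmem j] at h1
  change _ ∈ ccwArc (ccwLeaf α t) (cwLeaf α t) at h1
  have h2 := (hα.ccwLeaf_lt_cwLeaf t).2
  rw [mem_ccwArc_iff α] at h1
  rcases h1 with h1 | h1 | h1
  · exact h1
  · linarith
  · linarith

lemma knead_add_agree (hα : Tame α) (n : ℕ) :
    knead α (n + 1 + agree α n) = (knead α (agree α n)).other :=
  Letter.eq_other_of_ne (knead_agree_ne (hα.shift_ne n))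

/-- Up to digit `agree α n` the shifted sequence continues like the original; there the letter
flips, so the two ends of the leaf exchange their sides of `α`. -/
lemma Tame.wordBranch_ccwLeaf (hα : Tame α) (n : ℕ) :
    wordBranch α (kneadPre α (n + 1)) (ccwLeaf α (agree α n)) =
      cwLeaf α (n + 1 + agree α n) := by
  rw [cwLeaf, leafEnd, kneadPre_add fun j hj => knead_eq_of_lt_agree hj, wordBranch_append,
    knead_add_agree hα]
  rfl

lemma Tame.wordBranch_cwLeaf (hα : Tame α) (n : ℕ) :
    wordBranch α (kneadPre α (n + 1)) (cwLeaf α (agree α n)) =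
      ccwLeaf α (n + 1 + agree α n) := by
  rw [ccwLeaf, leafEnd, kneadPre_add fun j hj => knead_eq_of_lt_agree hj, wordBranch_append,
    knead_add_agree hα, Letter.other_other]
  rfl

lemma Tame.wordBranch_kneadPre_iterate (hα : Tame α) (n : ℕ) :
    wordBranch α (kneadPre α n) (dbl^[n] α) = α :=
  wordBranch_kneadPre fun j _ => iterate_mem_semicircle_knead hα.iterate_ne j

/-- The branch preserves cyclic order and carries `dbl^[n] α` to `α`. The order of points before
`dbl^[n] α`, seen from `⋆`, thus becomes their order seen from `α`. -/
lemma Tame.wordBranch_lt_of_lt_left (hα : Tame α) (n : ℕ) {z w : Circle}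
    (hzw : ccwAngle (starPt α (knead α n)) z < ccwAngle (starPt α (knead α n)) w)
    (hw : ccwAngle (starPt α (knead α n)) w < ccwAngle (starPt α (knead α n)) (dbl^[n] α)) :
    ccwAngle α (wordBranch α (kneadPre α n) z) < ccwAngle α (wordBranch α (kneadPre α n) w) := by
  have h : w ∈ ccwArc z (dbl^[n] α) := (mem_ccwArc_iff _).2 (Or.inl ⟨hzw, hw⟩)
  have h' := wordBranch_mem_ccwArc (α := α) (kneadPre α n) h
  rw [hα.wordBranch_kneadPre_iterate, mem_ccwArc_iff α, ccwAngle_self] at h'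
  have := ccwAngle_nonneg α (wordBranch α (kneadPre α n) z)
  have := ccwAngle_nonneg α (wordBranch α (kneadPre α n) w)
  rcases h' with h' | h' | h' <;> linarith

lemma Tame.wordBranch_lt_of_lt_right (hα : Tame α) (n : ℕ) {z w : Circle}
    (hzw : ccwAngle (starPt α (knead α n)) z < ccwAngle (starPt α (knead α n)) w)
    (hz : ccwAngle (starPt α (knead α n)) (dbl^[n] α) < ccwAngle (starPt α (knead α n)) z) :
    ccwAngle α (wordBranch α (kneadPre α n) z) < ccwAngle α (wordBranch α (kneadPre α n) w) := by
  have h : z ∈ ccwArc (dbl^[n] α) w := (mem_ccwArc_iff _).2 (Or.inl ⟨hz, hzw⟩)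
  have h' := wordBranch_mem_ccwArc (α := α) (kneadPre α n) h
  rw [hα.wordBranch_kneadPre_iterate, mem_ccwArc_iff α, ccwAngle_self] at h'
  have := ccwAngle_nonneg α (wordBranch α (kneadPre α n) z)
  have := ccwAngle_nonneg α (wordBranch α (kneadPre α n) w)
  rcases h' with h' | h' | h' <;> linarith

lemma wordBranch_kneadPre_succ (n : ℕ) (q : Circle) : wordBranch α (kneadPre α (n + 1)) q =
    wordBranch α (kneadPre α n) (branch α (knead α n) q) := by
  rw [kneadPre_succ, wordBranch_append]; rfl

lemma Tame.ccwAngle_iterate (hα : Tame α) (n : ℕ) :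
    ccwAngle (starPt α (knead α n)) (dbl^[n] α) = ccwAngle α (dbl^[n + 1] α) / 2 := by
  rw [Function.iterate_succ_apply', ccwAngle_dbl
    (mem_semicircle_iff.1 (iterate_mem_semicircle_knead hα.iterate_ne n)).2]
  ring

/-- On the counterclockwise side of `α`, the inverse branch along `kneadPre α (n + 1)` is monotone
and maps to the clockwise side. -/
lemma Tame.wordBranch_mono_left (hα : Tame α) (n : ℕ) {p q : Circle}
    (hpq : ccwAngle α p < ccwAngle α q)
    (hq : ccwAngle α q ≤ ccwAngle α (ccwLeaf α (agree α n))) :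
    ccwAngle α (wordBranch α (kneadPre α (n + 1)) p) <
      ccwAngle α (wordBranch α (kneadPre α (n + 1)) q) := by
  simp only [wordBranch_kneadPre_succ]
  apply hα.wordBranch_lt_of_lt_left <;> simp only [ccwAngle_branch, hα.ccwAngle_iterate]
  · linarith
  · linarith [(hα.ccwLeaf_lt_iterate n).1]

lemma Tame.wordBranch_mono_right (hα : Tame α) (n : ℕ) {p q : Circle}
    (hpq : ccwAngle α p < ccwAngle α q)
    (hp : ccwAngle α (cwLeaf α (agree α n)) ≤ ccwAngle α p) :
    ccwAngle α (wordBranch α (kneadPre α (n + 1)) p) <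
      ccwAngle α (wordBranch α (kneadPre α (n + 1)) q) := by
  simp only [wordBranch_kneadPre_succ]
  apply hα.wordBranch_lt_of_lt_right <;> simp only [ccwAngle_branch, hα.ccwAngle_iterate]
  · linarith
  · linarith [(hα.ccwLeaf_lt_iterate n).2]

/-- At its jump `α` the last branch takes the value at angle `0`, which is an end of the `⋆` leaf.
-/
lemma wordBranch_kneadPre_self (n : ℕ) : wordBranch α (kneadPre α (n + 1)) α = cwLeaf α n := by
  rw [wordBranch_kneadPre_succ, branch, ccwAngle_self]
  simp [cwLeaf, leafEnd]

lemma Tame.cwLeaf_lt (hα : Tame α) (n : ℕ) :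
    ccwAngle α (cwLeaf α n) < ccwAngle α (cwLeaf α (n + 1 + agree α n)) := by
  rw [← wordBranch_kneadPre_self n, ← hα.wordBranch_ccwLeaf]
  refine hα.wordBranch_mono_left n ?_ le_rfl
  rw [ccwAngle_self]
  exact (hα.ccwLeaf_lt_cwLeaf _).1

lemma Tame.wordBranch_lt_ccwLeaf (hα : Tame α) (n : ℕ) {p : Circle}
    (hp : ccwAngle α (cwLeaf α (agree α n)) ≤ ccwAngle α p) :
    ccwAngle α (wordBranch α (kneadPre α (n + 1)) p) < ccwAngle α (ccwLeaf α n) := by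
  rw [wordBranch_kneadPre_succ]
  apply hα.wordBranch_lt_of_lt_right <;> simp only [ccwAngle_branch, hα.ccwAngle_iterate]
  · rw [ccwAngle_starPt_other]
    linarith [ccwAngle_lt_two_pi α p]
  · linarith [(hα.ccwLeaf_lt_iterate n).2]

lemma Tame.ccwLeaf_lt (hα : Tame α) (n : ℕ) :
    ccwAngle α (ccwLeaf α (n + 1 + agree α n)) < ccwAngle α (ccwLeaf α n) := by
  rw [← hα.wordBranch_cwLeaf]
  exact hα.wordBranch_lt_ccwLeaf n le_rfl

/-- The arc from `α` to the leaf of level `agree α n` lands in the band between two nested leaves on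
the opposite side of `α`. For `n = cut α k` these are the leaves at consecutive cutting times. -/
lemma Tame.wordBranch_of_le (hα : Tame α) (n : ℕ) {q : Circle}
    (hq : ccwAngle α q ≤ ccwAngle α (ccwLeaf α (agree α n))) :
    ccwAngle α (cwLeaf α n) ≤ ccwAngle α (wordBranch α (kneadPre α (n + 1)) q) ∧
      ccwAngle α (wordBranch α (kneadPre α (n + 1)) q) ≤
        ccwAngle α (cwLeaf α (n + 1 + agree α n)) := by
  constructor
  · rw [← wordBranch_kneadPre_self n]
    rcases (ccwAngle_nonneg α q).eq_or_lt with h | h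
    · rw [← ccwAngle_self α, ccwAngle_inj] at h
      rw [h]
    · exact (hα.wordBranch_mono_left n (by rwa [ccwAngle_self]) hq).le
  · rw [← hα.wordBranch_ccwLeaf]
    rcases hq.eq_or_lt with h | h
    · rw [ccwAngle_inj] at h
      rw [h]
    · exact (hα.wordBranch_mono_left n h le_rfl).le

lemma Tame.wordBranch_of_ge (hα : Tame α) (n : ℕ) {q : Circle}
    (hq : ccwAngle α (cwLeaf α (agree α n)) ≤ ccwAngle α q) :
    ccwAngle α (ccwLeaf α (n + 1 + agree α n)) ≤
        ccwAngle α (wordBranch α (kneadPre α (n + 1)) q) ∧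
      ccwAngle α (wordBranch α (kneadPre α (n + 1)) q) ≤ ccwAngle α (ccwLeaf α n) := by
  refine ⟨?_, (hα.wordBranch_lt_ccwLeaf n hq).le⟩
  rw [← hα.wordBranch_cwLeaf]
  rcases hq.eq_or_lt with h | h
  · rw [ccwAngle_inj] at h
    rw [h]
  · exact (hα.wordBranch_mono_right n h le_rfl).le

lemma Tame.strictAnti_ccwLeaf (hα : Tame α) :
    StrictAnti fun k => ccwAngle α (ccwLeaf α (cut α k)) :=
  strictAnti_nat_of_succ_lt fun k => hα.ccwLeaf_lt (cut α k)

lemma Tame.strictMono_cwLeaf (hα : Tame α) :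
    StrictMono fun k => ccwAngle α (cwLeaf α (cut α k)) :=
  strictMono_nat_of_lt_succ fun k => hα.cwLeaf_lt (cut α k)

lemma Tame.ccwLeaf_zero_lt (hα : Tame α) : ccwAngle α (ccwLeaf α 0) < Real.pi ∧
    Real.pi < ccwAngle α (cwLeaf α 0) := by
  have h := mem_semicircle_iff.1 (iterate_mem_semicircle_knead hα.iterate_ne 0)
  simp only [Function.iterate_zero, id] at h
  have e3 : ccwAngle (starPt α (knead α 0)) (ccwLeaf α 0) = Real.pi := ccwAngle_starPt_other _
  have e4 : ccwAngle (starPt α (knead α 0)) (cwLeaf α 0) = 0 := ccwAngle_self _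
  have e1 := ccwAngle_of_le (h.2.le.trans e3.ge)
  have e2 := ccwAngle_of_lt (e4.trans_lt h.1)
  rw [e1, e2, e3, e4]
  constructor <;> linarith

lemma Tame.ccwAngle_ccwEnd (hα : Tame α) :
    ccwAngle α (α * Circle.exp (ccwEnd α)) = ccwEnd α :=
  ccwAngle_mul_exp _ hα.ccwEnd_mem.1 (by linarith [hα.ccwEnd_mem.2.1, Real.pi_pos])

lemma Tame.ccwAngle_cwEnd (hα : Tame α) (h : 0 < cwEnd α) :
    ccwAngle α (α * Circle.exp (-cwEnd α)) = 2 * Real.pi - cwEnd α := by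
  rw [← Circle.exp_add_two_pi, ccwAngle_mul_exp α (by linarith [hα.cwEnd_mem.2.1, Real.pi_pos])
    (by linarith)]
  ring

lemma Tame.lt_or_lt_of_mem (hα : Tame α) {β : Circle} (hβ : β ∈ alphaClass α) (n : ℕ) :
    ccwAngle α β < ccwAngle α (ccwLeaf α n) ∨ ccwAngle α (cwLeaf α n) < ccwAngle α β := by
  have h := hα.mem_ccwArc_leaf hβ n
  have h2 := hα.ccwLeaf_lt_cwLeaf n
  rw [mem_ccwArc_iff α] at h
  rcases h with h | h | h
  · linarith
  · exact Or.inl h.1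
  · exact Or.inr h.2

/-- The hull of the class of `α` is inside of the leaf if some point on the far side of this leaf
is outside of the hull. -/
lemma Tame.hull_inside (hα : Tame α) {n : ℕ} {z : Circle} (hz : z ∉ hull α)
    (h1 : ccwAngle α (ccwLeaf α n) ≤ ccwAngle α z) (h2 : ccwAngle α z ≤ ccwAngle α (cwLeaf α n)) :
    ccwEnd α < ccwAngle α (ccwLeaf α n) ∧ ccwAngle α (cwLeaf α n) < 2 * Real.pi - cwEnd α := by
  rw [hα.mem_hull_iff] at hz
  push Not at hz
  constructor
  · rcases hα.lt_or_lt_of_mem hα.ccwEnd_mem.2.2 n with h | h <;> rw [hα.ccwAngle_ccwEnd] at h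
    · exact h
    · linarith
  · rcases hα.cwEnd_mem.1.eq_or_lt with h0 | h0
    · rw [← h0, sub_zero]
      exact ccwAngle_lt_two_pi _ _
    · rcases hα.lt_or_lt_of_mem hα.cwEnd_mem.2.2 n with h | h <;> rw [hα.ccwAngle_cwEnd h0] at h
      · linarith
      · exact h

/-- The point `dbl^[n + 1] α` is outside the hull and is separated from `α` by this leaf. -/
lemma Tame.hull_inside_agree (hα : Tame α) (n : ℕ) :
    ccwEnd α < ccwAngle α (ccwLeaf α (agree α n)) ∧
      ccwAngle α (cwLeaf α (agree α n)) < 2 * Real.pi - cwEnd α :=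
  hα.hull_inside (hα.iterate_notMem_hull hα.self_mem_alphaClass n) (hα.ccwLeaf_lt_iterate n).1.le
    (hα.ccwLeaf_lt_iterate n).2.le

/-- Here the antipode of `α` is the witness beyond the leaf: it is already beyond the leaf of level
`0`, and the cutting leaves are nested. -/
lemma Tame.hull_inside_cut (hα : Tame α) (k : ℕ) :
    ccwEnd α < ccwAngle α (ccwLeaf α (cut α k)) ∧
      ccwAngle α (cwLeaf α (cut α k)) < 2 * Real.pi - cwEnd α := by
  have e : ccwAngle α (α * Circle.exp Real.pi) = Real.pi :=
    ccwAngle_mul_exp _ Real.pi_pos.le (by linarith [Real.pi_pos])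
  refine hα.hull_inside (z := α * Circle.exp Real.pi) ?_ ?_ ?_
  · rw [hα.mem_hull_iff, e]
    have := hα.ccwEnd_mem.2.1
    have := hα.cwEnd_mem.2.1
    push Not
    constructor <;> linarith
  · rw [e]
    have h : ccwAngle α (ccwLeaf α (cut α k)) ≤ ccwAngle α (ccwLeaf α (cut α 0)) :=
      hα.strictAnti_ccwLeaf.antitone (Nat.zero_le k)
    exact h.trans hα.ccwLeaf_zero_lt.1.le
  · rw [e]
    have h : ccwAngle α (cwLeaf α (cut α 0)) ≤ ccwAngle α (cwLeaf α (cut α k)) :=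
      hα.strictMono_cwLeaf.monotone (Nat.zero_le k)
    exact hα.ccwLeaf_zero_lt.2.le.trans h

lemma mem_closedSemi_of_hasPrefix_kneadPre {n j : ℕ} (hj : j < n) {z : Circle}
    (hz : HasPrefix α (kneadPre α n) z) : dbl^[j] z ∈ closedSemi α (knead α j) := by
  obtain ⟨m, rfl⟩ := Nat.exists_eq_add_of_lt hj
  have h : kneadPre α (j + m + 1) =
      kneadPre α (j + 1) ++ (List.range m).map fun i => knead α (j + 1 + i) := by
    rw [show j + m + 1 = j + 1 + m by ring, kneadPre, List.range_add, List.map_append,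
      List.map_map]
    rfl
  rw [h, hasPrefix_append, kneadPre_succ, hasPrefix_append, length_kneadPre] at hz
  exact hz.1.2.1

lemma mem_alphaClass_of_tendsto {f : ℕ → Circle} {z : Circle}
    (hf : ∀ k, HasPrefix α (kneadPre α (cut α k)) (f k))
    (hz : Filter.Tendsto f Filter.atTop (nhds z)) : z ∈ alphaClass α := by
  intro j
  refine (isClosed_closedSemi (knead α j)).mem_of_tendsto
    (((continuous_dbl.iterate j).tendsto z).comp hz) ?_
  filter_upwards [Filter.eventually_gt_atTop j] with k hk
  exact mem_closedSemi_of_hasPrefix_kneadPre (hk.trans_le (cut_strictMono.id_le k)) (hf k)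

/-- The leaves at the cutting times converge to the hull of the class of `α`. -/
lemma Tame.tendsto_ccwLeaf (hα : Tame α) :
    Filter.Tendsto (fun k => ccwAngle α (ccwLeaf α (cut α k))) Filter.atTop
      (nhds (ccwEnd α)) := by
  have hbdd : BddBelow (range fun k => ccwAngle α (ccwLeaf α (cut α k))) :=
    ⟨0, by rintro _ ⟨k, rfl⟩; exact ccwAngle_nonneg _ _⟩
  have h := tendsto_atTop_ciInf hα.strictAnti_ccwLeaf.antitone hbdd
  set Z := ⨅ k, ccwAngle α (ccwLeaf α (cut α k))
  have h1 : ccwEnd α ≤ Z := le_ciInf fun k => (hα.hull_inside_cut k).1.le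
  have h2 : Z ≤ Real.pi := (ciInf_le hbdd 0).trans hα.ccwLeaf_zero_lt.1.le
  -- The limit of the leaf ends has all prefixes of the kneading sequence, so it belongs to the
  -- class and cannot lie beyond `ccwEnd α`.
  have h3 : α * Circle.exp Z ∈ alphaClass α := by
    refine mem_alphaClass_of_tendsto (f := fun k => ccwLeaf α (cut α k))
      (fun k => hasPrefix_wordBranch (kneadPre α (cut α k)) (starPt α (knead α (cut α k)).other)) ?_
    have hc : Continuous fun t : ℝ => α * Circle.exp t := by fun_prop
    refine ((hc.tendsto Z).comp h).congr fun k => ?_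
    exact mul_exp_ccwAngle _ _
  have h4 := le_ccwEnd (hα.ccwEnd_mem.1.trans h1) h2 h3
  rwa [le_antisymm h4 h1] at h

lemma Tame.tendsto_cwLeaf (hα : Tame α) :
    Filter.Tendsto (fun k => ccwAngle α (cwLeaf α (cut α k))) Filter.atTop
      (nhds (2 * Real.pi - cwEnd α)) := by
  have hbdd : BddAbove (range fun k => ccwAngle α (cwLeaf α (cut α k))) :=
    ⟨2 * Real.pi, by rintro _ ⟨k, rfl⟩; exact (ccwAngle_lt_two_pi _ _).le⟩
  have h := tendsto_atTop_ciSup hα.strictMono_cwLeaf.monotone hbdd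
  set Z := ⨆ k, ccwAngle α (cwLeaf α (cut α k))
  have h1 : Z ≤ 2 * Real.pi - cwEnd α := ciSup_le fun k => (hα.hull_inside_cut k).2.le
  have h2 : Real.pi ≤ Z := hα.ccwLeaf_zero_lt.2.le.trans (le_ciSup hbdd 0)
  have h3 : α * Circle.exp (-(2 * Real.pi - Z)) ∈ alphaClass α := by
    rw [neg_sub, Circle.exp_sub_two_pi]
    refine mem_alphaClass_of_tendsto (f := fun k => cwLeaf α (cut α k))
      (fun k => hasPrefix_wordBranch (kneadPre α (cut α k)) (starPt α (knead α (cut α k)))) ?_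
    have hc : Continuous fun t : ℝ => α * Circle.exp t := by fun_prop
    refine ((hc.tendsto Z).comp h).congr fun k => ?_
    exact mul_exp_ccwAngle _ _
  have h4 := le_cwEnd (by linarith [hα.cwEnd_mem.1]) (by linarith) h3
  rwa [le_antisymm h1 (by linarith)] at h

/-! ### Cantor sets of points with prescribed itineraries -/

lemma dist_dbl_le (z w : Circle) : dist (dbl z) (dbl w) ≤ 2 * dist z w := by
  change dist ((dbl z : Circle) : ℂ) (dbl w : Circle) ≤ 2 * dist (z : ℂ) w
  rw [dist_eq_norm, dist_eq_norm]
  have h : ((dbl z : Circle) : ℂ) - (dbl w : Circle) = ((z : ℂ) + w) * ((z : ℂ) - w) := by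
    simp only [dbl, Circle.coe_pow]; ring
  rw [h, norm_mul]
  gcongr
  refine (norm_add_le _ _).trans ?_
  simp only [Circle.norm_coe]
  norm_num

lemma dist_iterate_dbl_le (n : ℕ) (z w : Circle) :
    dist (dbl^[n] z) (dbl^[n] w) ≤ 2 ^ n * dist z w := by
  induction n with
  | zero => simp
  | succ n ih =>
    rw [Function.iterate_succ_apply', Function.iterate_succ_apply']
    refine (dist_dbl_le _ _).trans ?_
    rw [pow_succ']
    linarith

/-- The point `z` follows the first `k` terms of the sequence `s`: its itinerary starts with the
corresponding words `c (s i)`, and it visits the sets `Q (s i)` at the corresponding times. -/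
def Follows (α : Circle) (c : Bool → List Letter) (Q : Bool → Set Circle) :
    ℕ → (ℕ → Bool) → Circle → Prop
  | 0, _, _ => True
  | k + 1, s, z => z ∈ Q (s 0) ∧ HasPrefix α (c (s 0)) z ∧
      Follows α c Q k (fun i => s (i + 1)) (dbl^[(c (s 0)).length] z)

variable {c : Bool → List Letter} {Q Q' : Bool → Set Circle}

lemma isClosed_follows (hQ : ∀ i, IsClosed (Q i)) (k : ℕ) (s : ℕ → Bool) :
    IsClosed {z | Follows α c Q k s z} := by
  induction k generalizing s with
  | zero => simp [Follows]
  | succ k ih =>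
    exact (hQ _).inter ((isClosed_hasPrefix _).inter ((ih _).preimage (continuous_dbl.iterate _)))

lemma Follows.congr {k : ℕ} {s s' : ℕ → Bool} (h : ∀ i < k, s i = s' i) {z : Circle}
    (hz : Follows α c Q k s z) : Follows α c Q k s' z := by
  induction k generalizing s s' z with
  | zero => trivial
  | succ k ih =>
    rw [Follows, ← h 0 (by omega)]
    exact ⟨hz.1, hz.2.1, ih (fun i hi => h (i + 1) (by omega)) hz.2.2⟩

lemma Follows.of_succ {k : ℕ} {s : ℕ → Bool} {z : Circle} (hz : Follows α c Q (k + 1) s z) :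
    Follows α c Q k s z := by
  induction k generalizing s z with
  | zero => trivial
  | succ k ih => exact ⟨hz.1, hz.2.1, ih hz.2.2⟩

lemma exists_follows {Y : Set Circle} (hY : Y.Nonempty)
    (hmap : ∀ i, ∀ z ∈ Y, wordBranch α (c i) z ∈ Y ∩ Q i) (k : ℕ) (s : ℕ → Bool) :
    ∃ z ∈ Y, Follows α c Q k s z := by
  induction k generalizing s with
  | zero => exact ⟨_, hY.some_mem, trivial⟩
  | succ k ih =>
    obtain ⟨z, hz, hzF⟩ := ih fun i => s (i + 1)
    refine ⟨_, (hmap (s 0) z hz).1, (hmap (s 0) z hz).2, hasPrefix_wordBranch _ _, ?_⟩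
    rwa [iterate_dbl_wordBranch]

/-- Only the words matter here, not the visited sets: this is how a code yields equivalent points on
the two sides of the hull. -/
lemma sameItinerary_of_follows (hc : ∀ i, c i ≠ []) {s : ℕ → Bool} {z z' : Circle}
    (hz : ∀ k, Follows α c Q k s z) (hz' : ∀ k, Follows α c Q' k s z') :
    SameItinerary α z z' := by
  have key : ∀ (j k : ℕ) (s : ℕ → Bool) (z z' : Circle), j < k → Follows α c Q k s z →
      Follows α c Q' k s z' → ∃ l, dbl^[j] z ∈ closedSemi α l ∧ dbl^[j] z' ∈ closedSemi α l := by
    intro j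
    induction j using Nat.strong_induction_on with
    | _ j ih =>
      intro k s z z' hjk hz hz'
      obtain ⟨k, rfl⟩ : ∃ k', k = k' + 1 := ⟨k - 1, by omega⟩
      rcases lt_or_ge j (c (s 0)).length with h | h
      · exact hz.2.1.exists_mem_closedSemi hz'.2.1 h
      · have hpos := List.length_pos_iff.2 (hc (s 0))
        have := ih (j - (c (s 0)).length) (by omega) k _ _ _ (by omega) hz.2.2 hz'.2.2
        rwa [← Function.iterate_add_apply, ← Function.iterate_add_apply,
          Nat.sub_add_cancel h] at this
  exact fun j => key j (j + 1) s z z' j.lt_succ_self (hz _) (hz' _)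

/-- After the common `k` blocks the two points lie in sets at distance at least `η`, and each block
of length `N` stretches distances by at most `2 ^ N`. A common block length makes the bound depend
on `k` alone. -/
lemma le_dist_of_follows {N : ℕ} (hN : ∀ i, (c i).length = N) {η : ℝ}
    (hη : ∀ z ∈ Q true, ∀ w ∈ Q false, η ≤ dist z w) {k : ℕ} {s s' : ℕ → Bool}
    (h : ∀ i < k, s i = s' i) (hk : s k ≠ s' k) {z z' : Circle}
    (hz : Follows α c Q (k + 1) s z) (hz' : Follows α c Q (k + 1) s' z') :
    η * (1 / 2 ^ N) ^ k ≤ dist z z' := by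
  induction k generalizing s s' z z' with
  | zero =>
    rw [pow_zero, mul_one]
    have h1 := hz.1
    have h2 := hz'.1
    cases hs : s 0 <;> cases hs' : s' 0 <;> rw [hs] at h1 <;> rw [hs'] at h2 <;>
      simp only [hs, hs', ne_eq, not_true_eq_false] at hk
    · rw [dist_comm]; exact hη _ h2 _ h1
    · exact hη _ h1 _ h2
  | succ k ih =>
    have h1 := ih (fun i hi => h (i + 1) (by omega)) hk hz.2.2 hz'.2.2
    rw [hN, hN] at h1
    have h2 := h1.trans (dist_iterate_dbl_le N z z')
    rw [pow_succ, ← mul_assoc, mul_one_div, div_le_iff₀ (by positivity)]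
    linarith

/-- A family of points, indexed by binary sequences, whose mutual distances are bounded from below
exponentially in the length of the common prefix of the indices. -/
def ExpSeparated {X : Type*} [Dist X] (f : (ℕ → Bool) → X) : Prop :=
  ∃ η > 0, ∃ ρ > 0, ∀ s s' k, (∀ i < k, s i = s' i) → s k ≠ s' k → η * ρ ^ k ≤ dist (f s) (f s')

/-- A measurable choice of points that follow given binary sequences. -/
lemma exists_measurable_follows (hQ : ∀ i, IsClosed (Q i)) {Y : Set Circle} (hY : Y.Nonempty)
    (hmap : ∀ i, ∀ z ∈ Y, wordBranch α (c i) z ∈ Y ∩ Q i) {p q : ℝ}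
    (hpq : ∀ i, Q i ⊆ (fun t : ℝ => α * Circle.exp t) '' Icc p q) :
    ∃ y : (ℕ → Bool) → ℝ, Measurable y ∧ (∀ s, y s ∈ Icc p q) ∧
      ∀ s k, Follows α c Q k s (α * Circle.exp (y s)) := by
  let F : ℕ → (ℕ → Bool) → Set ℝ := fun k s =>
    Icc p q ∩ {t | Follows α c Q k s (α * Circle.exp t)}
  have hFc : ∀ k s, IsCompact (F k s) := fun k s =>
    isCompact_Icc.inter_right ((isClosed_follows hQ k s).preimage
      (f := fun t : ℝ => α * Circle.exp t) (by fun_prop))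
  have hFa : ∀ k s, F (k + 1) s ⊆ F k s := fun k s t ht => ⟨ht.1, Follows.of_succ ht.2⟩
  have hFn : ∀ k s, (F k s).Nonempty := fun k s => by
    obtain ⟨z, -, hz⟩ := exists_follows hY hmap (k + 1) s
    obtain ⟨t, ht, rfl⟩ := hpq _ hz.1
    exact ⟨t, ht, hz.of_succ⟩
  have hGc : ∀ s, IsCompact (⋂ k, F k s) := fun s =>
    (hFc 0 s).of_isClosed_subset (isClosed_iInter fun k => (hFc k s).isClosed) (iInter_subset _ 0)
  have hGn : ∀ s, (⋂ k, F k s).Nonempty := fun s =>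
    IsCompact.nonempty_iInter_of_sequence_nonempty_isCompact_isClosed _ (fun k => hFa k s)
      (fun k => hFn k s) (hFc 0 s) fun k => (hFc k s).isClosed
  have hmem : ∀ s, sInf (⋂ k, F k s) ∈ ⋂ k, F k s := fun s => (hGc s).sInf_mem (hGn s)
  refine ⟨fun s => sInf (⋂ k, F k s), ?_, fun s => (mem_iInter.1 (hmem s) 0).1,
    fun s k => (mem_iInter.1 (hmem s) k).2⟩
  -- The least point that follows a code is lower semicontinuous in the code: if it exceeds `a`,
  -- then by compactness some finite stage already has no point in `(-∞, a]`, and this stage depends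
  -- on finitely many digits only.
  refine measurable_of_Ioi fun a => IsOpen.measurableSet (isOpen_iff_mem_nhds.2 fun s hs => ?_)
  have hempty : ∃ k, Iic a ∩ F k s = ∅ := by
    by_contra hne
    push Not at hne
    obtain ⟨t, ht⟩ := IsCompact.nonempty_iInter_of_sequence_nonempty_isCompact_isClosed
      (fun k => Iic a ∩ F k s) (fun k => inter_subset_inter_right _ (hFa k s)) hne
      ((hFc 0 s).inter_left isClosed_Iic) fun k => isClosed_Iic.inter (hFc k s).isClosed
    have h1 : sInf (⋂ k, F k s) ≤ t :=
      csInf_le (hGc s).bddBelow (mem_iInter.2 fun k => (mem_iInter.1 ht k).2)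
    exact absurd (h1.trans (mem_iInter.1 ht 0).1) (not_le.2 hs)
  obtain ⟨k, hk⟩ := hempty
  have hnhds : {s' : ℕ → Bool | ∀ i < k, s i = s' i} ∈ nhds s := by
    have : {s' : ℕ → Bool | ∀ i < k, s i = s' i} = ⋂ i ∈ Finset.range k, {s' | s i = s' i} := by
      ext; simp
    rw [this, Filter.biInter_finset_mem]
    intro i _
    exact ((isOpen_discrete {b | s i = b}).preimage (continuous_apply i)).mem_nhds rfl
  filter_upwards [hnhds] with s' hs'
  by_contra hle
  have h1 := mem_iInter.1 (hmem s') k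
  have h2 : sInf (⋂ k, F k s') ∈ Iic a ∩ F k s :=
    ⟨not_lt.1 (show ¬ a < sInf (⋂ k, F k s') from hle), h1.1, Follows.congr (fun i hi => (hs' i hi).symm) h1.2⟩
  rw [hk] at h2
  exact h2

lemma expSeparated_of_follows {N : ℕ} (hN : ∀ i, (c i).length = N)
    (hQ : ∀ i, IsClosed (Q i)) (hd : Disjoint (Q true) (Q false)) {f : (ℕ → Bool) → Circle}
    (hf : ∀ s k, Follows α c Q k s (f s)) : ExpSeparated f := by
  obtain ⟨r, hr, h⟩ := Metric.exists_pos_forall_lt_edist (hQ true).isCompact (hQ false) hd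
  refine ⟨r, hr, 1 / 2 ^ N, by positivity, fun s s' k hs hk =>
    le_dist_of_follows hN (fun z hz w hw => ?_) hs hk (hf s _) (hf s' _)⟩
  have := (h z hz w hw).le
  rw [edist_nndist] at this
  exact_mod_cast this

/-! ### Glued Cantor sets near the hull of the class of `α` -/

/-- The set of points with angle in `[a, b]`, seen from `α`. -/
def alphaArc (α : Circle) (a b : ℝ) : Set Circle := (fun t : ℝ => α * Circle.exp t) '' Icc a b

lemma isClosed_alphaArc (a b : ℝ) : IsClosed (alphaArc α a b) :=
  (isCompact_Icc.image (by fun_prop)).isClosed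

lemma mem_alphaArc {a b : ℝ} {z : Circle} (h1 : a ≤ ccwAngle α z) (h2 : ccwAngle α z ≤ b) :
    z ∈ alphaArc α a b := ⟨_, ⟨h1, h2⟩, mul_exp_ccwAngle α z⟩

lemma ccwAngle_of_mem_alphaArc {a b : ℝ} (ha : 0 ≤ a) (hb : b < 2 * Real.pi) {z : Circle}
    (h : z ∈ alphaArc α a b) : a ≤ ccwAngle α z ∧ ccwAngle α z ≤ b := by
  obtain ⟨t, ht, rfl⟩ := h
  change a ≤ ccwAngle α (α * Circle.exp t) ∧ ccwAngle α (α * Circle.exp t) ≤ b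
  rwa [ccwAngle_mul_exp _ (ha.trans ht.1) (ht.2.trans_lt hb)]

lemma disjoint_alphaArc {a b a' b' : ℝ} (ha : 0 ≤ a) (hb : b < a') (hb' : b' < 2 * Real.pi) :
    Disjoint (alphaArc α a b) (alphaArc α a' b') := by
  rw [Set.disjoint_left]
  intro z hz hz'
  rcases le_or_gt a b with hab | hab
  · rcases le_or_gt a' b' with hab' | hab'
    · have h1 := ccwAngle_of_mem_alphaArc ha (by linarith) hz
      have h2 := ccwAngle_of_mem_alphaArc (by linarith) hb' hz'
      linarith
    · simp [alphaArc, Icc_eq_empty (not_le.2 hab')] at hz'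
  · simp [alphaArc, Icc_eq_empty (not_le.2 hab)] at hz

/-- Arbitrarily close to the hull of the class of `α` there are Cantor sets on either side of it
whose corresponding points are equivalent. -/
lemma Tame.exists_glued (hα : Tame α) {ε : ℝ} (hε : 0 < ε) :
    ∃ (p q p' q' : ℝ) (y y' : (ℕ → Bool) → ℝ), ccwEnd α < p ∧ p < q ∧ q < ccwEnd α + ε ∧
      cwEnd α < p' ∧ p' < q' ∧ q' < cwEnd α + ε ∧ Measurable y ∧ Measurable y' ∧
      (∀ s, y s ∈ Icc p q) ∧ (∀ s, y' s ∈ Icc p' q') ∧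
      (∀ s, SameItinerary α (α * Circle.exp (y s)) (α * Circle.exp (-y' s))) ∧
      ExpSeparated (fun s => α * Circle.exp (y s)) ∧
      ExpSeparated (fun s => α * Circle.exp (-y' s)) := by
  obtain ⟨t, ht⟩ := hα.frequently_agree
  obtain ⟨k₀, -, hk₀⟩ := ht 0
  have hin := hα.hull_inside_agree (cut α k₀)
  rw [hk₀] at hin
  -- Beyond `K` the cutting leaves are `ε`-close to the hull and also inside the leaf of level `t`,
  -- so that the bands between them lie in the domains of the branches.
  obtain ⟨K, hK⟩ : ∃ K, ∀ k, K ≤ k →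
      ccwAngle α (ccwLeaf α (cut α k)) < min (ccwEnd α + ε) (ccwAngle α (ccwLeaf α t)) ∧
      max (2 * Real.pi - cwEnd α - ε) (ccwAngle α (cwLeaf α t)) <
        ccwAngle α (cwLeaf α (cut α k)) := by
    have h1 := hα.tendsto_ccwLeaf.eventually (gt_mem_nhds
      (lt_min (by linarith : ccwEnd α < ccwEnd α + ε) hin.1))
    have h2 := hα.tendsto_cwLeaf.eventually (lt_mem_nhds
      (max_lt (by linarith : 2 * Real.pi - cwEnd α - ε < 2 * Real.pi - cwEnd α) hin.2))
    obtain ⟨K, hK⟩ := Filter.eventually_atTop.1 (h1.and h2)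
    exact ⟨K, fun k hk => hK k hk⟩
  obtain ⟨k₁, hk₁, hk₁t⟩ := ht K
  -- The offset `2` separates the two bands strictly; adjacent bands would share an end point.
  obtain ⟨k₂, hk₂, hk₂t⟩ := ht (k₁ + 2)
  let κ : Bool → ℕ := fun i => if i then k₁ else k₂
  have hκK : ∀ i, K ≤ κ i := fun i => by cases i <;> simp [κ] <;> omega
  have hκt : ∀ i, agree α (cut α (κ i)) = t := fun i => by cases i <;> simp [κ, hk₁t, hk₂t]
  let w : Bool → List Letter := fun i => kneadPre α (cut α (κ i) + 1)
  -- Each `w i` exchanges the two sides of `α`, so two of them are needed to return. Pairing `w i`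
  -- with the other word gives both compositions the same length.
  let c : Bool → List Letter := fun i => w i ++ w (!i)
  let A : ℕ → ℝ := fun k => ccwAngle α (ccwLeaf α (cut α k))
  let B : ℕ → ℝ := fun k => ccwAngle α (cwLeaf α (cut α k))
  have hA : StrictAnti A := hα.strictAnti_ccwLeaf
  have hB : StrictMono B := hα.strictMono_cwLeaf
  have hA0 : ∀ k, 0 ≤ A k := fun k => ccwAngle_nonneg _ _
  have hB0 : ∀ k, 0 ≤ B k := fun k => ccwAngle_nonneg _ _
  have hA2 : ∀ k, A k < 2 * Real.pi := fun k => ccwAngle_lt_two_pi _ _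
  have hB2 : ∀ k, B k < 2 * Real.pi := fun k => ccwAngle_lt_two_pi _ _
  let Q : Bool → Set Circle := fun i => alphaArc α (A (κ i + 1)) (A (κ i))
  let Q' : Bool → Set Circle := fun i => alphaArc α (B (κ i)) (B (κ i + 1))
  let Y : Set Circle := {z | ccwAngle α z ≤ ccwAngle α (ccwLeaf α t)}
  let Y' : Set Circle := {z | ccwAngle α (cwLeaf α t) ≤ ccwAngle α z}
  have hm : ∀ i, ∀ z ∈ Y, wordBranch α (w i) z ∈ Y' ∩ Q' i := fun i z hz => by
    have h := hα.wordBranch_of_le (cut α (κ i)) (q := z) (by rw [hκt]; exact hz)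
    exact ⟨((le_max_right _ _).trans_lt (hK _ (hκK i)).2).le.trans h.1, mem_alphaArc h.1 h.2⟩
  have hm' : ∀ i, ∀ z ∈ Y', wordBranch α (w i) z ∈ Y ∩ Q i := fun i z hz => by
    have h := hα.wordBranch_of_ge (cut α (κ i)) (q := z) (by rw [hκt]; exact hz)
    exact ⟨h.2.trans ((hK _ (hκK i)).1.trans_le (min_le_right _ _)).le, mem_alphaArc h.1 h.2⟩
  have hmap : ∀ i, ∀ z ∈ Y, wordBranch α (c i) z ∈ Y ∩ Q i := fun i z hz => by
    rw [wordBranch_append]; exact hm' i _ (hm _ z hz).1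
  have hmap' : ∀ i, ∀ z ∈ Y', wordBranch α (c i) z ∈ Y' ∩ Q' i := fun i z hz => by
    rw [wordBranch_append]; exact hm i _ (hm' _ z hz).1
  have hQc : ∀ i, IsClosed (Q i) := fun i => isClosed_alphaArc _ _
  have hQc' : ∀ i, IsClosed (Q' i) := fun i => isClosed_alphaArc _ _
  have hQs : ∀ i, Q i ⊆ (fun t : ℝ => α * Circle.exp t) '' Icc (A (k₂ + 1)) (A k₁) := fun i =>
    image_mono (Icc_subset_Icc (hA.antitone (by cases i <;> simp [κ]; omega))
      (hA.antitone (by cases i <;> simp [κ]; omega)))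
  have hQs' : ∀ i, Q' i ⊆ (fun t : ℝ => α * Circle.exp t) '' Icc (B k₁) (B (k₂ + 1)) := fun i =>
    image_mono (Icc_subset_Icc (hB.monotone (by cases i <;> simp [κ]; omega))
      (hB.monotone (by cases i <;> simp [κ]; omega)))
  obtain ⟨y, hy, hyI, hyF⟩ := exists_measurable_follows hQc ⟨_, le_refl (ccwAngle α (ccwLeaf α t))⟩
    hmap hQs
  obtain ⟨y', hy', hyI', hyF'⟩ :=
    exists_measurable_follows hQc' ⟨_, le_refl (ccwAngle α (cwLeaf α t))⟩ hmap' hQs'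
  have hlen : ∀ i, (c i).length = cut α k₁ + 1 + (cut α k₂ + 1) := fun i => by
    cases i <;> simp [c, w, κ]; ring
  have e : ∀ s, α * Circle.exp (-(2 * Real.pi - y' s)) = α * Circle.exp (y' s) := fun s => by
    rw [neg_sub, Circle.exp_sub_two_pi]
  refine ⟨A (k₂ + 1), A k₁, 2 * Real.pi - B (k₂ + 1), 2 * Real.pi - B k₁, y,
    fun s => 2 * Real.pi - y' s, (hα.hull_inside_cut _).1, hA (by omega),
    (hK k₁ hk₁).1.trans_le (min_le_left _ _), ?_, ?_, ?_, hy, hy'.const_sub _, hyI,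
    fun s => ⟨by linarith [(hyI' s).2], by linarith [(hyI' s).1]⟩, fun s => ?_, ?_, ?_⟩
  · linarith [(hα.hull_inside_cut (k₂ + 1)).2]
  · linarith [hB (by omega : k₁ < k₂ + 1)]
  · linarith [(le_max_left _ _).trans_lt (hK k₁ hk₁).2]
  · rw [e]
    exact sameItinerary_of_follows (fun i => by
      rw [← List.length_pos_iff, hlen]; omega) (hyF s) (hyF' s)
  · exact expSeparated_of_follows hlen hQc
      ((disjoint_alphaArc (hA0 _) (hA (by simp [κ]; omega)) (hA2 _)).symm) hyF
  · simp only [e]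
    exact expSeparated_of_follows hlen hQc'
      (disjoint_alphaArc (hB0 _) (hB (by simp [κ]; omega)) (hB2 _)) hyF'

/-! ### Pulling back the glued Cantor sets to the leaves -/

/-- The branch jumps only at `α`; along a path that avoids `α` it is rotation by half the angle. -/
lemma branch_mul_exp {l : Letter} {z : Circle} {t : ℝ}
    (h : ∀ s ∈ uIcc 0 t, z * Circle.exp s ≠ α) :
    branch α l (z * Circle.exp t) = branch α l z * Circle.exp (t / 2) := by
  have hz : z = α * Circle.exp (ccwAngle α z) := (mul_exp_ccwAngle α z).symm
  have h0 := ccwAngle_nonneg α z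
  have h1 := ccwAngle_lt_two_pi α z
  have h2 : 0 ≤ ccwAngle α z + t := by
    by_contra hlt
    push Not at hlt
    refine h (-ccwAngle α z) (mem_uIcc.2 (Or.inr ⟨by linarith, by linarith⟩)) ?_
    conv_lhs => rw [hz]
    rw [mul_assoc, ← Circle.exp_add, mul_exp_ccwAngle]
    simp
  have h3 : ccwAngle α z + t < 2 * Real.pi := by
    by_contra hlt
    push Not at hlt
    refine h (2 * Real.pi - ccwAngle α z) (mem_uIcc.2 (Or.inl ⟨by linarith, by linarith⟩)) ?_
    conv_lhs => rw [hz]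
    rw [mul_assoc, ← Circle.exp_add, mul_exp_ccwAngle]
    simp
  have e : ccwAngle α (z * Circle.exp t) = ccwAngle α z + t := by
    conv_lhs => rw [hz, mul_assoc, ← Circle.exp_add]
    exact ccwAngle_mul_exp _ h2 h3
  rw [branch, branch, e, mul_assoc, ← Circle.exp_add, add_div]

/-- Composing branches stays affine as long as no intermediate path meets `α`, that is, as long as
the original arc misses the first `u.length` points of the orbit of `α`. -/
lemma wordBranch_mul_exp {a b : ℝ} (h0 : (0 : ℝ) ∈ Ioo a b) {p : Circle} (u : List Letter)
    (h : ∀ t ∈ Ioo a b, ∀ j < u.length, p * Circle.exp t ≠ dbl^[j] α) {t : ℝ}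
    (ht : t ∈ Ioo a b) :
    wordBranch α u (p * Circle.exp t) = wordBranch α u p * Circle.exp (t / 2 ^ u.length) := by
  induction u generalizing t with
  | nil => simp [wordBranch]
  | cons l u ih =>
    have ih' := fun {t} => @ih (fun t ht j hj => h t ht j (by simp; omega)) t
    rw [wordBranch, ih' ht, branch_mul_exp, wordBranch, List.length_cons, pow_succ, div_div]
    intro s hs hsα
    have hpow : (0 : ℝ) < 2 ^ u.length := by positivity
    have hs' : s * 2 ^ u.length ∈ Ioo a b := by
      rcases mem_uIcc.1 hs with ⟨h1, h2⟩ | ⟨h1, h2⟩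
      · rw [le_div_iff₀ hpow] at h2
        exact ⟨h0.1.trans_le (by positivity), h2.trans_lt ht.2⟩
      · rw [div_le_iff₀ hpow] at h1
        exact ⟨ht.1.trans_le h1, (mul_nonpos_of_nonpos_of_nonneg h2 hpow.le).trans_lt h0.2⟩
    refine h _ hs' u.length (by simp) ?_
    rw [← hsα, show s = s * 2 ^ u.length / 2 ^ u.length by field_simp, ← ih' hs',
      iterate_dbl_wordBranch, div_mul_cancel₀ _ hpow.ne']

/-- Near the components of `C_⋆`, the inverse branches along words of length `n` are affine. -/
lemma Tame.exists_wordBranch_starPt (hα : Tame α) (n : ℕ) : ∃ ε > 0, ∀ (u : List Letter) l,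
    u.length = n → ∀ t, -(cwEnd α / 2) - ε < t → t < ccwEnd α / 2 + ε →
      wordBranch α u (starPt α l * Circle.exp t) = leafEnd α u l * Circle.exp (t / 2 ^ n) := by
  -- Finitely many forward images of `α` have to be avoided, and each is off the hull. The room is
  -- `2 * ε` because doubling maps the lifts near `⋆` to a neighbourhood of the hull.
  have hε : ∃ ε > 0, ∀ j < n, ccwEnd α + 2 * ε < ccwAngle α (dbl^[j + 1] α) ∧
      ccwAngle α (dbl^[j + 1] α) < 2 * Real.pi - cwEnd α - 2 * ε := by
    induction n with
    | zero => exact ⟨1, one_pos, by simp⟩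
    | succ n ih =>
      obtain ⟨ε, hε, h⟩ := ih
      have hn := hα.iterate_notMem_hull hα.self_mem_alphaClass n
      rw [hα.mem_hull_iff] at hn
      push Not at hn
      refine ⟨min ε (min ((ccwAngle α (dbl^[n + 1] α) - ccwEnd α) / 3)
        ((2 * Real.pi - cwEnd α - ccwAngle α (dbl^[n + 1] α)) / 3)), ?_, fun j hj => ?_⟩
      · exact lt_min hε (lt_min (by linarith) (by linarith))
      · have h1 := min_le_left ε (min ((ccwAngle α (dbl^[n + 1] α) - ccwEnd α) / 3)
          ((2 * Real.pi - cwEnd α - ccwAngle α (dbl^[n + 1] α)) / 3))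
        have h2 := min_le_right ε (min ((ccwAngle α (dbl^[n + 1] α) - ccwEnd α) / 3)
          ((2 * Real.pi - cwEnd α - ccwAngle α (dbl^[n + 1] α)) / 3))
        rw [le_min_iff] at h2
        rcases (Nat.lt_succ_iff.1 hj).eq_or_lt with rfl | hj
        · constructor <;> linarith
        · have := h j hj
          constructor <;> linarith
  obtain ⟨ε, hε, h⟩ := hε
  refine ⟨ε, hε, fun u l hu t ht1 ht2 => ?_⟩
  subst hu
  have hx := hα.ccwEnd_mem.1
  have hy := hα.cwEnd_mem.1
  refine wordBranch_mul_exp (a := -(cwEnd α / 2) - ε) (b := ccwEnd α / 2 + ε)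
    ⟨by linarith, by linarith⟩ u (fun t ht j hj heq => ?_) ⟨ht1, ht2⟩
  have h1 := h j hj
  have h2 := h1.1.trans (ccwAngle_lt_two_pi _ _)
  have h3 := (ccwAngle_nonneg _ _).trans_lt h1.2
  rw [Function.iterate_succ_apply', ← heq, dbl_mul_exp, dbl_starPt] at h1
  rcases le_or_gt 0 t with h0 | h0
  · rw [ccwAngle_mul_exp _ (by linarith) (by linarith [ht.2])] at h1
    linarith [ht.2]
  · rw [← Circle.exp_add_two_pi, ccwAngle_mul_exp _ (by linarith [ht.1]) (by linarith)] at h1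
    linarith [ht.1]

lemma ExpSeparated.of_iterate_dbl {f g : (ℕ → Bool) → Circle} (n : ℕ)
    (hf : ExpSeparated f) (h : ∀ s, dbl^[n] (g s) = f s) : ExpSeparated g := by
  obtain ⟨η, hη, ρ, hρ, H⟩ := hf
  refine ⟨η / 2 ^ n, by positivity, ρ, hρ, fun s s' k hs hk => ?_⟩
  have h1 := H s s' k hs hk
  rw [← h, ← h] at h1
  rw [div_mul_eq_mul_div, div_le_iff₀ (by positivity)]
  linarith [dist_iterate_dbl_le n (g s) (g s')]

/-- Arbitrarily close to the components of the preimages of `C_⋆` there are Cantor sets on either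
side of the leaves whose corresponding points are equivalent. -/
lemma Tame.exists_glued_leaf (hα : Tame α) (n : ℕ) {ε : ℝ} (hε : 0 < ε) :
    ∃ (p q p' q' : ℝ) (y y' : (ℕ → Bool) → ℝ), ccwEnd α / 2 ^ (n + 1) < p ∧ p < q ∧
      q < ccwEnd α / 2 ^ (n + 1) + ε ∧ cwEnd α / 2 ^ (n + 1) < p' ∧ p' < q' ∧
      q' < cwEnd α / 2 ^ (n + 1) + ε ∧ Measurable y ∧ Measurable y' ∧
      (∀ s, y s ∈ Icc p q) ∧ (∀ s, y' s ∈ Icc p' q') ∧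
      ∀ (u : List Letter) l, u.length = n →
        (∀ s, SameItinerary α (leafEnd α u l * Circle.exp (y s))
          (leafEnd α u l.other * Circle.exp (-y' s))) ∧
        ExpSeparated (fun s => leafEnd α u l * Circle.exp (y s)) ∧
        ExpSeparated (fun s => leafEnd α u l.other * Circle.exp (-y' s)) := by
  obtain ⟨ε₁, hε₁, hloc⟩ := hα.exists_wordBranch_starPt n
  have hx0 := hα.ccwEnd_mem.1
  have hy0 := hα.cwEnd_mem.1
  have hx1 := hα.ccwEnd_mem.2.1
  have hy1 := hα.cwEnd_mem.2.1
  have hpi := Real.pi_pos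
  obtain ⟨p, q, p', q', y, y', hp, hpq, hq, hp', hpq', hq', hy, hy', hyI, hyI', hS, hE, hE'⟩ :=
    hα.exists_glued (ε := min ε (min ε₁ Real.pi)) (lt_min hε (lt_min hε₁ hpi))
  have m1 : min ε (min ε₁ Real.pi) ≤ ε := min_le_left _ _
  have m2 : min ε (min ε₁ Real.pi) ≤ ε₁ := (min_le_right _ _).trans (min_le_left _ _)
  have m3 : min ε (min ε₁ Real.pi) ≤ Real.pi := (min_le_right _ _).trans (min_le_right _ _)
  have hpow : (0 : ℝ) < 2 ^ (n + 1) := by positivity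
  have hone : (1 : ℝ) ≤ 2 ^ (n + 1) := one_le_pow₀ one_le_two
  have hεle : ε / 2 ^ (n + 1) ≤ ε := div_le_self hε.le hone
  have e : ∀ (u : List Letter) l, u.length = n → ∀ s, leafEnd α u l *
      Circle.exp (y s / 2 ^ (n + 1)) =
        wordBranch α (u ++ [l]) (α * Circle.exp (y s)) := fun u l hu s => by
    have := hyI s
    rw [wordBranch_append, pow_succ', ← div_div, ← hloc u l hu _ (by linarith [this.1])
      (by linarith [this.2]), wordBranch, wordBranch, branch,
      ccwAngle_mul_exp _ (by linarith [this.1]) (by linarith [this.2])]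
  -- The angle `2π - y' s` from `α` is halved to `π - y' s / 2`. Thus the clockwise side of `α`
  -- lifts to the clockwise side of the opposite `⋆`, and the two glued sets lie at opposite ends of
  -- the leaf but on the same side of it.
  have e' : ∀ (u : List Letter) l, u.length = n → ∀ s, leafEnd α u l.other *
      Circle.exp (-(y' s / 2 ^ (n + 1))) =
        wordBranch α (u ++ [l]) (α * Circle.exp (-y' s)) := fun u l hu s => by
    have := hyI' s
    rw [wordBranch_append, pow_succ', ← div_div, ← neg_div, ← hloc u l.other hu _
      (by linarith [this.2]) (by linarith [this.1]), wordBranch, wordBranch, branch,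
      ← Circle.exp_add_two_pi (-y' s),
      ccwAngle_mul_exp _ (by linarith [this.2]) (by linarith [this.1]), starPt_other, mul_assoc,
      ← Circle.exp_add]
    rw [show (-y' s + 2 * Real.pi) / 2 = Real.pi + -(y' s / 2) by ring]
  refine ⟨p / 2 ^ (n + 1), q / 2 ^ (n + 1), p' / 2 ^ (n + 1), q' / 2 ^ (n + 1),
    fun s => y s / 2 ^ (n + 1), fun s => y' s / 2 ^ (n + 1), ?_, ?_, ?_, ?_, ?_, ?_,
    hy.div_const _, hy'.div_const _, fun s => ⟨?_, ?_⟩, fun s => ⟨?_, ?_⟩, fun u l hu =>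
    ⟨fun s => ?_, ?_, ?_⟩⟩
  · gcongr
  · gcongr
  · refine lt_of_lt_of_le (b := (ccwEnd α + ε) / 2 ^ (n + 1)) (by gcongr; linarith) ?_
    rw [add_div]; linarith
  · gcongr
  · gcongr
  · refine lt_of_lt_of_le (b := (cwEnd α + ε) / 2 ^ (n + 1)) (by gcongr; linarith) ?_
    rw [add_div]; linarith
  · exact div_le_div_of_nonneg_right (hyI s).1 hpow.le
  · exact div_le_div_of_nonneg_right (hyI s).2 hpow.le
  · exact div_le_div_of_nonneg_right (hyI' s).1 hpow.le
  · exact div_le_div_of_nonneg_right (hyI' s).2 hpow.le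
  · change SameItinerary α (leafEnd α u l * Circle.exp (y s / 2 ^ (n + 1)))
      (leafEnd α u l.other * Circle.exp (-(y' s / 2 ^ (n + 1))))
    rw [e u l hu, e' u l hu]
    exact (hS s).wordBranch _
  · refine hE.of_iterate_dbl (u ++ [l]).length fun s => ?_
    rw [e u l hu, iterate_dbl_wordBranch]
  · refine hE'.of_iterate_dbl (u ++ [l]).length fun s => ?_
    rw [e' u l hu, iterate_dbl_wordBranch]

/-! ### Energy of exponentially separated families -/

/-- The law of a sequence of independent fair coin flips. -/
noncomputable def coinMeasure : Measure (ℕ → Bool) :=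
  Measure.infinitePi fun _ => (PMF.uniformOfFintype Bool).toMeasure

instance : IsProbabilityMeasure coinMeasure := by unfold coinMeasure; infer_instance

lemma coinMeasure_prefix (s : ℕ → Bool) (k : ℕ) :
    coinMeasure {s' | ∀ i < k, s i = s' i} = (1 / 2) ^ k := by
  have h : {s' : ℕ → Bool | ∀ i < k, s i = s' i} =
      Set.pi (Finset.range k : Set ℕ) fun i => {s i} := by
    ext s'; simp [Set.mem_pi, eq_comm]
  rw [h, coinMeasure, Measure.infinitePi_pi _ fun _ _ => measurableSet_singleton _]
  simp

lemma measurableSet_prefix (s : ℕ → Bool) (k : ℕ) :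
    MeasurableSet {s' : ℕ → Bool | ∀ i < k, s i = s' i} := by
  have h : {s' : ℕ → Bool | ∀ i < k, s i = s' i} =
      Set.pi (Finset.range k : Set ℕ) fun i => {s i} := by
    ext s'; simp [Set.mem_pi, eq_comm]
  rw [h]
  exact MeasurableSet.pi (Finset.countable_toSet _) fun _ _ => measurableSet_singleton _

/-- By exponential separation, `-log` of the distance grows at most linearly in the length of the
common prefix. Writing that length as a sum of indicators allows integration term by term. -/
lemma neg_log_edist_le {f : (ℕ → Bool) → ℂ} (hf : ExpSeparated f) : ∃ C : NNReal, ∀ s s',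
    (-ENNReal.log (edist (f s) (f s'))).toENNReal ≤
      ∑' k, {s' : ℕ → Bool | ∀ i < k, s i = s' i}.indicator (fun _ => (C : ℝ≥0∞)) s' := by
  obtain ⟨η, hη, ρ, hρ, H⟩ := hf
  refine ⟨⟨max 1 (max (-Real.log η) (-Real.log ρ)), le_max_of_le_left zero_le_one⟩,
    fun s s' => ?_⟩
  set C : NNReal := ⟨max 1 (max (-Real.log η) (-Real.log ρ)), le_max_of_le_left zero_le_one⟩
    with hC
  have hC1 : -Real.log η ≤ C := (le_max_left _ _).trans (le_max_right _ _)
  have hC2 : -Real.log ρ ≤ C := (le_max_right _ _).trans (le_max_right _ _)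
  by_cases hs : s = s'
  · have h1 : ∀ k, {s' : ℕ → Bool | ∀ i < k, s i = s' i}.indicator
        (fun _ => (C : ℝ≥0∞)) s' = C := fun k => indicator_of_mem (by simp [hs]) _
    simp only [h1]
    -- On the diagonal both sides may be infinite; the lower bound `1` for `C` makes the right side
    -- infinite.
    rw [ENNReal.tsum_const_eq_top_of_ne_zero]
    · exact le_top
    · have : (1 : ℝ) ≤ C := le_max_left _ _
      intro h0
      rw [ENNReal.coe_eq_zero] at h0
      rw [h0] at this
      norm_num at this
  · classical
    have hex : ∃ k, s k ≠ s' k := Function.ne_iff.1 hs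
    set k := Nat.find hex
    have hk : s k ≠ s' k := Nat.find_spec hex
    have hlt : ∀ i < k, s i = s' i := fun i hi => not_not.1 (Nat.find_min hex hi)
    have h1 := H s s' k hlt hk
    have h2 : ∑ j ∈ Finset.range (k + 1), {s' : ℕ → Bool | ∀ i < j, s i = s' i}.indicator
        (fun _ => (C : ℝ≥0∞)) s' = (k + 1 : ℕ) * C := by
      rw [Finset.sum_congr rfl fun j hj => indicator_of_mem (f := fun _ => (C : ℝ≥0∞))
        (show s' ∈ {s' : ℕ → Bool | ∀ i < j, s i = s' i} from fun i hi =>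
          hlt i (by have := Finset.mem_range.1 hj; omega))]
      simp
    refine le_trans ?_ (h2 ▸ ENNReal.sum_le_tsum (Finset.range (k + 1)))
    have h3 : ENNReal.ofReal (η * ρ ^ k) ≤ edist (f s) (f s') := by
      rw [edist_dist]; exact ENNReal.ofReal_le_ofReal h1
    have h4 : (((k + 1 : ℕ) * C : NNReal) : ℝ≥0∞) = (k + 1 : ℕ) * (C : ℝ≥0∞) := by push_cast; rfl
    rw [← h4]
    have hpos : 0 < η * ρ ^ k := by positivity
    have h5 : -ENNReal.log (edist (f s) (f s')) ≤ ((-Real.log (η * ρ ^ k) : ℝ) : EReal) := by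
      rw [EReal.coe_neg, EReal.neg_le_neg_iff, ← ENNReal.log_ofReal_of_pos hpos]
      exact ENNReal.log_monotone h3
    refine (EReal.toENNReal_le_toENNReal h5).trans ?_
    rw [EReal.toENNReal_of_ne_top (EReal.coe_ne_top _), EReal.toReal_coe, ENNReal.ofReal_le_iff_le_toReal ENNReal.coe_ne_top]
    rw [Real.log_mul hη.ne' (by positivity), Real.log_pow]
    rw [ENNReal.coe_toReal]
    push_cast
    have : (k : ℝ) * -Real.log ρ ≤ k * C := by gcongr
    linarith

/-- A common prefix of length `k` has probability `2⁻ᵏ`, so the bound integrates to a geometric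
series with sum `2 * C`. The negative part can be discarded. -/
lemma logEnergy_map_lt_top {f : (ℕ → Bool) → ℂ} (hf : ExpSeparated f) :
    logEnergy (coinMeasure.map f) < ⊤ := by
  obtain ⟨C, hC⟩ := neg_log_edist_le hf
  have key : ∀ s, ∫⁻ s', (-ENNReal.log (edist (f s) (f s'))).toENNReal ∂coinMeasure ≤ C * 2 := by
    intro s
    refine (lintegral_mono (hC s)).trans ?_
    rw [lintegral_tsum fun k => (measurable_const.indicator (measurableSet_prefix s k)).aemeasurable]
    simp only [lintegral_indicator_const (measurableSet_prefix s _), coinMeasure_prefix]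
    rw [ENNReal.tsum_mul_left]
    gcongr
    rw [ENNReal.tsum_geometric]
    simp
  have h1 : ∫⁻ x, ∫⁻ y, (-ENNReal.log (edist x y)).toENNReal ∂(coinMeasure.map f)
      ∂(coinMeasure.map f) ≤ C * 2 := by
    refine (lintegral_map_le _ _).trans ((lintegral_mono fun s => (lintegral_map_le
      (fun y => (-ENNReal.log (edist (f s) y)).toENNReal) f).trans (key s)).trans ?_)
    simp
  unfold logEnergy
  refine lt_of_le_of_lt (EReal.sub_le_sub (EReal.coe_ennreal_le_coe_ennreal_iff.2 h1)
    (EReal.coe_ennreal_nonneg _)) ?_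
  rw [sub_zero]
  exact lt_top_iff_ne_top.2 ((EReal.coe_ennreal_eq_top_iff.not.2 (ENNReal.mul_ne_top (by simp) (by simp))))

lemma rescaledEnergy_map_lt_top {f : (ℕ → Bool) → Circle} (hfm : Measurable f)
    (hf : ExpSeparated f) {A : Set Circle} (hA : 0 < Metric.diam A) :
    rescaledEnergy (coinMeasure.map f) A < ⊤ := by
  unfold rescaledEnergy
  rw [Measure.map_map (by fun_prop) hfm]
  apply logEnergy_map_lt_top
  obtain ⟨η, hη, ρ, hρ, H⟩ := hf
  refine ⟨η / Metric.diam A, by positivity, ρ, hρ, fun s s' k hs hk => ?_⟩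
  simp only [Function.comp_apply]
  rw [dist_eq_norm, ← sub_div, norm_div, Complex.norm_real, Real.norm_of_nonneg hA.le,
    div_mul_eq_mul_div]
  gcongr
  rw [← dist_eq_norm]
  exact H s s' k hs hk

lemma ExpSeparated.injective {X : Type*} [MetricSpace X] {f : (ℕ → Bool) → X}
    (hf : ExpSeparated f) : Function.Injective f := by
  obtain ⟨η, hη, ρ, hρ, H⟩ := hf
  intro s s' h
  by_contra hs
  classical
  have hex : ∃ k, s k ≠ s' k := Function.ne_iff.1 hs
  have := H s s' _ (fun i hi => not_not.1 (Nat.find_min hex hi)) (Nat.find_spec hex)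
  rw [h, dist_self] at this
  exact absurd this (not_le.2 (by positivity))

/-- Two families of points with pairwise equivalent members have glued laws. -/
lemma isGlued_map {rel : Circle → Circle → Prop} {A A' : Set Circle} {f f' : (ℕ → Bool) → Circle}
    (hf : Measurable f) (hf' : Measurable f') (hi : Function.Injective f)
    (hi' : Function.Injective f') (hA : ∀ s, f s ∈ A) (hA' : ∀ s, f' s ∈ A')
    (hrel : ∀ s, rel (f s) (f' s)) :
    IsGlued rel A A' (coinMeasure.map f) (coinMeasure.map f') := by
  have he := hf.measurableEmbedding hi
  have he' := hf'.measurableEmbedding hi'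
  -- The map `φ` is `f' ∘ f⁻¹` on the range of `f`, extended measurably to the circle.
  obtain ⟨φ, hφ, hφf⟩ := he.exists_measurable_extend hf' fun _ => ⟨1⟩
  have hφ' : ∀ s, φ (f s) = f' s := congrFun hφf
  have h0 : (coinMeasure.map f) (range f)ᶜ = 0 := by
    rw [he.map_apply]; simp
  have h0' : (coinMeasure.map f') (range f')ᶜ = 0 := by
    rw [he'.map_apply]; simp
  refine ⟨range f, range f', φ, range_subset_iff.2 hA, range_subset_iff.2 hA',
    he.measurableSet_range, he'.measurableSet_range, h0, h0', ⟨?_, ?_, ?_⟩, ⟨hφ, ?_⟩, ?_⟩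
  · rintro _ ⟨s, rfl⟩
    exact ⟨s, (hφ' s).symm⟩
  · rintro _ ⟨s, rfl⟩ _ ⟨s', rfl⟩ h
    rw [hφ', hφ'] at h
    rw [hi' h]
  · rintro _ ⟨s, rfl⟩
    exact ⟨f s, mem_range_self s, hφ' s⟩
  · have h1 : ∀ᵐ x ∂(coinMeasure.map f), x ∈ range f := h0
    have h1' : ∀ᵐ x ∂(coinMeasure.map f'), x ∈ range f' := h0'
    rw [Measure.restrict_eq_self_of_ae_mem h1, Measure.restrict_eq_self_of_ae_mem h1', Measure.map_map hφ hf, hφf]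
  · rintro _ ⟨s, rfl⟩
    rw [hφ']
    exact hrel s

/-! ### Leaves and generalized cylinder sets -/

@[simp] lemma iterate_dbl_leafEnd (u : List Letter) (l : Letter) :
    dbl^[u.length] (leafEnd α u l) = starPt α l := iterate_dbl_wordBranch u _

lemma iterate_succ_dbl_leafEnd (u : List Letter) (l : Letter) :
    dbl^[u.length + 1] (leafEnd α u l) = α := by
  rw [Function.iterate_succ_apply', iterate_dbl_leafEnd, dbl_starPt]

/-- An end of a leaf of level `n` reaches `α` at time `n + 1`. A point on leaves of two levels would
reach it twice and make `α` periodic. -/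
lemma Tame.length_eq_of_leafEnd_eq (hα : Tame α) {u v : List Letter} {l l' : Letter}
    (h : leafEnd α u l = leafEnd α v l') : u.length = v.length := by
  wlog hlt : u.length < v.length generalizing u v l l'
  · rcases (not_lt.1 hlt).eq_or_lt with h' | h'
    · exact h'.symm
    · exact (this h.symm h').symm
  obtain ⟨m, hm⟩ := Nat.exists_eq_add_of_lt hlt
  have h1 := iterate_succ_dbl_leafEnd (α := α) v l'
  rw [← h, hm, show u.length + m + 1 + 1 = m + 1 + (u.length + 1) by ring,
    Function.iterate_add_apply, iterate_succ_dbl_leafEnd] at h1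
  exact absurd h1 (hα.iterate_ne m)

lemma Tame.leafEnd_ne (hα : Tame α) (u : List Letter) (l : Letter) : leafEnd α u l ≠ α := by
  intro h
  have := iterate_succ_dbl_leafEnd (α := α) u l
  rw [h] at this
  exact hα.iterate_ne _ this

lemma Tame.leafEnd_inj (hα : Tame α) {u v : List Letter} {l l' : Letter}
    (h : leafEnd α u l = leafEnd α v l') : u = v ∧ l = l' := by
  have hlen := hα.length_eq_of_leafEnd_eq h
  have hl : l = l' := by
    by_contra hne
    have h1 := iterate_dbl_leafEnd (α := α) u l
    rw [h, hlen, iterate_dbl_leafEnd, Letter.eq_other_of_ne hne] at h1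
    exact starPt_other_ne _ h1.symm
  refine ⟨?_, hl⟩
  subst hl
  induction u generalizing v with
  | nil => exact (List.length_eq_zero_iff.1 hlen.symm).symm
  | cons a u ih =>
    cases v with
    | nil => simp at hlen
    | cons b v =>
      have hab : b = a := by
        have h1 : leafEnd α (a :: u) l ∈ semicircle α a :=
          branch_mem_semicircle (hα.leafEnd_ne u l)
        have h2 : leafEnd α (b :: v) l ∈ semicircle α b :=
          branch_mem_semicircle (hα.leafEnd_ne v l)
        rw [h] at h1
        exact notMem_semicircle_of_mem_closedSemi (semicircle_subset_closedSemi _ h1) h2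
      subst hab
      rw [ih (by simpa using hlen) (branch_injective b h)]

lemma Tame.leafEnd_other_ne (hα : Tame α) (u : List Letter) (l : Letter) :
    leafEnd α u l.other ≠ leafEnd α u l := fun h => l.other_ne (hα.leafEnd_inj h).2

/-- Distinct leaves of the same level do not cross. -/
lemma Tame.leaf_noncrossing (hα : Tame α) {u v : List Letter} (hlen : u.length = v.length)
    (hne : u ≠ v) : ∃ a, ∀ l, leafEnd α v l ∈ ccwArc (leafEnd α u a) (leafEnd α u a.other) := by
  induction u generalizing v with
  | nil => exact absurd (List.length_eq_zero_iff.1 hlen.symm).symm hne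
  | cons b u ih =>
    cases v with
    | nil => simp at hlen
    | cons c v =>
      by_cases hbc : b = c
      · subst hbc
        obtain ⟨a, ha⟩ := ih (v := v) (by simpa using hlen) (fun h => hne (h ▸ rfl))
        exact ⟨a, fun l => branch_mem_ccwArc b (ha l)⟩
      -- Different first letters put the two leaves into opposite open semicircles, where they
      -- cannot cross.
      · have hu : ∀ l, leafEnd α (b :: u) l ∈ semicircle α b := fun l =>
          branch_mem_semicircle (hα.leafEnd_ne u l)
        have hv : ∀ l, leafEnd α (c :: v) l ∈ semicircle α b.other := fun l => by
          rw [← Letter.eq_other_of_ne (Ne.symm hbc)]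
          exact branch_mem_semicircle (hα.leafEnd_ne v l)
        obtain ⟨a, ha⟩ : ∃ a : Letter,
            ccwAngle (starPt α b) (leafEnd α (b :: u) a.other) ≤
              ccwAngle (starPt α b) (leafEnd α (b :: u) a) := by
          rcases le_total (ccwAngle (starPt α b) (leafEnd α (b :: u) .L))
            (ccwAngle (starPt α b) (leafEnd α (b :: u) .R)) with h | h
          exacts [⟨.R, h⟩, ⟨.L, h⟩]
        have ha' := ha.lt_of_ne fun h => hα.leafEnd_other_ne _ _ (ccwAngle_inj.1 h)
        refine ⟨a, fun l => (mem_ccwArc_iff (starPt α b)).2 (Or.inr (Or.inr ⟨ha', ?_⟩))⟩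
        exact (mem_semicircle_iff.1 (hu a)).2.trans (mem_semicircle_other_iff.1 (hv l))

lemma mem_ccwClosedArc_iff {a b z : Circle} :
    z ∈ ccwClosedArc a b ↔ z = a ∨ z = b ∨ z ∈ ccwArc a b := by
  have h : z ∈ ccwClosedArc a b ↔ ccwAngle a z ≤ ccwAngle a b := Iff.rfl
  rw [h, le_iff_eq_or_lt, ccwAngle_inj]
  constructor
  · rintro (h | h)
    · exact Or.inr (Or.inl h)
    · by_cases hz : z = a
      · exact Or.inl hz
      · exact Or.inr (Or.inr ⟨ccwAngle_pos hz, h⟩)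
  · rintro (h | h | h)
    · rw [h, ccwAngle_self, eq_comm (a := a)]
      rcases (ccwAngle_nonneg a b).eq_or_lt with h' | h'
      · rw [← ccwAngle_self a, ccwAngle_inj] at h'
        exact Or.inl h'.symm
      · exact Or.inr h'
    · exact Or.inl h
    · exact Or.inr h.2

lemma mem_ccwArc_iff_notMem_ccwClosedArc {a b z : Circle} (hab : a ≠ b) :
    z ∈ ccwArc a b ↔ z ∉ ccwClosedArc b a := by
  have h : z ∈ ccwClosedArc b a ↔ ccwAngle b z ≤ ccwAngle b a := Iff.rfl
  have h1 := ccwAngle_pos hab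
  have h2 := ccwAngle_nonneg b z
  rw [h, mem_ccwArc_iff b, ccwAngle_self, not_le]
  constructor
  · rintro (h | h | h) <;> linarith
  · exact fun h => Or.inr (Or.inr ⟨h1, h⟩)

lemma isClosed_ccwClosedArc (a b : Circle) : IsClosed (ccwClosedArc a b) := by
  have : ccwClosedArc a b = alphaArc a 0 (ccwAngle a b) := by
    ext z
    exact ⟨fun h => mem_alphaArc (ccwAngle_nonneg _ _) h,
      fun h => (ccwAngle_of_mem_alphaArc le_rfl (ccwAngle_lt_two_pi _ _) h).2⟩
  rw [this]
  exact isClosed_alphaArc _ _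

lemma isOpen_ccwArc {a b : Circle} (hab : a ≠ b) : IsOpen (ccwArc a b) := by
  have : ccwArc a b = (ccwClosedArc b a)ᶜ := by
    ext z
    exact mem_ccwArc_iff_notMem_ccwClosedArc hab
  rw [this]
  exact (isClosed_ccwClosedArc _ _).isOpen_compl

/-- The points on the same closed sides of all leaves of level `n` as `x`. -/
def cylinder (α : Circle) (n : ℕ) (x : Circle) : Set Circle :=
  {y | ∀ u : List Letter, u.length = n → SameSide α u x y}

/-- `x` is not an end point of a leaf of level `n`. -/
def IsGeneric (α : Circle) (n : ℕ) (x : Circle) : Prop :=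
  ∀ u : List Letter, u.length = n → ∀ l, x ≠ leafEnd α u l

/-- The smaller angle, seen from `x`, of an end point of a leaf. -/
noncomputable def leafLo (α x : Circle) (u : List Letter) : ℝ :=
  min (ccwAngle x (leafEnd α u .L)) (ccwAngle x (leafEnd α u .R))

/-- The larger angle, seen from `x`, of an end point of a leaf. -/
noncomputable def leafHi (α x : Circle) (u : List Letter) : ℝ :=
  max (ccwAngle x (leafEnd α u .L)) (ccwAngle x (leafEnd α u .R))

lemma exists_leafLo_leafHi (α x : Circle) (u : List Letter) : ∃ a : Letter,
    leafHi α x u = ccwAngle x (leafEnd α u a) ∧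
      leafLo α x u = ccwAngle x (leafEnd α u a.other) := by
  unfold leafHi leafLo
  rcases le_total (ccwAngle x (leafEnd α u .L)) (ccwAngle x (leafEnd α u .R)) with h | h
  · exact ⟨.R, max_eq_right h, min_eq_left h⟩
  · exact ⟨.L, max_eq_left h, min_eq_right h⟩

lemma leafLo_le_leafHi (x : Circle) (u : List Letter) : leafLo α x u ≤ leafHi α x u :=
  min_le_max

lemma Tame.leafLo_lt_leafHi (hα : Tame α) (x : Circle) (u : List Letter) :
    leafLo α x u < leafHi α x u := by
  obtain ⟨a, h1, h2⟩ := exists_leafLo_leafHi α x u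
  refine lt_of_le_of_ne (leafLo_le_leafHi _ _) ?_
  rw [h1, h2, Ne, ccwAngle_inj]
  exact hα.leafEnd_other_ne u a

lemma sameSide_iff (u : List Letter) (a : Letter) (x y : Circle) : SameSide α u x y ↔
    (x ∈ ccwClosedArc (leafEnd α u a) (leafEnd α u a.other) ∧
      y ∈ ccwClosedArc (leafEnd α u a) (leafEnd α u a.other)) ∨
    (x ∈ ccwClosedArc (leafEnd α u a.other) (leafEnd α u a) ∧
      y ∈ ccwClosedArc (leafEnd α u a.other) (leafEnd α u a)) := by
  cases a
  · rfl
  · exact or_comm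

/-- In the coordinate based at `x`, the far side of a leaf is the open interval between its two end
points. Nesting of leaves thereby becomes nesting of intervals. -/
lemma Tame.sameSide_iff_of_ne (hα : Tame α) {u : List Letter} {x : Circle}
    (hx : ∀ l, x ≠ leafEnd α u l) {y : Circle} : SameSide α u x y ↔
      ¬ (leafLo α x u < ccwAngle x y ∧ ccwAngle x y < leafHi α x u) := by
  have hlt := hα.leafLo_lt_leafHi x u
  obtain ⟨a, h1, h2⟩ := exists_leafLo_leafHi α x u
  have hne := hα.leafEnd_other_ne u a
  have h0 : 0 < ccwAngle x (leafEnd α u a.other) := ccwAngle_pos (hx _).symm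
  rw [h1, h2] at hlt ⊢
  have hx1 : x ∈ ccwArc (leafEnd α u a) (leafEnd α u a.other) := by
    rw [mem_ccwArc_iff x, ccwAngle_self]
    exact Or.inr (Or.inl ⟨h0, hlt⟩)
  have hx2 : x ∉ ccwClosedArc (leafEnd α u a.other) (leafEnd α u a) :=
    (mem_ccwArc_iff_notMem_ccwClosedArc hne.symm).1 hx1
  have hx3 : x ∈ ccwClosedArc (leafEnd α u a) (leafEnd α u a.other) :=
    mem_ccwClosedArc_iff.2 (Or.inr (Or.inr hx1))
  have key : y ∈ ccwArc (leafEnd α u a.other) (leafEnd α u a) ↔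
      (ccwAngle x (leafEnd α u a.other) < ccwAngle x y ∧
        ccwAngle x y < ccwAngle x (leafEnd α u a)) := by
    rw [mem_ccwArc_iff x]
    constructor
    · rintro (h | h | h)
      · exact h
      · linarith
      · linarith
    · exact Or.inl
  rw [← key, mem_ccwArc_iff_notMem_ccwClosedArc hne, not_not, sameSide_iff u a]
  tauto

lemma SameSide.symm {u : List Letter} {x y : Circle} (h : SameSide α u x y) :
    SameSide α u y x := by
  rcases h with h | h
  exacts [Or.inl h.symm, Or.inr h.symm]

lemma Tame.notMem_both (hα : Tame α) {u : List Letter} {x : Circle}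
    (hx : ∀ l, x ≠ leafEnd α u l) (h : x ∈ ccwClosedArc (leafEnd α u .L) (leafEnd α u .R)) :
    x ∉ ccwClosedArc (leafEnd α u .R) (leafEnd α u .L) := by
  rw [← mem_ccwArc_iff_notMem_ccwClosedArc (show leafEnd α u .L ≠ leafEnd α u .R from
      hα.leafEnd_other_ne u .R)]
  exact ((mem_ccwClosedArc_iff.1 h).resolve_left (hx _)).resolve_left (hx _)

lemma Tame.sameSide_trans (hα : Tame α) {u : List Letter} {x y z : Circle}
    (hy : ∀ l, y ≠ leafEnd α u l) (h : SameSide α u x y) (h' : SameSide α u y z) :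
    SameSide α u x z := by
  have := hα.notMem_both hy
  unfold SameSide at *
  tauto

lemma Tame.sameSide_refl (hα : Tame α) {u : List Letter} (x : Circle) : SameSide α u x x := by
  unfold SameSide
  by_cases h : x ∈ ccwClosedArc (leafEnd α u .R) (leafEnd α u .L)
  · exact Or.inr ⟨h, h⟩
  · rw [← mem_ccwArc_iff_notMem_ccwClosedArc (show leafEnd α u .L ≠ leafEnd α u .R from
      hα.leafEnd_other_ne u .R)] at h
    have := mem_ccwClosedArc_iff.2 (Or.inr (Or.inr h))
    exact Or.inl ⟨this, this⟩

lemma Tame.cylinder_eq (hα : Tame α) {n : ℕ} {x y : Circle} (hx : IsGeneric α n x)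
    (hy : IsGeneric α n y) (h : y ∈ cylinder α n x) : cylinder α n x = cylinder α n y := by
  ext z
  exact forall₂_congr fun u hu =>
    ⟨fun h' => hα.sameSide_trans (hx u hu) (h u hu).symm h',
      fun h' => hα.sameSide_trans (hy u hu) (h u hu) h'⟩

lemma Tame.mem_cylinder_iff (hα : Tame α) {n : ℕ} {x y : Circle} (hx : IsGeneric α n x) :
    y ∈ cylinder α n x ↔ ∀ u : List Letter, u.length = n →
      ¬ (leafLo α x u < ccwAngle x y ∧ ccwAngle x y < leafHi α x u) :=
  forall₂_congr fun u hu => hα.sameSide_iff_of_ne (hx u hu)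

lemma finite_words (n : ℕ) : {u : List Letter | u.length = n}.Finite := by
  have : Finite Letter := Finite.of_injective (fun l : Letter => match l with
    | .L => true
    | .R => false) (by rintro (_ | _) (_ | _) <;> simp)
  exact List.finite_length_eq Letter n

lemma isClosed_sameSide (u : List Letter) (x : Circle) : IsClosed {y | SameSide α u x y} := by
  have c1 := isClosed_ccwClosedArc (leafEnd α u .L) (leafEnd α u .R)
  have c2 := isClosed_ccwClosedArc (leafEnd α u .R) (leafEnd α u .L)
  unfold SameSide
  by_cases h1 : x ∈ ccwClosedArc (leafEnd α u .L) (leafEnd α u .R) <;>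
  by_cases h2 : x ∈ ccwClosedArc (leafEnd α u .R) (leafEnd α u .L) <;>
  simp only [h1, h2, true_and, false_and, or_false, false_or]
  · exact c1.union c2
  · exact c1
  · exact c2
  · simp

lemma isClosed_cylinder (n : ℕ) (x : Circle) : IsClosed (cylinder α n x) := by
  have : cylinder α n x = ⋂ u ∈ {u : List Letter | u.length = n}, {y | SameSide α u x y} := by
    ext y; simp [cylinder]
  rw [this]
  exact isClosed_biInter fun u _ => isClosed_sameSide u x

lemma Tame.sameSide_mem_nhds (hα : Tame α) {u : List Letter} {x y : Circle}
    (hy : ∀ l, y ≠ leafEnd α u l) (h : SameSide α u x y) : {z | SameSide α u x z} ∈ nhds y := by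
  have hne : leafEnd α u .L ≠ leafEnd α u .R := hα.leafEnd_other_ne u .R
  rcases h with ⟨h1, h2⟩ | ⟨h1, h2⟩
  · filter_upwards [(isOpen_ccwArc hne).mem_nhds
      (((mem_ccwClosedArc_iff.1 h2).resolve_left (hy _)).resolve_left (hy _))] with z hz
    exact Or.inl ⟨h1, mem_ccwClosedArc_iff.2 (Or.inr (Or.inr hz))⟩
  · filter_upwards [(isOpen_ccwArc hne.symm).mem_nhds
      (((mem_ccwClosedArc_iff.1 h2).resolve_left (hy _)).resolve_left (hy _))] with z hz
    exact Or.inr ⟨h1, mem_ccwClosedArc_iff.2 (Or.inr (Or.inr hz))⟩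

/-- Away from the end points each side condition is open, and there are only finitely many leaves of
one level. -/
lemma Tame.not_isGeneric_of_mem_frontier (hα : Tame α) {n : ℕ} {x y : Circle}
    (hy : y ∈ frontier (cylinder α n x)) : ¬ IsGeneric α n y := by
  intro hgen
  rw [(isClosed_cylinder n x).frontier_eq] at hy
  refine hy.2 (mem_interior_iff_mem_nhds.2 ?_)
  have : cylinder α n x = ⋂ u ∈ {u : List Letter | u.length = n}, {y | SameSide α u x y} := by
    ext y; simp [cylinder]
  rw [this, Filter.biInter_mem (finite_words n)]
  exact fun u hu => hα.sameSide_mem_nhds (hgen u hu) (hy.1 u hu)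

lemma Tame.sameSide_leafEnd (hα : Tame α) {u v : List Letter} (hlen : u.length = v.length)
    (hne : u ≠ v) (l l' : Letter) : SameSide α u (leafEnd α v l) (leafEnd α v l') := by
  obtain ⟨a, ha⟩ := hα.leaf_noncrossing hlen hne
  rw [sameSide_iff u a]
  exact Or.inl ⟨mem_ccwClosedArc_iff.2 (Or.inr (Or.inr (ha l))),
    mem_ccwClosedArc_iff.2 (Or.inr (Or.inr (ha l')))⟩

lemma Tame.sameSide_self_leafEnd (hα : Tame α) {u : List Letter} (x : Circle) (l : Letter) :
    SameSide α u x (leafEnd α u l) := by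
  have h := hα.sameSide_refl (u := u) x
  have h1 : ∀ l a, leafEnd α u l ∈ ccwClosedArc (leafEnd α u a) (leafEnd α u (Letter.other a)) := by
    intro l a
    rw [mem_ccwClosedArc_iff]
    by_cases hla : l = a
    · exact Or.inl (by rw [hla])
    · exact Or.inr (Or.inl (by rw [Letter.eq_other_of_ne hla]))
  rcases h with h | h
  · exact Or.inl ⟨h.1, h1 l .L⟩
  · exact Or.inr ⟨h.1, h1 l .R⟩

/-- If an end point of a leaf belongs to a generalized cylinder set, then the whole leaf is
part of its boundary. -/
lemma Tame.leafEnd_mem_frontier (hα : Tame α) {n : ℕ} {x : Circle} (hx : IsGeneric α n x)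
    {u : List Letter} (hu : u.length = n) {l : Letter} (h : leafEnd α u l ∈ cylinder α n x)
    (l' : Letter) : leafEnd α u l' ∈ frontier (cylinder α n x) := by
  have h1 : leafEnd α u l' ∈ cylinder α n x := by
    intro v hv
    by_cases huv : v = u
    · rw [huv]
      exact hα.sameSide_self_leafEnd x l'
    · exact hα.sameSide_trans (fun l'' h2 => huv (hα.leafEnd_inj h2).1.symm) (h v hv)
        (hα.sameSide_leafEnd (hv.trans hu.symm) huv l l')
  rw [frontier_eq_closure_inter_closure]
  refine ⟨subset_closure h1, ?_⟩
  have hlt := hα.leafLo_lt_leafHi x u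
  have hsub : (fun t : ℝ => x * Circle.exp t) '' Ioo (leafLo α x u) (leafHi α x u) ⊆
      (cylinder α n x)ᶜ := by
    rintro _ ⟨t, ht, rfl⟩ hmem
    refine (hα.mem_cylinder_iff hx).1 hmem u hu ?_
    change _ < ccwAngle x (x * Circle.exp t) ∧ ccwAngle x (x * Circle.exp t) < _
    rw [ccwAngle_mul_exp]
    · exact ht
    · exact (le_min (ccwAngle_nonneg _ _) (ccwAngle_nonneg _ _)).trans ht.1.le
    · exact ht.2.trans (max_lt (ccwAngle_lt_two_pi _ _) (ccwAngle_lt_two_pi _ _))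
  refine closure_mono hsub (image_closure_subset_closure_image (by fun_prop)
    ⟨ccwAngle x (leafEnd α u l'), ?_, mul_exp_ccwAngle _ _⟩)
  rw [closure_Ioo hlt.ne]
  cases l'
  · exact ⟨min_le_left _ _, le_max_left _ _⟩
  · exact ⟨min_le_right _ _, le_max_right _ _⟩

lemma mem_gcs_iff {n : ℕ} {C : Set Circle} :
    C ∈ gcs α n ↔ ∃ x, IsGeneric α n x ∧ C = cylinder α n x := Iff.rfl

/-! ### Existence of inside coverings -/

lemma Tame.starPt_mem_cStar (l : Letter) : starPt α l ∈ cStar α :=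
  Or.inl (mem_range_self l)

lemma Tame.isClosed_cStar (hα : Tame α) : IsClosed (cStar α) := by
  rw [hα.cStar_eq]
  exact isClosed_hull.preimage continuous_dbl

lemma image_wordBranch_subset {n : ℕ} {g : List Letter} (hg : g.length = n) (S : Set Circle) :
    wordBranch α g '' S ⊆ dbl^[n] ⁻¹' S := by
  rintro _ ⟨z, hz, rfl⟩
  rwa [mem_preimage, ← hg, iterate_dbl_wordBranch]

lemma Tame.leafEnd_mem_preimage {u : List Letter} {n : ℕ} (hu : u.length = n)
    (l : Letter) : leafEnd α u l ∈ dbl^[n] ⁻¹' cStar α := by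
  rw [mem_preimage, ← hu, iterate_dbl_leafEnd]
  exact Tame.starPt_mem_cStar l

/-- Inside coverings exist. -/
lemma Tame.exists_isCK (hα : Tame α) (K : ℕ) :
    ∃ δ : ℝ, 0 < δ ∧ ∃ D : Circle → Set Circle, IsCK α K δ D := by
  let S : ℕ → Set Circle := fun n => dbl^[n] ⁻¹' cStar α
  have hSc : ∀ n, IsClosed (S n) := fun n => hα.isClosed_cStar.preimage (continuous_dbl.iterate n)
  have hSn : ∀ n, (S n).Nonempty := fun n =>
    ⟨leafEnd α (List.replicate n .L) .L, Tame.leafEnd_mem_preimage (by simp) _⟩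
  -- Otherwise a point of the hull would have its image in the hull.
  have hdisj : ∀ x, x ∉ S K ∨ x ∉ S (K + 1) := by
    intro x
    by_contra h
    push Not at h
    obtain ⟨h1, h2⟩ := h
    simp only [S, hα.cStar_eq, mem_preimage, Function.iterate_succ_apply'] at h1 h2
    exact hα.dbl_notMem_hull h1 h2
  let φ : Circle → ℝ := fun x => max (Metric.infDist x (S K)) (Metric.infDist x (S (K + 1)))
  have hφ : Continuous φ := (Metric.continuous_infDist_pt _).max (Metric.continuous_infDist_pt _)
  obtain ⟨x₀, -, hx₀⟩ := isCompact_univ.exists_isMinOn univ_nonempty hφ.continuousOn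
  replace hx₀ : ∀ x, φ x₀ ≤ φ x := fun x => hx₀ (mem_univ x)
  have hpos : 0 < φ x₀ := by
    rcases hdisj x₀ with h | h
    · exact lt_max_of_lt_left (((hSc K).notMem_iff_infDist_pos (hSn K)).1 h)
    · exact lt_max_of_lt_right (((hSc (K + 1)).notMem_iff_infDist_pos (hSn (K + 1))).1 h)
  have hex : ∀ x, ∃ n, (n = K ∨ n = K + 1) ∧ φ x₀ / 2 < Metric.infDist x (S n) := by
    intro x
    rcases lt_max_iff.1 ((half_lt_self hpos).trans_le (hx₀ x)) with h | h
    exacts [⟨K, Or.inl rfl, h⟩, ⟨K + 1, Or.inr rfl, h⟩]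
  choose n hn hnx using hex
  have hgen : ∀ x, IsGeneric α (n x) x := by
    rintro x u hu l rfl
    have := hnx (leafEnd α u l)
    rw [Metric.infDist_zero_of_mem (Tame.leafEnd_mem_preimage hu l)] at this
    linarith
  refine ⟨φ x₀ / 2, half_pos hpos, fun x => cylinder α (n x) x, fun x => ⟨?_, ?_, ?_⟩⟩
  · rcases hn x with h | h
    · exact Or.inl (h ▸ ⟨x, hgen x, rfl⟩)
    · exact Or.inr (h ▸ ⟨x, hgen x, rfl⟩)
  · exact fun u _ => hα.sameSide_refl x
  · intro g hg
    -- A frontier point is an end of a leaf of level `n x`, so `g` has this length and the image of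
    -- `C_⋆` along `g` is contained in `S (n x)`.
    have h1 := hα.not_isGeneric_of_mem_frontier (hg .L)
    unfold IsGeneric at h1
    push Not at h1
    obtain ⟨u, hu, l, hul⟩ := h1
    have hlen := (hα.length_eq_of_leafEnd_eq hul).trans hu
    exact (hnx x).trans_le (Metric.infDist_le_infDist_of_subset (image_wordBranch_subset hlen _)
      (Set.Nonempty.image _ ⟨_, Tame.starPt_mem_cStar .L⟩))

/-! ### The leaves on the boundary of a generalized cylinder set -/

lemma iterate_dbl_mul_exp (n : ℕ) (z : Circle) (t : ℝ) :
    dbl^[n] (z * Circle.exp t) = dbl^[n] z * Circle.exp (2 ^ n * t) := by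
  induction n with
  | zero => simp
  | succ n ih =>
    rw [Function.iterate_succ_apply', Function.iterate_succ_apply', ih, dbl_mul_exp, pow_succ']
    congr 2; ring

lemma Tame.starPt_mul_exp_mem_cStar (hα : Tame α) (l : Letter) {t : ℝ}
    (h1 : -(cwEnd α / 2) ≤ t) (h2 : t ≤ ccwEnd α / 2) : starPt α l * Circle.exp t ∈ cStar α := by
  rw [hα.cStar_eq, mem_preimage, dbl_mul_exp, dbl_starPt]
  exact ⟨2 * t, ⟨by linarith, by linarith⟩, rfl⟩

lemma Tame.leafEnd_mul_exp_mem (hα : Tame α) (u : List Letter) (l : Letter) {t : ℝ}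
    (h1 : -(cwEnd α / 2 ^ (u.length + 1)) ≤ t) (h2 : t ≤ ccwEnd α / 2 ^ (u.length + 1)) :
    leafEnd α u l * Circle.exp t ∈ wordBranch α u '' cStar α := by
  obtain ⟨ε, hε, h⟩ := hα.exists_wordBranch_starPt u.length
  have hpow : (0 : ℝ) < 2 ^ u.length := by positivity
  have h1' : -(cwEnd α / 2) ≤ t * 2 ^ u.length := by
    rw [pow_succ', ← div_div, ← neg_div, div_le_iff₀ hpow] at h1
    exact h1
  have h2' : t * 2 ^ u.length ≤ ccwEnd α / 2 := by
    rw [pow_succ', ← div_div, le_div_iff₀ hpow] at h2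
    exact h2
  refine ⟨_, hα.starPt_mul_exp_mem_cStar l h1' h2', ?_⟩
  rw [h u l rfl _ (by linarith) (by linarith), mul_div_cancel_right₀ _ hpow.ne']

lemma leafHi_lt (x : Circle) (u : List Letter) : leafHi α x u < 2 * Real.pi :=
  max_lt (ccwAngle_lt_two_pi _ _) (ccwAngle_lt_two_pi _ _)

lemma Tame.ccwAngle_leafEnd_ne (hα : Tame α) {u v : List Letter} (huv : u ≠ v) (x : Circle)
    (l l' : Letter) : ccwAngle x (leafEnd α u l) ≠ ccwAngle x (leafEnd α v l') :=
  fun h => huv (hα.leafEnd_inj (ccwAngle_inj.1 h)).1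

/-- A leaf of the same level has no end point in the interval of another leaf, or it has both. -/
lemma Tame.leaf_nested_or (hα : Tame α) {x : Circle} {u v : List Letter}
    (hlen : u.length = v.length) (huv : u ≠ v) :
    (leafLo α x u < leafLo α x v ∧ leafHi α x v < leafHi α x u) ∨
    ((leafLo α x v < leafLo α x u ∨ leafHi α x u < leafLo α x v) ∧
      (leafHi α x v < leafLo α x u ∨ leafHi α x u < leafHi α x v)) := by
  obtain ⟨a, ha⟩ := hα.leaf_noncrossing hlen huv
  obtain ⟨b, hb1, hb2⟩ := exists_leafLo_leafHi α x u
  obtain ⟨c, hc1, hc2⟩ := exists_leafLo_leafHi α x v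
  have hlt := hα.leafLo_lt_leafHi x u
  have h1 := ha c
  have h2 := ha c.other
  rw [mem_ccwArc_iff x, ← hc1] at h1
  rw [mem_ccwArc_iff x, ← hc2] at h2
  by_cases hab : a = b
  · subst hab
    rw [← hb1, ← hb2] at h1 h2
    right
    constructor
    · rcases h2 with h | h | h
      · linarith
      · exact Or.inl h.1
      · exact Or.inr h.2
    · rcases h1 with h | h | h
      · linarith
      · exact Or.inl h.1
      · exact Or.inr h.2
  · obtain rfl := Letter.eq_other_of_ne hab
    rw [Letter.other_other, ← hb1, ← hb2] at h1 h2
    left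
    constructor
    · rcases h2 with h | h | h <;> linarith
    · rcases h1 with h | h | h <;> linarith

/-- The words of length `n` whose leaves are not separated from `x` by other such leaves. -/
def outerWords (α : Circle) (n : ℕ) (x : Circle) : Set (List Letter) :=
  {u | u.length = n ∧ ∀ v : List Letter, v.length = n →
    ¬ (leafLo α x v < leafLo α x u ∧ leafHi α x u < leafHi α x v)}

lemma Tame.leafLo_injOn (hα : Tame α) {x : Circle} {u v : List Letter}
    (h : leafLo α x u = leafLo α x v) : u = v := by
  by_contra huv
  obtain ⟨b, hb1, hb2⟩ := exists_leafLo_leafHi α x u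
  obtain ⟨c, hc1, hc2⟩ := exists_leafLo_leafHi α x v
  exact hα.ccwAngle_leafEnd_ne huv x b.other c.other (hb2.symm.trans (h.trans hc2))

lemma Tame.outerWords_disjoint (hα : Tame α) {n : ℕ} {x : Circle} {u v : List Letter}
    (hu : u ∈ outerWords α n x) (hv : v ∈ outerWords α n x)
    (h : leafLo α x u < leafLo α x v) : leafHi α x u < leafLo α x v := by
  have huv : u ≠ v := by rintro rfl; exact lt_irrefl _ h
  rcases hα.leaf_nested_or (x := x) (hu.1.trans hv.1.symm) huv with h1 | h1
  · exact absurd h1 (hv.2 u hu.1)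
  · rcases h1.1 with h2 | h2
    · linarith
    · exact h2

lemma exists_outerWord {n : ℕ} (x : Circle) {u : List Letter}
    (hu : u.length = n) : ∃ v ∈ outerWords α n x,
      leafLo α x v ≤ leafLo α x u ∧ leafHi α x u ≤ leafHi α x v := by
  obtain ⟨v, ⟨hv, hv1, hv2⟩, hmin⟩ := Set.exists_min_image
    {v : List Letter | v.length = n ∧ leafLo α x v ≤ leafLo α x u ∧ leafHi α x u ≤ leafHi α x v}
    (leafLo α x) ((finite_words n).subset fun v hv => hv.1) ⟨u, hu, le_rfl, le_rfl⟩
  refine ⟨v, ⟨hv, fun w hw hwv => ?_⟩, hv1, hv2⟩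
  exact absurd (hmin w ⟨hw, hwv.1.le.trans hv1, hv2.trans hwv.2.le⟩) (not_le.2 hwv.1)

lemma Tame.mem_cylinder_iff_outer (hα : Tame α) {n : ℕ} {x y : Circle} (hx : IsGeneric α n x) :
    y ∈ cylinder α n x ↔ ∀ u ∈ outerWords α n x,
      ¬ (leafLo α x u < ccwAngle x y ∧ ccwAngle x y < leafHi α x u) := by
  rw [hα.mem_cylinder_iff hx]
  refine ⟨fun h u hu => h u hu.1, fun h u hu hy => ?_⟩
  obtain ⟨v, hv, h1, h2⟩ := exists_outerWord x hu
  exact h v hv ⟨h1.trans_lt hy.1, hy.2.trans_le h2⟩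

lemma Tame.leafEnd_mem_cylinder (hα : Tame α) {n : ℕ} {x : Circle} (hx : IsGeneric α n x)
    {u : List Letter} (hu : u ∈ outerWords α n x) :
    ∃ l, leafEnd α u l ∈ cylinder α n x := by
  obtain ⟨a, h1, h2⟩ := exists_leafLo_leafHi α x u
  refine ⟨a.other, (hα.mem_cylinder_iff_outer hx).2 fun v hv h => ?_⟩
  rw [← h2] at h
  linarith [hα.outerWords_disjoint hv hu h.1]

/-- The lifts of the hull of the class of `α` at consecutive boundary leaves are disjoint. -/
lemma Tame.gap (hα : Tame α) {n : ℕ} {x : Circle} {u v : List Letter}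
    (hu : u.length = n) (hv : v.length = n) (h : leafHi α x u < leafLo α x v) :
    leafHi α x u + ccwEnd α / 2 ^ (n + 1) < leafLo α x v - cwEnd α / 2 ^ (n + 1) := by
  by_contra hle
  push Not at hle
  obtain ⟨a, ha, -⟩ := exists_leafLo_leafHi α x u
  obtain ⟨b, -, hb⟩ := exists_leafLo_leafHi α x v
  set d := leafLo α x v - leafHi α x u with hd
  have h1 : leafEnd α v b.other = leafEnd α u a * Circle.exp d := by
    rw [← mul_exp_ccwAngle x (leafEnd α v b.other), ← mul_exp_ccwAngle x (leafEnd α u a), ← ha,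
      ← hb, mul_assoc, ← Circle.exp_add]
    congr 2; ring
  have h2 := congrArg (dbl^[n]) h1
  have hu' := iterate_dbl_leafEnd (α := α) u a
  have hv' := iterate_dbl_leafEnd (α := α) v b.other
  rw [hu] at hu'
  rw [hv] at hv'
  rw [iterate_dbl_mul_exp, hu', hv'] at h2
  have hpow : (0 : ℝ) < 2 ^ n := by positivity
  have h3 : 0 < 2 ^ n * d := mul_pos hpow (by linarith)
  -- Both leaf ends are mapped to `⋆` points by `dbl^[n]`, so `2 ^ n * d` would be a multiple of
  -- `π`; overlapping lifts would place it strictly between `0` and `π`.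
  have h4 : 2 ^ n * d < Real.pi := by
    have : d ≤ (ccwEnd α + cwEnd α) / 2 / 2 ^ n := by
      rw [div_div, ← pow_succ', add_div]
      linarith
    rw [le_div_iff₀ hpow] at this
    linarith [hα.ccwEnd_mem.2.1, hα.cwEnd_mem.2.1]
  have h5 := ccwAngle_mul_exp (starPt α a) h3.le (by linarith [Real.pi_pos])
  rw [← h2] at h5
  by_cases hab : b.other = a
  · rw [hab, ccwAngle_self] at h5
    linarith
  · rw [Letter.eq_other_of_ne hab, ccwAngle_starPt_other] at h5
    linarith

/-- If `x` were closer to the leaf, it would lie in the clockwise part of the lift of `C_⋆` at that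
leaf end. -/
lemma Tame.lt_leafLo (hα : Tame α) {x : Circle} {u : List Letter}
    (h : x ∉ wordBranch α u '' cStar α) : cwEnd α / 2 ^ (u.length + 1) < leafLo α x u := by
  by_contra hle
  push Not at hle
  obtain ⟨a, -, ha⟩ := exists_leafLo_leafHi α x u
  refine h ?_
  have h0 : 0 ≤ leafLo α x u := le_min (ccwAngle_nonneg _ _) (ccwAngle_nonneg _ _)
  have h1 := hα.leafEnd_mul_exp_mem u a.other (t := -leafLo α x u) (by linarith)
    ((neg_nonpos.2 h0).trans (div_nonneg hα.ccwEnd_mem.1 (by positivity)))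
  rw [← mul_exp_ccwAngle x (leafEnd α u a.other), ← ha, mul_assoc, ← Circle.exp_add,
    add_neg_cancel, Circle.exp_zero, mul_one] at h1
  exact h1

lemma Tame.leafHi_add_lt (hα : Tame α) {x : Circle} {u : List Letter}
    (h : x ∉ wordBranch α u '' cStar α) :
    leafHi α x u + ccwEnd α / 2 ^ (u.length + 1) < 2 * Real.pi := by
  by_contra hle
  push Not at hle
  obtain ⟨a, ha, -⟩ := exists_leafLo_leafHi α x u
  refine h ?_
  have h0 : 0 ≤ 2 * Real.pi - leafHi α x u := by linarith [leafHi_lt (α := α) x u]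
  have h1 := hα.leafEnd_mul_exp_mem u a (t := 2 * Real.pi - leafHi α x u)
    ((neg_nonpos.2 (div_nonneg hα.cwEnd_mem.1 (by positivity))).trans h0) (by linarith)
  rw [← mul_exp_ccwAngle x (leafEnd α u a), ← ha, mul_assoc, ← Circle.exp_add,
    add_sub_cancel, Circle.exp_two_pi, mul_one] at h1
  exact h1

lemma exists_pos_forall_lt {ι : Type*} {s : Set ι} (hs : s.Finite) {f : ι → ℝ}
    (hf : ∀ i ∈ s, 0 < f i) : ∃ ε > 0, ∀ i ∈ s, ε < f i := by
  have h : ∀ᶠ ε in nhdsWithin (0 : ℝ) (Ioi 0), ∀ i ∈ s, ε < f i :=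
    (Filter.eventually_all_finite hs).2 fun i hi =>
      nhdsWithin_le_nhds (gt_mem_nhds (hf i hi))
  obtain ⟨ε, h1, h2⟩ := (h.and self_mem_nhdsWithin).exists
  exact ⟨ε, h2, h1⟩

lemma exists_enumeration {ι : Type*} {s : Set ι} (hs : s.Finite) (hne : s.Nonempty) (f : ι → ℝ)
    (hf : InjOn f s) : ∃ (m : ℕ) (w : Fin (m + 1) → ι), (∀ j, w j ∈ s) ∧
      StrictMono (f ∘ w) ∧ ∀ i ∈ s, ∃ j, w j = i := by
  classical
  let T : Finset ℝ := hs.toFinset.image f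
  have hT : T.Nonempty := by
    obtain ⟨i, hi⟩ := hne
    exact ⟨f i, Finset.mem_image_of_mem _ (hs.mem_toFinset.2 hi)⟩
  obtain ⟨m, hm⟩ : ∃ m, T.card = m + 1 := ⟨T.card - 1, by have := hT.card_pos; omega⟩
  have hmem : ∀ j, ∃ i ∈ s, f i = T.orderEmbOfFin hm j := fun j => by
    obtain ⟨i, hi, h⟩ := Finset.mem_image.1 (T.orderEmbOfFin_mem hm j)
    exact ⟨i, hs.mem_toFinset.1 hi, h⟩
  choose w hw hfw using hmem
  refine ⟨m, w, hw, fun i j hij => ?_, fun i hi => ?_⟩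
  · simp only [Function.comp_apply, hfw]
    exact (T.orderEmbOfFin hm).strictMono hij
  · have h1 : f i ∈ Set.range (T.orderEmbOfFin hm) := by
      rw [Finset.range_orderEmbOfFin]
      exact Finset.mem_coe.2 (Finset.mem_image_of_mem _ (hs.mem_toFinset.2 hi))
    obtain ⟨j, hj⟩ := h1
    exact ⟨j, hf (hw j) hi ((hfw j).trans hj)⟩

/-! ### Nice gluing circuits -/

lemma diam_pos_of_angleArc_subset {s t : ℝ} (h : s < t) {A : Set Circle} (hA : angleArc s t ⊆ A) :
    0 < Metric.diam A := by
  have hc : ∃ r ∈ Icc s t, Circle.exp s ≠ Circle.exp r := by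
    refine ⟨min t (s + Real.pi), ⟨le_min h.le (by linarith [Real.pi_pos]), min_le_left _ _⟩, ?_⟩
    intro heq
    have h1 : s < min t (s + Real.pi) := lt_min h (by linarith [Real.pi_pos])
    have h2 := Circle.exp_injOn_Ico (a := s) (b := s + 2 * Real.pi) (by linarith)
      ⟨le_rfl, by linarith [Real.pi_pos]⟩
      ⟨h1.le, (min_le_right _ _).trans_lt (by linarith [Real.pi_pos])⟩ heq
    exact h1.ne h2
  obtain ⟨r, hr, hne⟩ := hc
  refine Metric.diam_pos ⟨_, hA ⟨s, ⟨le_rfl, h.le⟩, rfl⟩, _, hA ⟨r, hr, rfl⟩, hne⟩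
    (isCompact_univ.isBounded.subset (subset_univ _))

lemma eventually_comparable {a b : ℝ} (ha : 0 < a) (hb : 0 < b) :
    ∀ᶠ C in Filter.atTop, Comparable C a b := by
  filter_upwards [Filter.eventually_ge_atTop (a / b), Filter.eventually_ge_atTop (b / a)]
    with C h1 h2
  exact ⟨(div_le_iff₀ hb).1 h1, (div_le_iff₀ ha).1 h2⟩

lemma eventually_le_coe {e : EReal} (he : e < ⊤) : ∀ᶠ C : ℝ in Filter.atTop, e ≤ (C : EReal) := by
  obtain ⟨r, hr, -⟩ := EReal.lt_iff_exists_real_btwn.1 he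
  filter_upwards [Filter.eventually_ge_atTop r] with C hC
  exact hr.le.trans (EReal.coe_le_coe_iff.2 hC)

lemma angleArc_sub_two_pi (s t : ℝ) :
    angleArc (s - 2 * Real.pi) (t - 2 * Real.pi) = angleArc s t := by
  ext z
  constructor
  · rintro ⟨r, hr, rfl⟩
    exact ⟨r + 2 * Real.pi, ⟨by linarith [hr.1], by linarith [hr.2]⟩, Circle.exp_add_two_pi r⟩
  · rintro ⟨r, hr, rfl⟩
    exact ⟨r - 2 * Real.pi, ⟨by linarith [hr.1], by linarith [hr.2]⟩, Circle.exp_sub_two_pi r⟩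

lemma measurableSet_angleArc (s t : ℝ) : MeasurableSet (angleArc s t) :=
  (isCompact_Icc.image Circle.exp.continuous).measurableSet

/-- Around every point that is outside of the lifts of `C_⋆` at the boundary leaves of its
generalized cylinder set there is a nice gluing circuit in this set. -/
lemma Tame.exists_circuit (hα : Tame α) {n : ℕ} {x : Circle} (hx : IsGeneric α n x)
    (hout : ∀ u ∈ outerWords α n x, x ∉ wordBranch α u '' cStar α) :
    ∃ N : ℕ, ∀ᶠ C : ℝ in Filter.atTop,
      HasNiceCircuit (LamEquiv α) N C 1 x (cylinder α n x) := by
  set X := ccwEnd α / 2 ^ (n + 1) with hX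
  set Y := cwEnd α / 2 ^ (n + 1) with hY
  have hX0 : 0 ≤ X := div_nonneg hα.ccwEnd_mem.1 (by positivity)
  have hY0 : 0 ≤ Y := div_nonneg hα.cwEnd_mem.1 (by positivity)
  set M := outerWords α n x with hM
  have hMfin : M.Finite := (finite_words n).subset fun u hu => hu.1
  have hMne : M.Nonempty := by
    obtain ⟨v, hv, -⟩ := exists_outerWord (α := α) (n := n) x (u := List.replicate n .L) (by simp)
    exact ⟨v, hv⟩
  -- room around the lifts of the hull
  obtain ⟨ε₁, hε₁, h1⟩ := exists_pos_forall_lt hMfin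
    (f := fun u => min (leafLo α x u - Y) (2 * Real.pi - (leafHi α x u + X))) fun u hu => by
      have h1 := hα.lt_leafLo (hout u hu)
      have h2 := hα.leafHi_add_lt (hout u hu)
      rw [hu.1] at h1 h2
      exact lt_min (by linarith) (by linarith)
  obtain ⟨ε₂, hε₂, h2⟩ := exists_pos_forall_lt
    ((hMfin.prod hMfin).subset (sep_subset (M ×ˢ M) fun p => leafLo α x p.1 < leafLo α x p.2))
    (f := fun p => (leafLo α x p.2 - Y - (leafHi α x p.1 + X)) / 2) fun p hp => by
      have := hα.gap hp.1.1.1 hp.1.2.1 (hα.outerWords_disjoint hp.1.1 hp.1.2 hp.2)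
      linarith
  set ε := min ε₁ ε₂ with hε
  have hεε₁ : ε ≤ ε₁ := min_le_left _ _
  have hεε₂ : ε ≤ ε₂ := min_le_right _ _
  have hε0 : 0 < ε := lt_min hε₁ hε₂
  have hlo : ∀ u ∈ M, ε < leafLo α x u - Y := fun u hu =>
    hεε₁.trans_lt ((h1 u hu).trans_le (min_le_left _ _))
  have hhi : ∀ u ∈ M, leafHi α x u + X + ε < 2 * Real.pi := fun u hu => by
    linarith [(h1 u hu).trans_le (min_le_right _ _)]
  have hgap : ∀ u ∈ M, ∀ v ∈ M, leafLo α x u < leafLo α x v →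
      leafHi α x u + X + ε < leafLo α x v - Y - ε := fun u hu v hv huv => by
    linarith [h2 (u, v) ⟨⟨hu, hv⟩, huv⟩]
  have hlohi : ∀ u, leafLo α x u < leafHi α x u := hα.leafLo_lt_leafHi x
  obtain ⟨p, q, p', q', y, y', hp, hpq, hq, hp', hpq', hq', hy, hy', hyI, hyI', hglue⟩ :=
    hα.exists_glued_leaf n hε0
  obtain ⟨m, w, hwM, hwmono, -⟩ := exists_enumeration hMfin hMne (leafLo α x)
    fun u _ v _ h => hα.leafLo_injOn h
  -- The arcs lie just outside the lifts of the hull, on the side of each leaf that faces `x`. The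
  -- margin `ε` keeps them from reaching any other boundary leaf.
  have hmem : ∀ u ∈ M, ∀ θ, (leafLo α x u - q' ≤ θ ∧ θ ≤ leafLo α x u - p') ∨
      (leafHi α x u + p ≤ θ ∧ θ ≤ leafHi α x u + q) →
      x * Circle.exp θ ∈ cylinder α n x := by
    intro u hu θ hθ
    have a1 := hlo u hu
    have a2 := hhi u hu
    have a3 := hlohi u
    rw [hα.mem_cylinder_iff_outer hx]
    intro v hv hvθ
    have b1 := hlohi v
    rw [ccwAngle_mul_exp x (by rcases hθ with h | h <;> linarith [h.1])
      (by rcases hθ with h | h <;> linarith [h.2])] at hvθ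
    rcases lt_trichotomy (leafLo α x u) (leafLo α x v) with h | h | h
    · have := hgap u hu v hv h
      rcases hθ with h' | h' <;> linarith [h'.2, hvθ.1]
    · rw [← hα.leafLo_injOn h] at hvθ
      rcases hθ with h' | h' <;> linarith [h'.1, h'.2, hvθ.1, hvθ.2]
    · have := hgap v hv u hu h
      rcases hθ with h' | h' <;> linarith [h'.1, hvθ.2]
  choose a ha ha' using exists_leafLo_leafHi α x
  have hHi : ∀ u, leafEnd α u (a u) = x * Circle.exp (leafHi α x u) := fun u => by
    rw [ha, mul_exp_ccwAngle]
  have hLo : ∀ u, leafEnd α u (a u).other = x * Circle.exp (leafLo α x u) := fun u => by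
    rw [ha', mul_exp_ccwAngle]
  obtain ⟨ξ, rfl⟩ : ∃ ξ, x = Circle.exp ξ := ⟨_, (Circle.exp_arg x).symm⟩
  set x := Circle.exp ξ with hxξ
  set lo : Fin (m + 1) → ℝ := fun j => leafLo α x (w j) with hlodef
  set hi : Fin (m + 1) → ℝ := fun j => leafHi α x (w j) with hhidef
  -- The arc `A'_j` follows leaf `j - 1`. For `j = 0` this is the last leaf, turned back by `2π` so
  -- that `A'_0` precedes `x` (at angle `ξ`) and `A_0` comes after it.
  set H : Fin (m + 1) → ℝ := fun j => hi (j - 1) - if j = 0 then 2 * Real.pi else 0 with hH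
  have hlast : ∀ j : Fin (m + 1), lo j ≤ lo (0 - 1) := fun j =>
    hwmono.monotone (by
      rw [Fin.le_def, Fin.coe_sub_one, if_pos rfl]; exact Nat.lt_succ_iff.1 j.2)
  have hpred : ∀ j : Fin (m + 1), j ≠ 0 → j - 1 < j := fun j hj =>
    Fin.sub_one_lt_iff.2 (Fin.pos_iff_ne_zero.2 hj)
  have hle_pred : ∀ i j : Fin (m + 1), i < j → i ≤ j - 1 := fun i j hij => by
    rw [Fin.le_def, Fin.coe_sub_one, if_neg (Fin.ne_zero_of_lt hij)]
    exact Nat.le_sub_one_of_lt hij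
  have k1 : ∀ j, ε < lo j - Y := fun j => hlo _ (hwM j)
  have k2 : ∀ j, hi j + X + ε < 2 * Real.pi := fun j => hhi _ (hwM j)
  have k3 : ∀ i j, i < j → hi i + X + ε < lo j - Y - ε := fun i j hij =>
    hgap _ (hwM i) _ (hwM j) (hwmono hij)
  have k4 : ∀ j, lo j < hi j := fun j => hlohi _
  have hH0 : H 0 = hi (0 - 1) - 2 * Real.pi := by simp [hH]
  have hHne : ∀ j, j ≠ 0 → H j = hi (j - 1) := fun j hj => by simp [hH, hj]
  have hA' : ∀ j, angleArc (ξ + (H j + p)) (ξ + (H j + q)) =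
      angleArc (ξ + (hi (j - 1) + p)) (ξ + (hi (j - 1) + q)) := by
    intro j
    by_cases hj : j = 0
    · rw [hj, hH0, ← angleArc_sub_two_pi (ξ + (hi (0 - 1) + p))]
      congr 1 <;> ring
    · rw [hHne j hj]
  have hfA : ∀ j s, leafEnd α (w j) (a (w j)).other * Circle.exp (-y' s) ∈
      angleArc (ξ + (lo j - q')) (ξ + (lo j - p')) := fun j s =>
    ⟨ξ + (lo j - y' s), ⟨by linarith [(hyI' s).2], by linarith [(hyI' s).1]⟩, by
      rw [hLo, hxξ, ← Circle.exp_add, ← Circle.exp_add]; congr 1; simp only [hlodef]; ring⟩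
  have hfA' : ∀ j s, leafEnd α (w j) (a (w j)) * Circle.exp (y s) ∈
      angleArc (ξ + (hi j + p)) (ξ + (hi j + q)) := fun j s =>
    ⟨ξ + (hi j + y s), ⟨by linarith [(hyI s).1], by linarith [(hyI s).2]⟩, by
      rw [hHi, hxξ, ← Circle.exp_add, ← Circle.exp_add]; congr 1; simp only [hhidef]; ring⟩
  have hfm : ∀ j, Measurable fun s => leafEnd α (w j) (a (w j)).other * Circle.exp (-y' s) :=
    fun j => (Continuous.measurable (by fun_prop :
      Continuous fun t : ℝ => leafEnd α (w j) (a (w j)).other * Circle.exp (-t))).comp hy'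
  have hfm' : ∀ j, Measurable fun s => leafEnd α (w j) (a (w j)) * Circle.exp (y s) :=
    fun j => (Continuous.measurable (by fun_prop :
      Continuous fun t : ℝ => leafEnd α (w j) (a (w j)) * Circle.exp t)).comp hy
  have hlen : ∀ j, (w j).length = n := fun j => (hwM j).1
  have hd : ∀ j, 0 < Metric.diam (angleArc (ξ + (lo j - q')) (ξ + (lo j - p'))) := fun j =>
    diam_pos_of_angleArc_subset (by linarith) Subset.rfl
  have hd' : ∀ j, 0 < Metric.diam (angleArc (ξ + (H j + p)) (ξ + (H j + q))) := fun j =>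
    diam_pos_of_angleArc_subset (by linarith) Subset.rfl
  have hdu : ∀ j, 0 < Metric.diam (angleArc (ξ + (lo j - q')) (ξ + (lo j - p')) ∪
      angleArc (ξ + (H j + p)) (ξ + (H j + q))) := fun j =>
    diam_pos_of_angleArc_subset (s := ξ + (H j + p)) (t := ξ + (H j + q)) (by linarith)
      subset_union_right
  refine ⟨m + 1, ?_⟩
  -- There are finitely many arcs, all of positive diameter, and finitely many finite energies, so a
  -- large `C` absorbs everything and the scale can be taken to be `1`.
  filter_upwards [Filter.eventually_all.2 fun j => eventually_comparable (hdu j) one_pos,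
    Filter.eventually_all.2 fun j => eventually_comparable (hd j) (hdu j),
    Filter.eventually_all.2 fun j => eventually_comparable (hdu j) (hd' j),
    Filter.eventually_all.2 fun j => eventually_le_coe
      (rescaledEnergy_map_lt_top (hfm j) (hglue _ _ (hlen j)).2.2 (hd j)),
    Filter.eventually_all.2 fun j => eventually_le_coe
      (rescaledEnergy_map_lt_top (hfm' (j - 1)) (hglue _ _ (hlen (j - 1))).2.1 (hd' j))]
    with C c1 c2 c3 c4 c5
  refine ⟨m, fun j => ξ + (H j + p), fun j => ξ + (H j + q), fun j => ξ + (lo j - q'),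
    fun j => ξ + (lo j - p'),
    fun j => coinMeasure.map fun s => leafEnd α (w j) (a (w j)).other * Circle.exp (-y' s),
    fun j => coinMeasure.map fun s =>
      leafEnd α (w (j - 1)) (a (w (j - 1))) * Circle.exp (y s),
    le_rfl, fun j => ⟨by linarith, ?_, by linarith⟩, fun i j hij => ?_, fun i j => ?_,
    fun j => ⟨c1 j, c2 j, c3 j⟩, fun j => ⟨?_, ?_, ?_, ?_, c4 j, c5 j⟩, fun j => ?_,
    fun j => ⟨?_, ?_⟩, 0, ξ, ⟨?_, ?_⟩, rfl⟩
  · beta_reduce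
    by_cases hj : j = 0
    · rw [hj, hH0]
      linarith [k2 (0 - 1), k1 0]
    · rw [hHne j hj]
      linarith [k3 _ _ (hpred j hj)]
  · beta_reduce
    rw [hHne j (Fin.ne_zero_of_lt hij)]
    have := hwmono.monotone (hle_pred i j hij)
    simp only [Function.comp_apply] at this
    linarith [k4 (j - 1)]
  · beta_reduce
    by_cases hi0 : i = 0
    · rw [hi0, hH0]
      linarith [hlast j, k4 (0 - 1)]
    · rw [hHne i hi0]
      linarith [k4 j, k2 j, k1 (i - 1), k4 (i - 1)]
  · exact Measure.isProbabilityMeasure_map (hfm j).aemeasurable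
  · exact Measure.isProbabilityMeasure_map (hfm' (j - 1)).aemeasurable
  · beta_reduce
    rw [Measure.map_apply (hfm j) (measurableSet_angleArc _ _).compl]
    convert measure_empty (μ := coinMeasure)
    exact eq_empty_of_forall_notMem fun s hs => hs (hfA j s)
  · beta_reduce
    rw [hA', Measure.map_apply (hfm' (j - 1))
      (measurableSet_angleArc _ _).compl]
    convert measure_empty (μ := coinMeasure)
    exact eq_empty_of_forall_notMem fun s hs => hs (hfA' (j - 1) s)
  · beta_reduce
    -- Since `(j + 1) - 1 = j`, the arcs `A_j` and `A'_{j+1}` flank the same leaf; for the last `j`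
    -- this closes the circuit.
    rw [hA', add_sub_cancel_right]
    refine isGlued_map (hfm j) (hfm' j) (hglue _ _ (hlen j)).2.2.injective
      (hglue _ _ (hlen j)).2.1.injective (hfA j) (hfA' j) fun s => ?_
    refine SameItinerary.lamEquiv fun k => ?_
    obtain ⟨l, h1, h2⟩ := (hglue _ (a (w j)) (hlen j)).1 s k
    exact ⟨l, h2, h1⟩
  · rintro _ ⟨r, hr, rfl⟩
    have := hmem _ (hwM j) (r - ξ) (Or.inl ⟨by linarith [hr.1], by linarith [hr.2]⟩)
    rwa [hxξ, ← Circle.exp_add, add_sub_cancel] at this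
  · beta_reduce
    rw [hA']
    rintro _ ⟨r, hr, rfl⟩
    have := hmem _ (hwM (j - 1)) (r - ξ) (Or.inr ⟨by linarith [hr.1], by linarith [hr.2]⟩)
    rwa [hxξ, ← Circle.exp_add, add_sub_cancel] at this
  · beta_reduce
    rw [hH0]
    linarith [k2 (0 - 1)]
  · linarith [k1 0]

/-! ### Uniform constants by compactness -/

lemma Comparable.mono {C C' a b : ℝ} (ha : 0 ≤ a) (hb : 0 ≤ b) (hC : C ≤ C')
    (h : Comparable C a b) : Comparable C' a b :=
  ⟨h.1.trans (mul_le_mul_of_nonneg_right hC hb), h.2.trans (mul_le_mul_of_nonneg_right hC ha)⟩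

lemma HasNiceCircuit.mono {rel : Circle → Circle → Prop} {N N' : ℕ} {C C' : ℝ} {r : ℝ}
    {x : Circle} {D : Set Circle} (hr : 0 ≤ r) (hN : N ≤ N') (hC : C ≤ C')
    (h : HasNiceCircuit rel N C r x D) : HasNiceCircuit rel N' C' r x D := by
  obtain ⟨m, s', t', s, t, μ, μ', h1, h2, h3, h4, h5, h6, h7⟩ := h
  have hCE : (C : EReal) ≤ C' := EReal.coe_le_coe_iff.2 hC
  refine ⟨m, s', t', s, t, μ, μ', h1.trans hN, h2, h3, h4, fun j => ⟨?_, ?_, ?_⟩, fun j => ?_, h7⟩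
  · exact (h5 j).1.mono Metric.diam_nonneg hr hC
  · exact (h5 j).2.1.mono Metric.diam_nonneg Metric.diam_nonneg hC
  · exact (h5 j).2.2.mono Metric.diam_nonneg Metric.diam_nonneg hC
  · obtain ⟨a1, a2, a3, a4, a5, a6⟩ := h6 j
    exact ⟨a1, a2, a3, a4, a5.trans hCE, a6.trans hCE⟩

/-- The point enters only through its membership in an open arc, so the same circuit works for its
neighbours. -/
lemma HasNiceCircuit.eventually {rel : Circle → Circle → Prop} {N : ℕ} {C r : ℝ}
    {x : Circle} {D : Set Circle} (h : HasNiceCircuit rel N C r x D) :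
    ∀ᶠ z in nhds x, HasNiceCircuit rel N C r z D := by
  obtain ⟨m, s', t', s, t, μ, μ', h1, h2, h3, h4, h5, h6, h7, h8, j, hj⟩ := h
  filter_upwards [(isLocalHomeomorph_circleExp.isOpenMap _ isOpen_Ioo).mem_nhds hj] with z hz
  exact ⟨m, s', t', s, t, μ, μ', h1, h2, h3, h4, h5, h6, h7, h8, j, hz⟩

lemma Tame.isGeneric_of_le_infDist (hα : Tame α) {n : ℕ} {D : Set Circle} (hD : D ∈ gcs α n)
    {δ : ℝ} (hδ : 0 < δ) {x : Circle} (hxD : x ∈ D)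
    (hx : ∀ g : List Letter, (∀ l, leafEnd α g l ∈ frontier D) →
      δ ≤ Metric.infDist x (wordBranch α g '' cStar α)) : IsGeneric α n x := by
  obtain ⟨z, hz, rfl⟩ := mem_gcs_iff.1 hD
  rintro u hu l rfl
  have h := hx u (hα.leafEnd_mem_frontier hz hu hxD)
  rw [Metric.infDist_zero_of_mem (show leafEnd α u l ∈ wordBranch α u '' cStar α from
    ⟨_, Tame.starPt_mem_cStar l, rfl⟩)] at h
  exact absurd h hδ.not_ge

/-- Uniform constants for the nice gluing circuits in one generalized cylinder set. -/
lemma Tame.eventually_hasNiceCircuit (hα : Tame α) {n : ℕ} {D : Set Circle} (hD : D ∈ gcs α n)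
    {δ : ℝ} (hδ : 0 < δ) : ∀ᶠ p : ℕ × ℝ in Filter.atTop, ∀ x ∈ D,
      (∀ g : List Letter, (∀ l, leafEnd α g l ∈ frontier D) →
        δ ≤ Metric.infDist x (wordBranch α g '' cStar α)) →
      HasNiceCircuit (LamEquiv α) p.1 p.2 1 x D := by
  have hDc : IsClosed D := by
    obtain ⟨z, hz, rfl⟩ := mem_gcs_iff.1 hD
    exact isClosed_cylinder n z
  -- The non-strict inequality makes this set closed, hence compact.
  set S : Set Circle := {x | x ∈ D ∧ ∀ g : List Letter, (∀ l, leafEnd α g l ∈ frontier D) →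
    δ ≤ Metric.infDist x (wordBranch α g '' cStar α)} with hS
  have hSc : IsCompact S := by
    refine IsClosed.isCompact ?_
    simp only [hS, ofPred_and, ofPred_forall]
    refine hDc.inter (isClosed_iInter fun g => isClosed_iInter fun _ => ?_)
    exact isClosed_le continuous_const (Metric.continuous_infDist_pt _)
  have main : ∀ᶠ p : ℕ × ℝ in Filter.atTop, ∀ x ∈ S,
      HasNiceCircuit (LamEquiv α) p.1 p.2 1 x D := by
    refine hSc.induction_on (p := fun S => ∀ᶠ p : ℕ × ℝ in Filter.atTop, ∀ x ∈ S,
      HasNiceCircuit (LamEquiv α) p.1 p.2 1 x D) (by simp)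
      (fun A B hAB h => h.mono fun p hp x hx => hp x (hAB hx)) (fun A B hA hB => ?_)
      fun x hx => ?_
    · filter_upwards [hA, hB] with p h1 h2 x hx
      exact hx.elim (h1 x) (h2 x)
    · have hgen := hα.isGeneric_of_le_infDist hD hδ hx.1 hx.2
      obtain ⟨z, hz, rfl⟩ := mem_gcs_iff.1 hD
      -- The point `x` is itself a generic base point of `D`, so the construction of the circuit can
      -- be carried out in the coordinate based at `x`.
      have heq := hα.cylinder_eq hz hgen hx.1
      have hout : ∀ u ∈ outerWords α n x, x ∉ wordBranch α u '' cStar α := by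
        intro u hu hxu
        obtain ⟨l, hl⟩ := hα.leafEnd_mem_cylinder hgen hu
        rw [← heq] at hl
        have h := hx.2 u (hα.leafEnd_mem_frontier hz hu.1 hl)
        rw [Metric.infDist_zero_of_mem hxu] at h
        exact absurd h hδ.not_ge
      obtain ⟨N, hN⟩ := hα.exists_circuit hgen hout
      obtain ⟨C, hC⟩ := hN.exists
      rw [← heq] at hC
      refine ⟨_, mem_nhdsWithin_of_mem_nhds hC.eventually, ?_⟩
      filter_upwards [Filter.eventually_ge_atTop (N, C)] with p hp y hy
      exact HasNiceCircuit.mono zero_le_one hp.1 hp.2 hy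
  filter_upwards [main] with p hp x hxD hx
  exact hp x ⟨hxD, hx⟩

/-- A cylinder set is determined by the sides of the finitely many leaves on which its base point
lies. -/
lemma Tame.finite_gcs (hα : Tame α) (n : ℕ) : (gcs α n).Finite := by
  let T : Circle → Set (List Letter) := fun x =>
    {u | u.length = n ∧ x ∈ ccwClosedArc (leafEnd α u .L) (leafEnd α u .R)}
  have hT : (T '' {x | IsGeneric α n x}).Finite :=
    (finite_words n).finite_subsets.subset (by
      rintro _ ⟨x, -, rfl⟩
      exact fun u hu => hu.1)
  have hcyl : ∀ x y, IsGeneric α n x → T x = T y → y ∈ cylinder α n x := by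
    intro x y hx hxy u hu
    have h := Set.ext_iff.1 hxy u
    simp only [T, mem_ofPred_eq, hu, true_and] at h
    by_cases hxu : x ∈ ccwClosedArc (leafEnd α u .L) (leafEnd α u .R)
    · exact Or.inl ⟨hxu, h.1 hxu⟩
    · have hne : leafEnd α u .R ≠ leafEnd α u .L := hα.leafEnd_other_ne u .L
      refine Or.inr ⟨?_, ?_⟩ <;> rw [mem_ccwClosedArc_iff]
      · exact Or.inr (Or.inr ((mem_ccwArc_iff_notMem_ccwClosedArc hne).2 hxu))
      · exact Or.inr (Or.inr ((mem_ccwArc_iff_notMem_ccwClosedArc hne).2 fun hy => hxu (h.2 hy)))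
  obtain ⟨F, hF, hFT⟩ := exists_subset_image_finite_and (f := T) (s := {x | IsGeneric α n x})
    (p := fun t => t = T '' {x | IsGeneric α n x}) |>.1 ⟨_, Subset.rfl, hT, rfl⟩
  refine (hFT.1.image (cylinder α n)).subset ?_
  rintro D hD
  obtain ⟨x, hx, rfl⟩ := mem_gcs_iff.1 hD
  obtain ⟨y, hy, hyx⟩ : T x ∈ T '' F := hFT.2 ▸ mem_image_of_mem T hx
  exact ⟨y, hy, (hα.cylinder_eq (hF hy) hx (hcyl y x (hF hy) hyx))⟩

lemma Tame.exists_uniform_circuit (hα : Tame α) (K : ℕ) {δ : ℝ} (hδ : 0 < δ) :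
    ∃ (N : ℕ) (C r : ℝ), 0 < C ∧ 0 < r ∧ ∀ D : Circle → Set Circle, IsCK α K δ D →
      ∀ x : Circle, HasNiceCircuit (LamEquiv α) N C r x (D x) := by
  have h : ∀ᶠ p : ℕ × ℝ in Filter.atTop, ∀ D ∈ gcs α K ∪ gcs α (K + 1), ∀ x ∈ D,
      (∀ g : List Letter, (∀ l, leafEnd α g l ∈ frontier D) →
        δ ≤ Metric.infDist x (wordBranch α g '' cStar α)) →
      HasNiceCircuit (LamEquiv α) p.1 p.2 1 x D :=
    (Filter.eventually_all_finite ((hα.finite_gcs K).union (hα.finite_gcs (K + 1)))).2 fun D hD =>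
      hD.elim (fun h => hα.eventually_hasNiceCircuit h hδ)
        fun h => hα.eventually_hasNiceCircuit h hδ
  obtain ⟨⟨N, C⟩, h1, h2⟩ := (h.and (Filter.eventually_ge_atTop ((0 : ℕ), (1 : ℝ)))).exists
  refine ⟨N, C, 1, zero_lt_one.trans_le h2.2, one_pos, fun D hD x => ?_⟩
  obtain ⟨a1, a2, a3⟩ := hD x
  exact h1 _ a1 x a2 fun g hg => (a3 g hg).le

end QuadLam

theorem mainTheorem5 (α : Circle) (hSR : ¬ QuadLam.IsStronglyRecurrent α)
    (hpp : ¬ QuadLam.IsPreperiodicAngle α) (K : ℕ) :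
    (∃ δ : ℝ, 0 < δ ∧ ∃ D : Circle → Set Circle, QuadLam.IsCK α K δ D) ∧
    ∀ δ : ℝ, 0 < δ → ∃ (N : ℕ) (C r : ℝ), 0 < C ∧ 0 < r ∧
      ∀ D : Circle → Set Circle, QuadLam.IsCK α K δ D →
        ∀ x : Circle, QuadLam.HasNiceCircuit (QuadLam.LamEquiv α) N C r x (D x) := by
  have hα := QuadLam.tame_of_not_stronglyRecurrent hSR hpp
  exact ⟨hα.exists_isCK K, fun δ hδ => hα.exists_uniform_circuit K hδ⟩
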